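/- Fix $n\ge 2$ and let $\mathfrak V=\{(i,j)\mid 1\le j\le i\le n\}$. A (Gelfand–Tsetlin) tableau $T(L)$ of height $n$ is an array $L=(l_{ij})_{(i,j)\in\mathfrak V}$ of complex numbers. It satisfies the relation $(i,j)\ge(s,t)$ (resp. $(i,j)>(s,t)$) if $l_{ij}-l_{st}\in\mathbb Z_{\ge 0}$ (resp. $\mathbb Z_{>0}$). Let $$\mathcal R=\{(i,j)\ge(i-1,j'),\ (i-1,j')>(i,j)\mid 1\le j\le i\le n,\ 1\le j'\le i-1\},\qquad \mathcal R^0=\{(n,i)\ge(n,j)\mid 1\le i\ne j\le n\}.$$ For $\mathcal C\subseteq\mathcal R\cup\mathcal R^0$ let $\mathfrak V(\mathcal C)$ be the set of positions occurring in relations of $\mathcal C$. Two sets of relations are disconnected if their sets of positions are disjoint; a set is indecomposable if it is not a union of two nonempty disconnected sets. Every $\mathcal C$ is uniquely a union of pairwise disconnected nonempty indecomposable sets, its components. A set $\mathcal C$ implies a relation if every tableau satisfying $\mathcal C$ satisfies that relation. Call $\mathcal C$ noncritical if some tableau satisfies it and every component $\mathcal D$ of $\mathcal C$ has the following two properties: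 (a) if $T(L)$ satisfies $\mathcal D$, then $l_{ki}\ne l_{kj}$ for all $k\le n-1$ and $i\neq j$ with $(k,i),(k,j)\in\mathfrak V(\mathcal D)$; (b) for any $(n,i),(n,j)\in\mathfrak V(\mathcal D)$, $\mathcal D$ implies $(n,i)\ge(n,j)$ or $(n,j)\ge(n,i)$. Then $\mathcal D$ orders its positions in each row. We say that $\mathcal C$ is numbered in order if, for each component $\mathcal D$ and all positions in $\mathfrak V(\mathcal D)$, $\mathcal D$ implies $(k,i)>(k,j)$ with $k\le n-1$, or $(n,i)\ge(n,j)$ with $i\ne j$, only if $i<j$. For a tableau $T(L)$ satisfying $\mathcal C$, let $\mathcal B_{\mathcal C}(T(L))$ be the set of tableaux $T(L+z)$ satisfying $\mathcal C$, where $z$ is an integral vector vanishing on the top row $n$, and let $V_{\mathcal C}(T(L))$ be the complex vector space with basis $\mathcal B_{\mathcal C}(T(L))$. A $\mathcal C$-realization is a tableau $T(L)$ satisfying $\mathcal C$ such that every $T(R)\in\mathcal B_{\mathcal C}(T(L))$ is noncritical, i.e. $r_{ki}\ne r_{kj}$ for $1\le i<j\le k\le n-1$. A strict $\mathcal C$-realization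 is a tableau $T(L)$ satisfying $\mathcal C$ such that, for all $1\le k\le n$ and $i\ne j$, $l_{ki}-l_{kj}\in\mathbb Z$ if and only if $(k,i)$ and $(k,j)$ lie in $\mathfrak V(\mathcal D)$ for one and the same component $\mathcal D$ of $\mathcal C$. The set $\mathcal C$ is called admissible (resp. strictly admissible) if for every $\mathcal C$-realization (resp. strict $\mathcal C$-realization) $T(L)$ the space $V_{\mathcal C}(T(L))$ has a structure of a $\mathfrak{gl}_n$-module in which, for all basis tableaux $T(R)$, the Gelfand–Tsetlin formulas hold: $$E_{k,k+1}T(R)=-\sum_{i=1}^k\frac{\prod_{j=1}^{k+1}(r_{ki}-r_{k+1,j})}{\prod_{j\ne i}(r_{ki}-r_{kj})}T(R+\delta^{ki}),\quad E_{k+1,k}T(R)=\sum_{i=1}^k\frac{\prod_{j=1}^{k-1}(r_{ki}-r_{k-1,j})}{\prod_{j\ne i}(r_{ki}-r_{kj})}T(R-\delta^{ki})\quad(1\le k\le n-1),$$ $$E_{kk}T(R)=\Bigl(k-1+\sum_{i=1}^k r_{ki}-\sum_{i=1}^{k-1}r_{k-1,i}\Bigr)T(R)\quad(1\le k\le n),$$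 where $T(Q)$ is read as $0$ if $T(Q)\notin\mathcal B_{\mathcal C}(T(L))$. Positions $(k,i),(k,j)\in\mathfrak V(\mathcal C)$, $1\le k\le n-1$, form an adjoining pair of an indecomposable $\mathcal C$ if $\mathcal C$ implies $(k,i)>(k,j)$ and there is no $(k,m)\in\mathfrak V(\mathcal C)$ such that $\mathcal C$ implies $(k,i)>(k,m)$ and $(k,m)>(k,j)$. Let $\mathfrak F$ be the set of all indecomposable $\mathcal C\subseteq\mathcal R\cup\mathcal R^0$ such that for every adjoining pair $(k,i),(k,j)$ of $\mathcal C$ one of the following holds: $$\{(k,i)>(k+1,s)\ge(k,j),\ (k,i)\ge(k-1,t)>(k,j)\}\subseteq\mathcal C\ \text{ for some } s,t,$$ $$\{(k,i)>(k+1,s),\ (k+1,t)\ge(k,j)\}\subseteq\mathcal C\ \text{ for some } s<t.$$ **Theorem.** Let $\mathcal C\subseteq\mathcal R\cup\mathcal R^0$ be noncritical and numbered in order. Then $\mathcal C$ is admissible if and only if $\mathcal C$ is a union of pairwise disconnected sets from $\mathfrak F$; likewise, $\mathcal C$ is strictly admissible if and only if $\mathcal C$ is a union of pairwise disconnected sets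 from $\mathfrak F$. -/

import Mathlib

attribute [local instance 100] LieRing.ofAssociativeRing

namespace GelfandTsetlin

/-- The positions of a triangular array of height `n`. The element `⟨k, i⟩` (numbered from zero)
stands for the position `(k + 1, i + 1)`; see `row` and `col`. -/
abbrev Vertex (n : ℕ) : Type := (k : Fin n) × Fin ((k : ℕ) + 1)

/-- The row number, between `1` and `n`. -/
def row {n : ℕ} (a : Vertex n) : ℕ := (a.1 : ℕ) + 1

/-- The place inside the row, between `1` and `row a`. -/
def col {n : ℕ} (a : Vertex n) : ℕ := (a.2 : ℕ) + 1

/-- A Gelfand–Tsetlin tableau `T(L)` of height `n`. -/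
abbrev Tableau (n : ℕ) : Type := Vertex n → ℂ

/-- The formal relations `a ≥ b` and `a > b` between positions. -/
inductive Relation (n : ℕ) : Type
  | ge (a b : Vertex n) : Relation n
  | gt (a b : Vertex n) : Relation n

/-- `T(L)` satisfies `a ≥ b` if `l_a - l_b` is a nonnegative integer, and `a > b` if
`l_a - l_b` is a positive integer. -/
def Holds {n : ℕ} (L : Tableau n) : Relation n → Prop
  | .ge a b => ∃ m : ℕ, L a - L b = (m : ℂ)
  | .gt a b => ∃ m : ℕ, 0 < m ∧ L a - L b = (m : ℂ)

/-- The set `𝓡` of the relations `(i, j) ≥ (i - 1, j')` and `(i - 1, j') > (i, j)`. -/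
def relR (n : ℕ) : Set (Relation n) :=
  {r | ∃ a b : Vertex n, row a = row b + 1 ∧ (r = .ge a b ∨ r = .gt b a)}

/-- The set `𝓡⁰` of the relations `(n, i) ≥ (n, j)` with `i ≠ j`. -/
def relR0 (n : ℕ) : Set (Relation n) :=
  {r | ∃ a b : Vertex n, row a = n ∧ row b = n ∧ a ≠ b ∧ r = .ge a b}

/-- `T(L)` satisfies all relations of `C`. -/
def Satisfies {n : ℕ} (C : Set (Relation n)) (L : Tableau n) : Prop :=
  ∀ r ∈ C, Holds L r

/-- Every tableau that satisfies `C` satisfies the relation `r`. -/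
def Implies {n : ℕ} (C : Set (Relation n)) (r : Relation n) : Prop :=
  ∀ L : Tableau n, Satisfies C L → Holds L r

/-- A tableau is noncritical if the entries of each row other than the top one are distinct. -/
def NoncriticalTableau {n : ℕ} (L : Tableau n) : Prop :=
  ∀ a b : Vertex n, row a = row b → row a < n → a ≠ b → L a ≠ L b

/-- The set `𝓑_C(T(L))` of the tableaux `T(L + z)` that satisfy `C`, where `z` is an integral
vector that vanishes on the top row. -/
def tableauxSet {n : ℕ} (C : Set (Relation n)) (L : Tableau n) : Set (Tableau n) :=
  {R | Satisfies C R ∧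
    ∃ z : Vertex n → ℤ, (∀ a, row a = n → z a = 0) ∧ ∀ a, R a = L a + (z a : ℂ)}

/-- The vector space `V_C(T(L))` with basis `𝓑_C(T(L))`. -/
abbrev TableauxSpace {n : ℕ} (C : Set (Relation n)) (L : Tableau n) : Type :=
  tableauxSet C L →₀ ℂ

open Classical in
/-- The tableau `T(Q)` as an element of `V_C(T(L))`; it is zero if `T(Q)` is not in
`𝓑_C(T(L))`. -/
noncomputable def tab {n : ℕ} (C : Set (Relation n)) (L Q : Tableau n) : TableauxSpace C L :=
  if h : Q ∈ tableauxSet C L then Finsupp.single ⟨Q, h⟩ 1 else 0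

/-- The tableau `T(L + m δ^a)`. -/
def shift {n : ℕ} (L : Tableau n) (a : Vertex n) (m : ℤ) : Tableau n :=
  fun b => if b = a then L b + (m : ℂ) else L b

/-- For `a = (k, i)`, the coefficient of `T(L + δ^{ki})` in `E_{k,k+1} T(L)`. -/
noncomputable def raiseCoeff {n : ℕ} (L : Tableau n) (a : Vertex n) : ℂ :=
  -((∏ b : Vertex n with row b = row a + 1, (L a - L b)) /
    ∏ b : Vertex n with row b = row a ∧ b ≠ a, (L a - L b))

/-- For `a = (k, i)`, the coefficient of `T(L - δ^{ki})` in `E_{k+1,k} T(L)`. -/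
noncomputable def lowerCoeff {n : ℕ} (L : Tableau n) (a : Vertex n) : ℂ :=
  (∏ b : Vertex n with row b + 1 = row a, (L a - L b)) /
    ∏ b : Vertex n with row b = row a ∧ b ≠ a, (L a - L b)

/-- `V_C(T(L))` is a `𝔤𝔩_n`-module whose generators `E_{k,k+1}`, `E_{k+1,k}`, `E_{k,k}` act on the
basis tableaux by the Gelfand–Tsetlin formulas. The index `k : Fin n` of a matrix unit stands for
the number `k + 1`, so it goes with row `k + 1` of the tableau. -/
def IsGTModule {n : ℕ} (C : Set (Relation n)) (L : Tableau n) : Prop :=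
  ∃ ρ : Matrix (Fin n) (Fin n) ℂ →ₗ⁅ℂ⁆ Module.End ℂ (TableauxSpace C L),
    ∀ R ∈ tableauxSet C L,
      (∀ k l : Fin n, (l : ℕ) = k + 1 →
        ρ (Matrix.single k l 1) (tab C L R) =
            ∑ a : Vertex n with row a = k + 1, raiseCoeff R a • tab C L (shift R a 1) ∧
        ρ (Matrix.single l k 1) (tab C L R) =
            ∑ a : Vertex n with row a = k + 1, lowerCoeff R a • tab C L (shift R a (-1))) ∧
      ∀ k : Fin n,
        ρ (Matrix.single k k 1) (tab C L R) =
          (((k : ℕ) : ℂ) + ∑ a : Vertex n with row a = k + 1, R a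
            - ∑ a : Vertex n with row a = k, R a) • tab C L R

/-- The set `𝔙(C)` of the positions that occur in the relations of `C`. -/
def vertices {n : ℕ} (C : Set (Relation n)) : Set (Vertex n) :=
  {a | ∃ b : Vertex n, .ge a b ∈ C ∨ .ge b a ∈ C ∨ .gt a b ∈ C ∨ .gt b a ∈ C}

/-- No position occurs in both sets. -/
def Disconnected {n : ℕ} (C₁ C₂ : Set (Relation n)) : Prop :=
  Disjoint (vertices C₁) (vertices C₂)

/-- `C` is not the union of two nonempty disconnected sets. -/
def Indecomposable {n : ℕ} (C : Set (Relation n)) : Prop :=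
  ¬ ∃ C₁ C₂ : Set (Relation n),
    C₁.Nonempty ∧ C₂.Nonempty ∧ Disconnected C₁ C₂ ∧ C₁ ∪ C₂ = C

/-- `D` is one of the indecomposable sets in the decomposition of `C` into disconnected
indecomposable sets. -/
def IsComponent {n : ℕ} (C D : Set (Relation n)) : Prop :=
  D ⊆ C ∧ D.Nonempty ∧ Indecomposable D ∧ Disconnected D (C \ D)

/-- A set of relations is noncritical if some tableau satisfies it and, for each of its
indecomposable components `D`: in a tableau that satisfies `D`, entries at distinct positions of
`𝔙(D)` in the same row below the top row never coincide, and the positions of `𝔙(D)` in the top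
row are ordered by the relations of `D`. -/
def IsNoncritical {n : ℕ} (C : Set (Relation n)) : Prop :=
  (∃ L : Tableau n, Satisfies C L) ∧
  ∀ D, IsComponent C D →
    (∀ L : Tableau n, Satisfies D L → ∀ a ∈ vertices D, ∀ b ∈ vertices D,
      row a = row b → row a < n → a ≠ b → L a ≠ L b) ∧
    ∀ a ∈ vertices D, ∀ b ∈ vertices D, row a = n → row b = n →
      Implies D (.ge a b) ∨ Implies D (.ge b a)

/-- The order that each indecomposable component of `C` defines on its positions in a row agrees
with the numbering: `(k, i) > (k, j)` with `k < n`, and `(n, i) ≥ (n, j)` with `i ≠ j`, only if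
`i < j`. -/
def IsNumberedInOrder {n : ℕ} (C : Set (Relation n)) : Prop :=
  ∀ D, IsComponent C D → ∀ a ∈ vertices D, ∀ b ∈ vertices D, row a = row b →
    (row a < n → Implies D (.gt a b) → col a < col b) ∧
    (row a = n → a ≠ b → Implies D (.ge a b) → col a < col b)

/-- `T(L)` is a `C`-realization: it satisfies `C`, and all tableaux of `𝓑_C(T(L))` are
noncritical. -/
def IsRealization {n : ℕ} (C : Set (Relation n)) (L : Tableau n) : Prop :=
  Satisfies C L ∧ ∀ R ∈ tableauxSet C L, NoncriticalTableau R

/-- `T(L)` satisfies `C`, and the entries at two different positions of the same row differ by an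
integer if and only if both positions belong to the same indecomposable component of `C`. -/
def IsStrictRealization {n : ℕ} (C : Set (Relation n)) (L : Tableau n) : Prop :=
  Satisfies C L ∧ ∀ a b : Vertex n, row a = row b → a ≠ b →
    ((∃ m : ℤ, L a - L b = (m : ℂ)) ↔
      ∃ D, IsComponent C D ∧ a ∈ vertices D ∧ b ∈ vertices D)

/-- `C` is admissible: for every `C`-realization `T(L)`, the Gelfand–Tsetlin formulas make
`V_C(T(L))` a `𝔤𝔩_n`-module. -/
def IsAdmissible {n : ℕ} (C : Set (Relation n)) : Prop :=
  ∀ L : Tableau n, IsRealization C L → IsGTModule C L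

/-- Admissibility tested on strict realizations only. -/
def IsStrictlyAdmissible {n : ℕ} (C : Set (Relation n)) : Prop :=
  ∀ L : Tableau n, IsStrictRealization C L → IsGTModule C L

/-- `a = (k, i)` and `b = (k, j)`, `1 ≤ k ≤ n - 1`, form an adjoining pair of `C`: they are
neighbours, `(k, i) > (k, j)`, for the order that `C` defines on its positions in row `k`. -/
def IsAdjoining {n : ℕ} (C : Set (Relation n)) (a b : Vertex n) : Prop :=
  a ∈ vertices C ∧ b ∈ vertices C ∧ row a = row b ∧ row a < n ∧ Implies C (.gt a b) ∧
  ¬ ∃ c ∈ vertices C, row c = row a ∧ Implies C (.gt a c) ∧ Implies C (.gt c b)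

/-- The set `𝔉` of the indecomposable subsets of `𝓡 ∪ 𝓡⁰` each of whose adjoining pairs
`(k, i)`, `(k, j)` satisfies one of
`{(k, i) > (k+1, s) ≥ (k, j), (k, i) ≥ (k-1, t) > (k, j)} ⊆ C` for some `s`, `t`, or
`{(k, i) > (k+1, s), (k+1, t) ≥ (k, j)} ⊆ C` for some `s < t`. -/
def familyF (n : ℕ) : Set (Set (Relation n)) :=
  {C | C ⊆ relR n ∪ relR0 n ∧ Indecomposable C ∧
    ∀ a b : Vertex n, IsAdjoining C a b →
      (∃ s t : Vertex n, row s = row a + 1 ∧ row t + 1 = row a ∧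
        {.gt a s, .ge s b, .ge a t, .gt t b} ⊆ C) ∨
      (∃ s t : Vertex n, row s = row a + 1 ∧ row t = row a + 1 ∧ col s < col t ∧
        {.gt a s, .ge t b} ⊆ C)}

/-- `C` is a union of pairwise disconnected sets from `𝔉`. -/
def IsDisconnectedUnionOfF {n : ℕ} (C : Set (Relation n)) : Prop :=
  ∃ 𝒟 : Set (Set (Relation n)),
    𝒟 ⊆ familyF n ∧ 𝒟.Pairwise Disconnected ∧ ⋃₀ 𝒟 = C

end GelfandTsetlin

/-! The formulas define a module exactly when the operators on the basis tableaux satisfy the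
Serre-type presentation of $\mathfrak{gl}_n$. Discarding tableaux outside the basis is mostly
harmless. A step that leaves the basis is stopped by a relation that holds with equality, and such a
relation makes a factor in the numerator of the step, or of a neighbouring step on the path, equal
to zero. So the generic identities survive unless a denominator vanishes as well, which is a danger
only when two entries of one row satisfy $l_a=l_b+1$.

For $[E_{k,k+1},E_{k+1,k}]$ this danger is measured by residues. The commutator is diagonal, and its
scalar is the sum of the residues of
$$\prod_s(z-1-l_{k+1,s})\prod_t(z-l_{k-1,t})\Big/\prod_c(z-l_{kc})(z-1-l_{kc})$$ over its simple
poles. The behaviour at infinity gives the value that the weights require, and a double pole sits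
precisely where $l_a=l_b+1$. With $x/0=0$ the formulas leave out the double poles, so the relation
holds when each of them is cancelled by a double zero (`diagonal_sum`), and it fails if there is a
single double pole met by a simple zero only (`diagonal_sum_ne`). The two alternatives in the
definition of $\mathfrak F$ provide exactly the double zero: one zero from the row above and one
from the row below, or two zeros from the row above, which must then be the top row. Unlinked
positions with $l_a=l_b+1$ satisfy the same requirement, because in a realization no step may make
the entries equal, so relations hold with equality at both of them (`bounds_of_eq_add_one`). The
same information shows that no path occurring in a Serre relation starts at such a pair
(`not_step_of_eq_add_one_aux`), so its denominators do not vanish. This proves that unions of sets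
from $\mathfrak F$ are admissible.

Strict realizations are realizations, so admissible sets are strictly admissible. To return from
strict admissibility to $\mathfrak F$, consider an adjoining pair $a,b$ that violates the condition,
in the lowest possible row. Then exactly one position $m$ lies strictly between $a$ and $b$
(`IsComponent.exists_middle`). A strict realization can be chosen with $l_a=l_b+1$, with $m$ giving
the only zero at this double pole, and with no other pair at distance one in the row. The diagonal
scalar is then wrong (`not_isStrictlyAdmissible_of_middle`). -/

namespace GelfandTsetlin

/-! ### Commutators of matrix units from a Serre-type presentation of $\mathfrak{gl}_n$ -/

section Presentation

variable {M : Type*} [LieRing M]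

/-- The Serre-type relations between the elements `e k`, `f k` (`k + 1 < n`) and `h k` (`k < n`)
that present `𝔤𝔩_n`. -/
structure GLRelations (n : ℕ) (e f h : ℕ → M) : Prop where
  hh : ∀ k l, k < n → l < n → ⁅h k, h l⁆ = 0
  he : ∀ k l, k < n → l + 1 < n →
    ⁅h k, e l⁆ = (if k = l then e l else 0) - (if k = l + 1 then e l else 0)
  hf : ∀ k l, k < n → l + 1 < n →
    ⁅h k, f l⁆ = (if k = l + 1 then f l else 0) - (if k = l then f l else 0)
  ef : ∀ k l, k + 1 < n → l + 1 < n → ⁅e k, f l⁆ = if k = l then h k - h (k + 1) else 0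
  ee : ∀ k l, k + 1 < l → l + 1 < n → ⁅e k, e l⁆ = 0
  ff : ∀ k l, k + 1 < l → l + 1 < n → ⁅f k, f l⁆ = 0
  eee : ∀ k, k + 2 < n → ⁅e k, ⁅e k, e (k + 1)⁆⁆ = 0
  eee' : ∀ k, k + 2 < n → ⁅e (k + 1), ⁅e (k + 1), e k⁆⁆ = 0
  fff : ∀ k, k + 2 < n → ⁅f k, ⁅f k, f (k + 1)⁆⁆ = 0
  fff' : ∀ k, k + 2 < n → ⁅f (k + 1), ⁅f (k + 1), f k⁆⁆ = 0

/-- The image of the matrix unit `E_{ij}`, `i < j`, as an iterated commutator. -/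
def upper (e : ℕ → M) (i : ℕ) : ℕ → M
  | 0 => 0
  | j + 1 => if j = i then e i else ⁅upper e i j, e j⁆

theorem upper_self_succ (e : ℕ → M) (i : ℕ) : upper e i (i + 1) = e i := by
  simp [upper]

theorem upper_succ (e : ℕ → M) {i j : ℕ} (h : i < j) : upper e i (j + 1) = ⁅upper e i j, e j⁆ := by
  simp [upper, h.ne']

namespace GLRelations

variable {n : ℕ} {e f h : ℕ → M}

/-- The relations are invariant under the automorphism `x ↦ -xᵀ` of `𝔤𝔩_n`. -/
theorem neg (H : GLRelations n e f h) :
    GLRelations n (fun k => -f k) (fun k => -e k) (fun k => -h k) where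
  hh k l hk hl := by simp [H.hh k l hk hl]
  he k l hk hl := by simp only [lie_neg, neg_lie, neg_neg, H.hf k l hk hl]; split_ifs <;> simp
  hf k l hk hl := by simp only [lie_neg, neg_lie, neg_neg, H.he k l hk hl]; split_ifs <;> simp
  ef k l hk hl := by
    simp only [lie_neg, neg_lie, neg_neg]
    rw [← lie_skew, H.ef l k hl hk]
    by_cases hkl : k = l
    · subst hkl; simp [neg_add_eq_sub]
    · simp [hkl, Ne.symm hkl]
  ee k l hk hl := by simp [H.ff k l hk hl]
  ff k l hk hl := by simp [H.ee k l hk hl]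
  eee k hk := by simp [H.fff k hk]
  eee' k hk := by simp [H.fff' k hk]
  fff k hk := by simp [H.eee k hk]
  fff' k hk := by simp [H.eee' k hk]

theorem lie_h_upper (H : GLRelations n e f h) (k i j : ℕ) (hk : k < n) (hij : i < j) (hj : j < n) :
    ⁅h k, upper e i j⁆ =
      (if k = i then upper e i j else 0) - (if k = j then upper e i j else 0) := by
  induction j, hij using Nat.le_induction with
  | base => rw [upper_self_succ, H.he k i hk hj]
  | succ j hij ih =>
    have hij' : i < j := hij
    rw [upper_succ e hij', leibniz_lie, ih (by omega), H.he k j hk hj]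
    split_ifs <;> first | omega | (simp; done) |
      (subst_vars; rw [zero_sub, neg_lie, sub_zero, neg_add_cancel, sub_zero])

theorem lie_upper_e_of_lt (H : GLRelations n e f h) (i j k : ℕ) (hij : i < j) (hjk : j < k)
    (hk : k + 1 < n) : ⁅upper e i j, e k⁆ = 0 := by
  induction j, hij using Nat.le_induction with
  | base => rw [upper_self_succ, H.ee i k hjk hk]
  | succ j hij ih =>
    have hij' : i < j := hij
    rw [upper_succ e hij', lie_lie, H.ee j k hjk hk, ih (by omega)]
    simp

theorem lie_e_upper_of_lt (H : GLRelations n e f h) (i j k : ℕ) (hij : i < j) (hki : k + 1 < i)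
    (hj : j < n) : ⁅e k, upper e i j⁆ = 0 := by
  induction j, hij using Nat.le_induction with
  | base => rw [upper_self_succ, H.ee k i hki hj]
  | succ j hij ih =>
    have hij' : i < j := hij
    rw [upper_succ e hij', leibniz_lie, H.ee k j (by omega) hj, ih (by omega)]
    simp

theorem lie_e_upper_left (H : GLRelations n e f h) (k j : ℕ) (hkj : k + 1 < j) (hj : j < n) :
    ⁅e k, upper e (k + 1) j⁆ = upper e k j := by
  induction j, hkj using Nat.le_induction with
  | base => rw [upper_self_succ, upper_succ e (by omega), upper_self_succ]
  | succ j hij ih =>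
    have hij' : k + 1 < j := hij
    rw [upper_succ e hij', leibniz_lie, H.ee k j (by omega) hj, ih (by omega),
      upper_succ e (by omega)]
    simp

/-- `[E_{k,k+1}, E_{k-1,k+1}] = 0` in the form needed for the induction. -/
theorem lie_e_upper_last (H : GLRelations n e f h) (i k : ℕ) (hik : i ≤ k) (hk : k + 1 < n) :
    ⁅e k, upper e i (k + 1)⁆ = 0 := by
  rcases hik.eq_or_lt with rfl | hik
  · rw [upper_self_succ, lie_self]
  · obtain ⟨k, rfl⟩ : ∃ m, k = m + 1 := ⟨k - 1, by omega⟩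
    rcases (Nat.lt_succ_iff.mp hik).eq_or_lt with rfl | hik'
    · rw [upper_succ e (by omega), upper_self_succ, ← lie_skew (e i), lie_neg, H.eee' i hk, neg_zero]
    · have h0 : ⁅e (k + 1), upper e i k⁆ = 0 := by
        rw [← lie_skew, H.lie_upper_e_of_lt i k (k + 1) hik' (by omega) hk, neg_zero]
      rw [upper_succ e (by omega), upper_succ e hik', ← lie_skew (⁅upper e i k, e k⁆), lie_neg,
        leibniz_lie (e (k + 1)) (upper e i k), h0, zero_lie, zero_add, leibniz_lie, h0, H.eee' k hk]
      simp

/-- The critical case is $j=k+2$, $i<k$. Expanding $[e_k,[u,[e_k,e_{k+1}]]]$ with $u=E_{ik}$ by the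
Jacobi identity, in two ways, shows that the element equals its own negative. Hence the absence of
additive torsion is needed. Larger $j$ follow because $e_k$ commutes with the further factors. -/
theorem lie_e_upper_mid (H : GLRelations n e f h) [IsAddTorsionFree M] (i j k : ℕ) (hik : i ≤ k)
    (hkj : k + 1 < j) (hj : j < n) : ⁅e k, upper e i j⁆ = 0 := by
  induction j, hkj using Nat.le_induction with
  | base =>
    rcases hik.eq_or_lt with rfl | hik
    · rw [upper_succ e (by omega), upper_self_succ, H.eee i (by omega)]
    · have h0 : ⁅upper e i k, e (k + 1)⁆ = 0 :=
        H.lie_upper_e_of_lt i k (k + 1) hik (by omega) (by omega)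
      have h1 : upper e i (k + 1 + 1) = ⁅upper e i k, ⁅e k, e (k + 1)⁆⁆ := by
        rw [upper_succ e (by omega), upper_succ e hik, lie_lie, h0]; simp
      have h2 : ⁅upper e i (k + 1), e k⁆ = 0 := by
        rw [← lie_skew, H.lie_e_upper_last i k hik.le (by omega), neg_zero]
      have h3 : ⁅e k, upper e i (k + 1 + 1)⁆ = -⁅e k, upper e i (k + 1 + 1)⁆ := by
        conv_lhs => rw [h1, leibniz_lie, H.eee k (by omega), lie_zero, add_zero,
          ← lie_skew (e k), ← upper_succ e hik, neg_lie, leibniz_lie, h2, zero_lie,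
          zero_add, ← upper_succ e (by omega)]
      exact self_eq_neg.mp h3
  | succ j hij ih =>
    have hij' : k + 1 < j := hij
    rw [upper_succ e (by omega), leibniz_lie, H.ee k j (by omega) hj, ih (by omega)]
    simp

theorem lie_e_upper (H : GLRelations n e f h) [IsAddTorsionFree M] (i j k : ℕ) (hij : i < j)
    (hj : j < n) (hk : k + 1 < n) : ⁅e k, upper e i j⁆ =
      (if k + 1 = i then upper e k j else 0) - (if k = j then upper e i (k + 1) else 0) := by
  rcases lt_trichotomy (k + 1) i with h1 | rfl | h1
  · rw [H.lie_e_upper_of_lt i j k hij h1 hj, if_neg (by omega), if_neg (by omega), sub_zero]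
  · rw [H.lie_e_upper_left k j hij hj, if_pos rfl, if_neg (by omega), sub_zero]
  · rw [if_neg (by omega), zero_sub]
    rcases lt_trichotomy k j with h2 | rfl | h2
    · rw [if_neg (by omega), neg_zero]
      rcases (show k + 1 ≤ j from h2).eq_or_lt with rfl | h3
      · exact H.lie_e_upper_last i k (by omega) hk
      · exact H.lie_e_upper_mid i j k (by omega) h3 hj
    · rw [if_pos rfl, ← lie_skew, upper_succ e hij]
    · rw [if_neg (by omega), ← lie_skew, H.lie_upper_e_of_lt i j k hij h2 hk]

theorem lie_f_upper (H : GLRelations n e f h) (i j k : ℕ) (hij : i < j) (hj : j < n)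
    (hk : k + 1 < n) : ⁅f k, upper e i j⁆ =
      (if k = i then if k + 1 = j then h j else upper e (k + 1) j else 0) -
        (if k + 1 = j then if k = i then h i else upper e i k else 0) := by
  induction j, hij using Nat.le_induction with
  | base =>
    rw [upper_self_succ, ← lie_skew, H.ef i k hj hk]
    by_cases hki : k = i
    · subst hki; simp
    · simp [hki, Ne.symm hki]
  | succ j hij ih =>
    have hij' : i < j := hij
    rw [upper_succ e hij', leibniz_lie, ih (by omega), ← lie_skew (f k), H.ef j k hj hk]
    rcases eq_or_ne k j with rfl | hkj
    · have := H.lie_h_upper k i k (by omega) hij' (by omega)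
      have h2 := H.lie_h_upper (k + 1) i k (by omega) hij' (by omega)
      simp only [if_neg hij'.ne', if_neg (show ¬ k + 1 = k by omega), if_true, zero_sub, sub_zero,
        if_neg (show ¬ k + 1 = i by omega)] at this h2 ⊢
      rw [← lie_skew] at this h2
      simp only [neg_inj, neg_eq_zero] at this h2
      simp [lie_sub, this, h2]
    · rw [if_neg hkj.symm, if_neg (show ¬ k + 1 = j + 1 by omega)]
      by_cases h1 : k = i
      · subst h1
        by_cases h2 : k + 1 = j
        · subst h2
          simp only [↓reduceIte]
          rw [sub_lie, H.he _ _ (by omega) hj, H.he _ _ (by omega) hj, upper_self_succ]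
          simp [show k ≠ k + 1 + 1 by omega, upper_self_succ]
        · rw [if_pos rfl, if_neg h2, if_neg h2, if_pos rfl, if_neg (by omega),
            upper_succ e (by omega)]
          simp
      · rw [if_neg h1, if_neg h1]
        by_cases h2 : k + 1 = j
        · subst h2
          rw [if_pos rfl, if_neg h1, zero_sub, neg_lie,
            H.lie_upper_e_of_lt i k (k + 1) (by omega) (by omega) hj]
          simp
        · rw [if_neg h2]; simp [h1, hkj]

end GLRelations

/-- The images of all matrix units. -/
def unitImage (e f h : ℕ → M) (i j : ℕ) : M :=
  if i < j then upper e i j else if i = j then h i else -upper (fun k => -f k) j i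

namespace GLRelations

variable {n : ℕ} {e f h : ℕ → M}

/-- Below the diagonal the automorphism `H.neg` exchanges raising and lowering generators, so
`lie_f_upper` applies to the negated generators. The sign in the lower half of `unitImage` is the
one of $x\mapsto -x^T$. -/
theorem lie_e_unitImage (H : GLRelations n e f h) [IsAddTorsionFree M] (i j k : ℕ) (hi : i < n)
    (hj : j < n) (hk : k + 1 < n) : ⁅e k, unitImage e f h i j⁆ =
      (if k + 1 = i then unitImage e f h k j else 0) -
        (if k = j then unitImage e f h i (k + 1) else 0) := by
  unfold unitImage
  rcases lt_trichotomy i j with hij | rfl | hij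
  · rw [if_pos hij, H.lie_e_upper i j k hij hj hk]
    split_ifs <;> first | omega | rfl
  · rw [if_neg (by omega), if_pos rfl, ← lie_skew, H.he i k hi hk]
    split_ifs <;> first | omega | (subst_vars; simp [upper_self_succ])
  · have := H.neg.lie_f_upper j i k hij hi hk
    rw [neg_lie, neg_eq_iff_eq_neg] at this
    rw [if_neg (by omega), if_neg (by omega), lie_neg, this, neg_neg]
    split_ifs <;> first | omega | (subst_vars; simp [neg_add_eq_sub])

theorem lie_f_unitImage (H : GLRelations n e f h) [IsAddTorsionFree M] (i j k : ℕ) (hi : i < n)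
    (hj : j < n) (hk : k + 1 < n) : ⁅f k, unitImage e f h i j⁆ =
      (if k = i then unitImage e f h (k + 1) j else 0) -
        (if k + 1 = j then unitImage e f h i k else 0) := by
  unfold unitImage
  rcases lt_trichotomy i j with hij | rfl | hij
  · rw [if_pos hij, H.lie_f_upper i j k hij hj hk]
    split_ifs <;> first | omega | (subst_vars; rfl)
  · rw [if_neg (by omega), if_pos rfl, ← lie_skew, H.hf i k hi hk]
    split_ifs <;> first | omega | (subst_vars; simp [upper_self_succ])
  · have := H.neg.lie_e_upper j i k hij hi hk
    rw [neg_lie, neg_eq_iff_eq_neg] at this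
    rw [if_neg (by omega), if_neg (by omega), lie_neg, this, neg_neg]
    split_ifs <;> first | omega | (subst_vars; simp)

theorem lie_h_unitImage (H : GLRelations n e f h) (i j k : ℕ) (hi : i < n)
    (hj : j < n) (hk : k < n) : ⁅h k, unitImage e f h i j⁆ =
      (if k = i then unitImage e f h k j else 0) -
        (if k = j then unitImage e f h i k else 0) := by
  unfold unitImage
  rcases lt_trichotomy i j with hij | rfl | hij
  · rw [if_pos hij, H.lie_h_upper k i j hk hij hj]
    split_ifs <;> first | omega | (subst_vars; rfl)
  · rw [if_neg (by omega), if_pos rfl, H.hh k i hk hi]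
    split_ifs <;> first | omega | (subst_vars; simp)
  · have := H.neg.lie_h_upper k j i hk hij hi
    rw [neg_lie, neg_eq_iff_eq_neg] at this
    rw [if_neg (by omega), if_neg (by omega), lie_neg, this, neg_neg]
    split_ifs <;> first | omega | (subst_vars; simp)

end GLRelations

end Presentation

/-! ### From the presentation to a homomorphism of Lie algebras -/

section LieHom

variable {M : Type*} [LieRing M] [LieAlgebra ℂ M] {n : ℕ} {e f h : ℕ → M}

/-- The linear extension of `unitImage` to all matrices. -/
noncomputable def matrixMap (n : ℕ) (e f h : ℕ → M) : Matrix (Fin n) (Fin n) ℂ →ₗ[ℂ] M where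
  toFun x := ∑ i : Fin n, ∑ j : Fin n, x i j • unitImage e f h i j
  map_add' x y := by simp [add_smul, Finset.sum_add_distrib]
  map_smul' c x := by simp [mul_smul, Finset.smul_sum]

theorem matrixMap_single (i j : Fin n) :
    matrixMap n e f h (Matrix.single i j 1) = unitImage e f h i j := by
  simp only [matrixMap, LinearMap.coe_mk, AddHom.coe_mk]
  rw [Finset.sum_eq_single i, Finset.sum_eq_single j]
  · simp
  · intro b _ hb; simp [Matrix.single, Ne.symm hb]
  · simp
  · intro b _ hb; simp [Matrix.single, Ne.symm hb]
  · simp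

theorem single_lie_single (i j k l : Fin n) :
    ⁅(Matrix.single i j 1 : Matrix (Fin n) (Fin n) ℂ),
      (Matrix.single k l 1 : Matrix (Fin n) (Fin n) ℂ)⁆ =
      (if j = k then Matrix.single i l 1 else 0) - (if l = i then Matrix.single k j 1 else 0) := by
  rw [Ring.lie_def]
  congr 1
  · split_ifs with hjk
    · subst hjk; simp
    · rw [Matrix.single_mul_single_of_ne _ _ _ _ hjk]
  · split_ifs with hjk
    · subst hjk; simp
    · rw [Matrix.single_mul_single_of_ne _ _ _ _ hjk]

/-- The matrices on which `matrixMap` is multiplicative with respect to all matrices. -/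
noncomputable def multiplicativeSubalgebra (g : Matrix (Fin n) (Fin n) ℂ →ₗ[ℂ] M) :
    LieSubalgebra ℂ (Matrix (Fin n) (Fin n) ℂ) where
  carrier := {x | ∀ y, g ⁅x, y⁆ = ⁅g x, g y⁆}
  add_mem' hx hy z := by rw [add_lie, map_add, hx, hy, map_add, add_lie]
  zero_mem' := by intro y; simp
  smul_mem' c x hx y := by rw [smul_lie, map_smul, hx, map_smul, smul_lie]
  lie_mem' {x y} hx hy z := by
    rw [lie_lie, map_sub, hx, hy, hx, hy, hx, lie_lie]

theorem mem_multiplicativeSubalgebra_of_single {g : Matrix (Fin n) (Fin n) ℂ →ₗ[ℂ] M}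
    {x : Matrix (Fin n) (Fin n) ℂ}
    (hx : ∀ i j : Fin n, g ⁅x, Matrix.single i j 1⁆ = ⁅g x, g (Matrix.single i j 1)⁆) :
    x ∈ multiplicativeSubalgebra g := by
  intro y
  induction y using Matrix.induction_on' with
  | h_zero => simp
  | h_add p q hp hq => rw [lie_add, map_add, hp, hq, map_add, lie_add]
  | h_std_basis i j c =>
    rw [show Matrix.single i j c = c • Matrix.single i j (1 : ℂ) by simp, lie_smul, map_smul, hx,
      map_smul, lie_smul]

/-- Elements that satisfy the defining relations of `𝔤𝔩_n` give a homomorphism from `𝔤𝔩_n`. -/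
theorem GLRelations.exists_lieHom (H : GLRelations n e f h) :
    ∃ ρ : Matrix (Fin n) (Fin n) ℂ →ₗ⁅ℂ⁆ M,
      (∀ k l : Fin n, (l : ℕ) = k + 1 → ρ (Matrix.single k l 1) = e k ∧
        ρ (Matrix.single l k 1) = f k) ∧
      ∀ k : Fin n, ρ (Matrix.single k k 1) = h k := by
  have : IsAddTorsionFree M := IsAddTorsionFree.of_isTorsionFree ℂ M
  set g := matrixMap n e f h with hg
  have he : ∀ k l : Fin n, (l : ℕ) = k + 1 → g (Matrix.single k l 1) = e k := by
    intro k l hkl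
    rw [hg, matrixMap_single, unitImage, if_pos (by omega), hkl, upper_self_succ]
  have hf : ∀ k l : Fin n, (l : ℕ) = k + 1 → g (Matrix.single l k 1) = f k := by
    intro k l hkl
    rw [hg, matrixMap_single, unitImage, if_neg (by omega), if_neg (by omega), hkl,
      upper_self_succ, neg_neg]
  have hh : ∀ k : Fin n, g (Matrix.single k k 1) = h k := by
    intro k
    rw [hg, matrixMap_single, unitImage, if_neg (by omega), if_pos rfl]
  have me : ∀ k l : Fin n, (l : ℕ) = k + 1 →
      Matrix.single k l 1 ∈ multiplicativeSubalgebra g := by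
    intro k l hkl
    refine mem_multiplicativeSubalgebra_of_single fun i j => ?_
    rw [he k l hkl, single_lie_single, map_sub, hg, matrixMap_single,
      H.lie_e_unitImage i j k i.2 j.2 (by omega)]
    congr 1
    · by_cases hli : l = i
      · rw [if_pos hli, if_pos (by omega), matrixMap_single]
      · rw [if_neg hli, if_neg (by omega), map_zero]
    · by_cases hjk : j = k
      · rw [if_pos hjk, if_pos (by omega), matrixMap_single, hkl]
      · rw [if_neg hjk, if_neg (by omega), map_zero]
  have mf : ∀ k l : Fin n, (l : ℕ) = k + 1 →
      Matrix.single l k 1 ∈ multiplicativeSubalgebra g := by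
    intro k l hkl
    refine mem_multiplicativeSubalgebra_of_single fun i j => ?_
    rw [hf k l hkl, single_lie_single, map_sub, hg, matrixMap_single,
      H.lie_f_unitImage i j k i.2 j.2 (by omega)]
    congr 1
    · by_cases hli : k = i
      · rw [if_pos hli, if_pos (by omega), matrixMap_single, hkl]
      · rw [if_neg hli, if_neg (by omega), map_zero]
    · by_cases hjk : j = l
      · rw [if_pos hjk, if_pos (by omega), matrixMap_single]
      · rw [if_neg hjk, if_neg (by omega), map_zero]
  have mh : ∀ k : Fin n, Matrix.single k k 1 ∈ multiplicativeSubalgebra g := by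
    intro k
    refine mem_multiplicativeSubalgebra_of_single fun i j => ?_
    rw [hh k, single_lie_single, map_sub, hg, matrixMap_single,
      H.lie_h_unitImage i j k i.2 j.2 k.2]
    congr 1
    · by_cases hli : k = i
      · rw [if_pos hli, if_pos (by omega), matrixMap_single]
      · rw [if_neg hli, if_neg (by omega), map_zero]
    · by_cases hjk : j = k
      · rw [if_pos hjk, if_pos (by omega), matrixMap_single]
      · rw [if_neg hjk, if_neg (by omega), map_zero]
  -- Induction on the distance from the diagonal: a farther matrix unit is a commutator of nearer
  -- ones, and the multiplicative matrices form a Lie subalgebra.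
  have mu : ∀ d : ℕ, ∀ i j : Fin n, (j : ℕ) = i + 1 + d →
      Matrix.single i j 1 ∈ multiplicativeSubalgebra g ∧
      Matrix.single j i 1 ∈ multiplicativeSubalgebra g := by
    intro d
    induction d with
    | zero => intro i j hij; exact ⟨me i j hij, mf i j hij⟩
    | succ d ih =>
      intro i j hij
      have hm : (i : ℕ) + 1 + d < n := by omega
      obtain ⟨h1, h2⟩ := ih i ⟨i + 1 + d, hm⟩ rfl
      have h3 := me ⟨i + 1 + d, hm⟩ j (by simp; omega)
      have h4 := mf ⟨i + 1 + d, hm⟩ j (by simp; omega)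
      have hne : j ≠ i := by intro h; rw [h] at hij; omega
      constructor
      · have := (multiplicativeSubalgebra g).lie_mem h1 h3
        rwa [single_lie_single, if_pos rfl, if_neg hne, sub_zero] at this
      · have := (multiplicativeSubalgebra g).lie_mem h4 h2
        rwa [single_lie_single, if_pos rfl, if_neg hne.symm, sub_zero] at this
  have key : ∀ x, x ∈ multiplicativeSubalgebra g := by
    intro x
    induction x using Matrix.induction_on' with
    | h_zero => exact zero_mem _
    | h_add p q hp hq => exact add_mem hp hq
    | h_std_basis i j c =>
      rw [show Matrix.single i j c = c • Matrix.single i j (1 : ℂ) by simp]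
      refine (multiplicativeSubalgebra g).smul_mem c ?_
      rcases lt_trichotomy (i : ℕ) j with hij | hij | hij
      · exact (mu (j - i - 1) i j (by omega)).1
      · rw [Fin.ext hij]; exact mh j
      · exact (mu (i - j - 1) j i (by omega)).2
  exact ⟨{ g with map_lie' := fun {x y} => key x y },
    fun k l hkl => ⟨he k l hkl, hf k l hkl⟩, hh⟩

end LieHom

/-! ### Sums of residues and cancelled double poles -/

section Residues

open Polynomial Lagrange

/-- For a monic polynomial whose degree is the number of nodes, the sum of the residues of its
quotient by the nodal polynomial. -/
theorem sum_eval_div_derivative_nodal (S : Finset ℂ) {f : ℂ[X]} (hf : f.Monic)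
    (hdeg : f.natDegree = S.card) :
    ∑ w ∈ S, f.eval w / (derivative (nodal S id)).eval w =
      f.nextCoeff - (nodal S id).nextCoeff := by
  rcases S.eq_empty_or_nonempty with rfl | hS
  · have : f = 1 := by
      rw [Finset.card_empty] at hdeg
      exact hf.natDegree_eq_zero.mp hdeg
    simp [this]
  have hpos : 0 < S.card := hS.card_pos
  have hd : f.degree = (nodal S id).degree := by
    rw [degree_nodal, degree_eq_natDegree hf.ne_zero, hdeg]
  -- Subtracting the nodal polynomial leaves the values at the nodes unchanged and lowers the
  -- degree, so Lagrange interpolation expresses the remaining top coefficient through these values.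
  have hlt : (f - nodal S id).degree < S.card := by
    have := degree_sub_lt_left hd hf.ne_zero (by rw [hf.leadingCoeff, nodal_monic.leadingCoeff])
    rwa [degree_eq_natDegree hf.ne_zero, hdeg] at this
  have key := coeff_eq_sum (s := S) (v := id) (Function.injective_id.injOn) hlt
  rw [nextCoeff_of_natDegree_pos (by omega), nextCoeff_of_natDegree_pos (by rw [natDegree_nodal]; exact hpos),
    hdeg, natDegree_nodal, ← coeff_sub, key]
  refine Finset.sum_congr rfl fun w hw => ?_
  have h1 := eval_nodal_derivative_eval_node_eq (s := S) (v := id) hw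
  simp only [id] at h1
  have h2 : eval w (nodal S id) = 0 := eval_nodal_at_node (v := id) hw
  rw [h1, eval_nodal, id, eval_sub, h2, sub_zero]

variable {ι κ : Type*}

/-- The common values of `x` and `x + 1`. -/
noncomputable def doubleNodes (I : Finset ι) (x : ι → ℂ) : Finset ℂ :=
  I.image x ∩ I.image (fun c => x c + 1)

theorem mem_doubleNodes {I : Finset ι} {x : ι → ℂ} {z : ℂ} :
    z ∈ doubleNodes I x ↔ (∃ a ∈ I, x a = z) ∧ ∃ b ∈ I, x b + 1 = z := by
  simp [doubleNodes]

variable [DecidableEq ι] [DecidableEq κ]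

/-- The sum of the residues of `∏ (X - v j) / ∏ (X - x c) (X - x c - 1)`, where the double poles
are cancelled by zeros `v (j z)`. The residues at the other poles are written as quotients that
vanish, by the convention on division by zero, at the double poles. -/
theorem sum_residues (I : Finset ι) (x : ι → ℂ) (hx : Set.InjOn x I) (J : Finset κ) (v : κ → ℂ)
    (hJ : J.card = 2 * I.card) (j : ℂ → κ) (hj : ∀ z ∈ doubleNodes I x, j z ∈ J ∧ v (j z) = z) :
    ∃ d : ℂ → ℂ, (∀ z ∈ doubleNodes I x, d z ≠ 0) ∧
    ∑ a ∈ I, ((∏ i ∈ J, (x a - v i)) /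
        ((∏ c ∈ I.erase a, (x a - x c)) * ∏ c ∈ I, (x a - (x c + 1))) +
      (∏ i ∈ J, (x a + 1 - v i)) /
        ((∏ c ∈ I.erase a, (x a - x c)) * ∏ c ∈ I, (x a + 1 - x c))) +
      ∑ z ∈ doubleNodes I x, (∏ i ∈ J \ (doubleNodes I x).image j, (z - v i)) / d z =
      2 * ∑ c ∈ I, x c + I.card - ∑ i ∈ J, v i := by
  set A := doubleNodes I x with hA
  set S := I.image x ∪ I.image (fun c => x c + 1) with hS
  have hx' : Set.InjOn (fun c => x c + 1) I := fun a ha b hb hab => hx ha hb (add_right_cancel hab)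
  have hnod : ∀ (T : Finset ℂ), nodal T id = ∏ w ∈ T, (X - C w) := fun T => rfl
  have hAS : A ⊆ S := fun z hz => Finset.mem_union_left _ (Finset.mem_inter.mp hz).1
  -- The union of the two sets of poles contains each pole once; the double ones are the
  -- intersection.
  have hDen : nodal S id * nodal A id = nodal I x * nodal I (fun c => x c + 1) := by
    rw [hnod, hnod, hA, doubleNodes, Finset.prod_union_inter, Finset.prod_image hx,
      Finset.prod_image hx', nodal, nodal]
  have hjinj : Set.InjOn j A := fun z hz w hw h => by
    rw [← (hj z hz).2, ← (hj w hw).2, h]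
  have hjJ : A.image j ⊆ J := by
    intro i hi
    obtain ⟨z, hz, rfl⟩ := Finset.mem_image.mp hi
    exact (hj z hz).1
  -- One zero is cancelled at each double pole; the quotient of `f` by `nodal S id` then has simple
  -- poles only.
  set f := nodal (J \ A.image j) v with hf
  have hNum : f * nodal A id = nodal J v := by
    rw [hf, hnod, nodal, nodal, ← Finset.prod_sdiff hjJ, Finset.prod_image hjinj]
    congr 1
    exact Finset.prod_congr rfl fun z hz => by rw [(hj z hz).2]
  have hfm : f.Monic := nodal_monic
  have hcard : f.natDegree = S.card := by
    have h1 := congrArg natDegree hNum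
    have h2 := congrArg natDegree hDen
    rw [hfm.natDegree_mul nodal_monic, natDegree_nodal (s := A), natDegree_nodal (s := J)] at h1
    rw [nodal_monic.natDegree_mul nodal_monic, nodal_monic.natDegree_mul nodal_monic,
      natDegree_nodal, natDegree_nodal, natDegree_nodal, natDegree_nodal] at h2
    omega
  have hmain := sum_eval_div_derivative_nodal S hfm hcard
  have hnc : f.nextCoeff - (nodal S id).nextCoeff = 2 * ∑ c ∈ I, x c + I.card - ∑ i ∈ J, v i := by
    have h1 := congrArg nextCoeff hNum
    have h2 := congrArg nextCoeff hDen
    rw [hfm.nextCoeff_mul nodal_monic] at h1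
    rw [nodal_monic.nextCoeff_mul nodal_monic, nodal_monic.nextCoeff_mul nodal_monic] at h2
    have h3 : (nodal J v).nextCoeff = -∑ i ∈ J, v i := prod_X_sub_C_nextCoeff v
    have h4 : (nodal I x).nextCoeff = -∑ i ∈ I, x i := prod_X_sub_C_nextCoeff x
    have h5 : (nodal I (fun c => x c + 1)).nextCoeff = -∑ i ∈ I, (x i + 1) :=
      prod_X_sub_C_nextCoeff _
    rw [Finset.sum_add_distrib] at h5
    simp only [Finset.sum_const, nsmul_eq_mul, mul_one] at h5
    rw [h3] at h1
    rw [h4, h5] at h2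
    linear_combination h1 - h2
  refine ⟨fun z => (derivative (nodal S id)).eval z, ?_, ?_⟩
  · intro z hz
    have h1 := eval_nodal_derivative_eval_node_eq (s := S) (v := id) (hAS hz)
    simp only [id] at h1
    change eval z (derivative (nodal S id)) ≠ 0
    rw [h1]
    exact eval_nodal_not_at_node fun w hw => (Finset.ne_of_mem_erase hw).symm
  rw [← hnc, ← hmain, ← Finset.sum_sdiff hAS]
  congr 1
  swap
  · exact Finset.sum_congr rfl fun z hz => by rw [hf, eval_nodal]
  -- the derivative of the full denominator
  have hderiv : ∀ w ∈ S, (derivative (nodal I x * nodal I (fun c => x c + 1))).eval w =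
      (derivative (nodal S id)).eval w * (nodal A id).eval w := by
    intro w hw
    have : eval w (nodal S id) = 0 := eval_nodal_at_node (v := id) hw
    rw [← hDen, derivative_mul, eval_add, eval_mul, eval_mul, this]; ring
  have hA0 : ∀ w ∈ A, (nodal A id).eval w = 0 := fun w hw => eval_nodal_at_node (v := id) hw
  have hA1 : ∀ w, w ∉ A → (nodal A id).eval w ≠ 0 := fun w hw =>
    eval_nodal_not_at_node fun z hz => by rintro rfl; exact hw hz
  -- At a double pole the derivative of the full denominator vanishes, so the uncancelled quotient
  -- is zero by convention; elsewhere the common factor `nodal A id` cancels.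
  have hterm : ∀ w ∈ S, (nodal J v).eval w /
      (derivative (nodal I x * nodal I (fun c => x c + 1))).eval w =
      if w ∈ A then 0 else f.eval w / (derivative (nodal S id)).eval w := by
    intro w hw
    rw [hderiv w hw]
    split_ifs with hwA
    · rw [hA0 w hwA, mul_zero, div_zero]
    · rw [← hNum, eval_mul, mul_div_mul_right _ _ (hA1 w hwA)]
  have e1 : ∀ a ∈ I, (derivative (nodal I x * nodal I (fun c => x c + 1))).eval (x a) =
      (∏ c ∈ I.erase a, (x a - x c)) * ∏ c ∈ I, (x a - (x c + 1)) := by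
    intro a ha
    rw [derivative_mul, eval_add, eval_mul, eval_mul, eval_nodal_at_node ha,
      eval_nodal_derivative_eval_node_eq ha, eval_nodal, eval_nodal, zero_mul, add_zero]
  have e2 : ∀ a ∈ I, (derivative (nodal I x * nodal I (fun c => x c + 1))).eval (x a + 1) =
      (∏ c ∈ I.erase a, (x a - x c)) * ∏ c ∈ I, (x a + 1 - x c) := by
    intro a ha
    have h1 : eval (x a + 1) (nodal I (fun c => x c + 1)) = 0 :=
      eval_nodal_at_node (v := fun c => x c + 1) ha
    have h2 := eval_nodal_derivative_eval_node_eq (v := fun c => x c + 1) ha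
    rw [derivative_mul, eval_add, eval_mul, eval_mul, h1, h2, eval_nodal, eval_nodal, mul_zero,
      zero_add, mul_comm]
    congr 1
    exact Finset.prod_congr rfl fun c _ => by ring
  have hg : ∑ w ∈ S \ A, f.eval w / (derivative (nodal S id)).eval w =
      ∑ w ∈ I.image x, (nodal J v).eval w /
        (derivative (nodal I x * nodal I (fun c => x c + 1))).eval w +
      ∑ w ∈ I.image (fun c => x c + 1), (nodal J v).eval w /
        (derivative (nodal I x * nodal I (fun c => x c + 1))).eval w := by
    rw [← Finset.sum_union_inter, ← hS]
    have h0 : ∑ w ∈ I.image x ∩ I.image (fun c => x c + 1), (nodal J v).eval w /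
        (derivative (nodal I x * nodal I (fun c => x c + 1))).eval w = 0 :=
      Finset.sum_eq_zero fun w hw => by
        rw [hterm w (hAS hw), if_pos (show w ∈ A from hw)]
    rw [h0, add_zero, ← Finset.sum_sdiff hAS]
    rw [Finset.sum_eq_zero (s := A) fun w hw => by rw [hterm w (hAS hw), if_pos hw], add_zero]
    refine Finset.sum_congr rfl fun w hw => ?_
    rw [hterm w (Finset.mem_sdiff.mp hw).1, if_neg (Finset.mem_sdiff.mp hw).2]
  rw [hg, Finset.sum_image hx, Finset.sum_image hx', ← Finset.sum_add_distrib]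
  refine Finset.sum_congr rfl fun a ha => ?_
  rw [e1 a ha, e2 a ha, eval_nodal, eval_nodal]

/-- The numerators that occur in the diagonal part of the commutator of the raising and the
lowering operator. -/
theorem diagonal_sum_aux (I U W : Finset ι) (x : ι → ℂ) (hx : Set.InjOn x I)
    (hcard : U.card + W.card = 2 * I.card) (j : ℂ → ι ⊕ ι)
    (hj : ∀ z ∈ doubleNodes I x, j z ∈ U.disjSum W ∧
      Sum.elim (fun s => x s + 1) x (j z) = z) :
    ∃ d : ℂ → ℂ, (∀ z ∈ doubleNodes I x, d z ≠ 0) ∧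
    ∑ a ∈ I, ((∏ s ∈ U, (x a - 1 - x s)) * (∏ t ∈ W, (x a - x t)) /
        ((∏ c ∈ I.erase a, (x a - x c)) * ∏ c ∈ I, (x a - 1 - x c)) +
      (∏ s ∈ U, (x a - x s)) * (∏ t ∈ W, (x a + 1 - x t)) /
        ((∏ c ∈ I.erase a, (x a - x c)) * ∏ c ∈ I, (x a + 1 - x c))) +
      ∑ z ∈ doubleNodes I x, (∏ i ∈ U.disjSum W \ (doubleNodes I x).image j,
        (z - Sum.elim (fun s => x s + 1) x i)) / d z =
      2 * ∑ c ∈ I, x c + I.card - U.card - ∑ s ∈ U, x s - ∑ t ∈ W, x t := by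
  obtain ⟨d, hd, h⟩ := sum_residues I x hx (U.disjSum W) (Sum.elim (fun s => x s + 1) x)
    (by rw [Finset.card_disjSum, hcard]) j hj
  refine ⟨d, hd, ?_⟩
  simp only [Finset.prod_disjSum, Finset.sum_disjSum, Sum.elim_inl, Sum.elim_inr] at h
  rw [Finset.sum_add_distrib (s := U)] at h
  simp only [Finset.sum_const, nsmul_eq_mul, mul_one] at h
  have r1 : ∀ p q : ℂ, p - (q + 1) = p - 1 - q := fun p q => by ring
  have r2 : ∀ p : ℂ, p + 1 - 1 = p := fun p => by ring
  simp only [r1, r2] at h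
  rw [h]; ring

/-- If every double pole is cancelled by a double zero, the remaining residues add up as in the
generic case. -/
theorem diagonal_sum (I U W : Finset ι) (x : ι → ℂ) (hx : Set.InjOn x I)
    (hcard : U.card + W.card = 2 * I.card)
    (hbad : ∀ a ∈ I, ∀ b ∈ I, x a = x b + 1 →
      ((∃ s ∈ U, x s = x b) ∧ ∃ t ∈ W, x t = x a) ∨
      ∃ s ∈ U, ∃ s' ∈ U, s ≠ s' ∧ x s = x b ∧ x s' = x b) :
    ∑ a ∈ I, ((∏ s ∈ U, (x a - 1 - x s)) * (∏ t ∈ W, (x a - x t)) /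
        ((∏ c ∈ I.erase a, (x a - x c)) * ∏ c ∈ I, (x a - 1 - x c)) +
      (∏ s ∈ U, (x a - x s)) * (∏ t ∈ W, (x a + 1 - x t)) /
        ((∏ c ∈ I.erase a, (x a - x c)) * ∏ c ∈ I, (x a + 1 - x c))) =
      2 * ∑ c ∈ I, x c + I.card - U.card - ∑ s ∈ U, x s - ∑ t ∈ W, x t := by
  have h1 : ∀ z ∈ doubleNodes I x, ∃ i ∈ U.disjSum W, ∃ i' ∈ U.disjSum W, i ≠ i' ∧
      Sum.elim (fun s => x s + 1) x i = z ∧ Sum.elim (fun s => x s + 1) x i' = z := by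
    intro z hz
    obtain ⟨⟨a, ha, rfl⟩, b, hb, hab⟩ := mem_doubleNodes.mp hz
    rcases hbad a ha b hb hab.symm with ⟨⟨s, hs, hsb⟩, t, ht, hta⟩ | ⟨s, hs, s', hs', hne, h, h'⟩
    · exact ⟨Sum.inl s, by simpa using hs, Sum.inr t, by simpa using ht, by simp,
        by simp [hsb, hab], by simp [hta]⟩
    · exact ⟨Sum.inl s, by simpa using hs, Sum.inl s', by simpa using hs', by simpa using hne,
        by simp [h, hab], by simp [h', hab]⟩
  rcases I.eq_empty_or_nonempty with rfl | hI
  · have : U.card = 0 ∧ W.card = 0 := by simpa using hcard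
    simp only [Finset.card_eq_zero] at this
    simp [this.1, this.2]
  have hne : Nonempty (ι ⊕ ι) := ⟨Sum.inl hI.choose⟩
  choose! j hj j' hj' hjj' hv hv' using h1
  obtain ⟨d, -, h⟩ := diagonal_sum_aux I U W x hx hcard j (fun z hz => ⟨hj z hz, hv z hz⟩)
  rw [← h]
  symm
  rw [add_eq_left]
  refine Finset.sum_eq_zero fun z hz => ?_
  rw [Finset.prod_eq_zero (i := j' z), zero_div]
  -- The zero used up at a double pole lies over that very pole. So `j' z` could have been used up
  -- only at `z` itself, where `j z` was taken instead.
  · refine Finset.mem_sdiff.mpr ⟨hj' z hz, fun hmem => ?_⟩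
    obtain ⟨w, hw, hwz⟩ := Finset.mem_image.mp hmem
    have : w = z := by rw [← hv w hw, hwz, hv' z hz]
    subst this
    exact hjj' w hw hwz
  · rw [hv' z hz, sub_self]

/-- If there is exactly one double pole and it is cancelled by a simple zero only, the remaining
residues do not add up as in the generic case. -/
theorem diagonal_sum_ne (I U W : Finset ι) (x : ι → ℂ) (hx : Set.InjOn x I)
    (hcard : U.card + W.card = 2 * I.card) {a b : ι} (ha : a ∈ I) (hb : b ∈ I)
    (hab : x a = x b + 1) (hu : ∀ c ∈ I, ∀ d ∈ I, x c = x d + 1 → c = a)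
    (hz : (∃ s ∈ U, x s = x b ∧ (∀ s' ∈ U, x s' = x b → s' = s) ∧ ∀ t ∈ W, x t ≠ x a) ∨
      ∃ t ∈ W, x t = x a ∧ (∀ t' ∈ W, x t' = x a → t' = t) ∧ ∀ s ∈ U, x s ≠ x b) :
    ∑ a ∈ I, ((∏ s ∈ U, (x a - 1 - x s)) * (∏ t ∈ W, (x a - x t)) /
        ((∏ c ∈ I.erase a, (x a - x c)) * ∏ c ∈ I, (x a - 1 - x c)) +
      (∏ s ∈ U, (x a - x s)) * (∏ t ∈ W, (x a + 1 - x t)) /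
        ((∏ c ∈ I.erase a, (x a - x c)) * ∏ c ∈ I, (x a + 1 - x c))) ≠
      2 * ∑ c ∈ I, x c + I.card - U.card - ∑ s ∈ U, x s - ∑ t ∈ W, x t := by
  have hA : doubleNodes I x = {x a} := by
    ext z
    rw [mem_doubleNodes, Finset.mem_singleton]
    constructor
    · rintro ⟨⟨c, hc, rfl⟩, d, hd, hcd⟩
      rw [hu c hc d hd hcd.symm]
    · rintro rfl
      exact ⟨⟨a, ha, rfl⟩, b, hb, hab.symm⟩
  have h1 : ∃ i ∈ U.disjSum W, Sum.elim (fun s => x s + 1) x i = x a ∧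
      ∀ i' ∈ U.disjSum W, Sum.elim (fun s => x s + 1) x i' = x a → i' = i := by
    rcases hz with ⟨s, hs, hsb, hu', hw⟩ | ⟨t, ht, hta, hu', hw⟩
    · refine ⟨Sum.inl s, by simpa using hs, by simp [hsb, hab], ?_⟩
      rintro (s' | t) hi hv
      · simp only [Sum.elim_inl, hab, add_left_inj] at hv
        rw [hu' s' (by simpa using hi) hv]
      · exact absurd hv (hw t (by simpa using hi))
    · refine ⟨Sum.inr t, by simpa using ht, by simp [hta], ?_⟩
      rintro (s | t') hi hv
      · simp only [Sum.elim_inl, hab, add_left_inj] at hv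
        exact absurd hv (hw s (by simpa using hi))
      · rw [hu' t' (by simpa using hi) hv]
  obtain ⟨i, hi, hiv, hiu⟩ := h1
  obtain ⟨d, hd, h⟩ := diagonal_sum_aux I U W x hx hcard (fun _ => i) (fun z hz => by
    rw [hA, Finset.mem_singleton] at hz
    exact ⟨hi, hz ▸ hiv⟩)
  rw [← h]
  intro heq
  rw [left_eq_add, hA, Finset.sum_singleton, Finset.image_singleton] at heq
  -- The only zero over the double pole is already cancelled, so its residue survives.
  refine div_ne_zero ?_ (hd (x a) (by rw [hA]; simp)) heq
  refine Finset.prod_ne_zero_iff.mpr fun i' hi' => ?_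
  rw [Finset.mem_sdiff, Finset.mem_singleton] at hi'
  intro h0
  exact hi'.2 (hiu i' hi'.1 (sub_eq_zero.mp h0).symm)

end Residues

variable {n : ℕ}

/-! ### Relations as bounds on moving entries -/

section Relations

/-- The position with the larger entry in a relation. -/
def Relation.hi : Relation n → Vertex n
  | .ge a _ => a
  | .gt a _ => a

/-- The position with the smaller entry in a relation. -/
def Relation.lo : Relation n → Vertex n
  | .ge _ b => b
  | .gt _ b => b

/-- The least difference of entries that a relation allows. -/
def Relation.wt : Relation n → ℕ
  | .ge _ _ => 0
  | .gt _ _ => 1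

theorem Relation.wt_le_one (r : Relation n) : r.wt ≤ 1 := by
  cases r <;> simp [Relation.wt]

/-- Both kinds of relations become a lower bound `r.wt` for one difference, which avoids treating
$\ge$ and $>$ separately. -/
theorem holds_iff {R : Tableau n} {r : Relation n} :
    Holds R r ↔ ∃ m : ℕ, R r.hi - R r.lo = ((r.wt + m : ℕ) : ℂ) := by
  cases r with
  | ge a b => simp [Holds, Relation.hi, Relation.lo, Relation.wt]
  | gt a b =>
    simp only [Holds, Relation.hi, Relation.lo, Relation.wt]
    constructor
    · rintro ⟨m, hm, h⟩
      exact ⟨m - 1, by rw [h]; congr 1; omega⟩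
    · rintro ⟨m, h⟩
      exact ⟨1 + m, by omega, h⟩

theorem hi_ne_lo {C : Set (Relation n)} (hC : C ⊆ relR n ∪ relR0 n) {r : Relation n} (hr : r ∈ C) :
    r.hi ≠ r.lo := by
  rcases hC hr with ⟨a, b, hab, rfl | rfl⟩ | ⟨a, b, -, -, hab, rfl⟩
  · rintro h; simp only [Relation.hi, Relation.lo] at h; rw [h] at hab; omega
  · rintro h; simp only [Relation.hi, Relation.lo] at h; rw [h] at hab; omega
  · exact hab

theorem row_pos (a : Vertex n) : 0 < row a := Nat.succ_pos _

theorem row_le (a : Vertex n) : row a ≤ n := a.1.2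

theorem row_hi_of_lt {C : Set (Relation n)} (hC : C ⊆ relR n ∪ relR0 n) {r : Relation n}
    (hr : r ∈ C) (h : row r.hi < n ∨ row r.lo < n) : (row r.hi : ℤ) = row r.lo + 1 - 2 * r.wt := by
  rcases hC hr with ⟨a, b, hab, rfl | rfl⟩ | ⟨a, b, ha, hb, -, rfl⟩
  · simp only [Relation.hi, Relation.lo, Relation.wt]; omega
  · simp only [Relation.hi, Relation.lo, Relation.wt]; omega
  · simp only [Relation.hi, Relation.lo] at h; omega

/-- `C` bounds the entry at `a`, when it moves in the direction `σ = ±1`, by the entry at `y`: the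
distance `σ * (l_y - l_a)` has to be at least `w`. -/
def Bound (C : Set (Relation n)) (σ : ℤ) (a y : Vertex n) (w : ℕ) : Prop :=
  (σ = 1 ∧ ∃ r ∈ C, r.hi = y ∧ r.lo = a ∧ r.wt = w) ∨
    (σ = -1 ∧ ∃ r ∈ C, r.hi = a ∧ r.lo = y ∧ r.wt = w)

theorem Bound.exists_nat {C : Set (Relation n)} {σ : ℤ} {a y : Vertex n} {w : ℕ}
    (h : Bound C σ a y w) {R : Tableau n} (hR : Satisfies C R) :
    ∃ m : ℕ, σ * (R y - R a) = ((w + m : ℕ) : ℂ) := by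
  rcases h with ⟨rfl, r, hr, rfl, rfl, rfl⟩ | ⟨rfl, r, hr, rfl, rfl, rfl⟩
  · obtain ⟨m, hm⟩ := holds_iff.mp (hR r hr)
    exact ⟨m, by rw [hm]; simp⟩
  · obtain ⟨m, hm⟩ := holds_iff.mp (hR r hr)
    exact ⟨m, by rw [← hm]; push_cast; ring⟩

/-- This is the link between relations and coefficients. A bound of weight 0 comes from the row
ahead, whose entries form the numerator of the step $\sigma\delta^a$. A bound of weight 1 comes from
the row behind, whose entries form the numerator of the inverse step. -/
theorem Bound.row {C : Set (Relation n)} (hC : C ⊆ relR n ∪ relR0 n) {σ : ℤ} {a y : Vertex n}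
    {w : ℕ} (h : Bound C σ a y w) (ha : row a < n) :
    (w = 0 ∧ (row y : ℤ) = row a + σ) ∨ (w = 1 ∧ (row y : ℤ) = row a - σ) := by
  rcases h with ⟨rfl, r, hr, rfl, rfl, rfl⟩ | ⟨rfl, r, hr, rfl, rfl, rfl⟩
  · have := row_hi_of_lt hC hr (Or.inr ha)
    have := r.wt_le_one
    omega
  · have := row_hi_of_lt hC hr (Or.inl ha)
    have := r.wt_le_one
    omega

@[simp] theorem shift_self (R : Tableau n) (a : Vertex n) (m : ℤ) : shift R a m a = R a + m := by
  simp [shift]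

theorem shift_ne (R : Tableau n) {a b : Vertex n} (m : ℤ) (h : b ≠ a) : shift R a m b = R b := by
  simp [shift, h]

theorem shift_comm (R : Tableau n) (a b : Vertex n) (p q : ℤ) :
    shift (shift R a p) b q = shift (shift R b q) a p := by
  funext c
  simp only [shift]
  split_ifs <;> ring

theorem shift_shift_neg (R : Tableau n) (a : Vertex n) (p : ℤ) :
    shift (shift R a p) a (-p) = R := by
  funext c
  simp only [shift]
  split_ifs <;> simp

theorem shift_neg_shift (R : Tableau n) (a : Vertex n) (p : ℤ) :
    shift (shift R a (-p)) a p = R := by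
  funext c
  simp only [shift]
  split_ifs <;> simp

variable {C : Set (Relation n)} {L : Tableau n}

theorem shift_mem_iff {R : Tableau n} (hR : R ∈ tableauxSet C L) {a : Vertex n} (ha : row a < n)
    (m : ℤ) : shift R a m ∈ tableauxSet C L ↔ Satisfies C (shift R a m) := by
  obtain ⟨-, z, hz, hRz⟩ := hR
  refine ⟨fun h => h.1, fun h => ⟨h, fun b => if b = a then z b + m else z b, ?_, ?_⟩⟩
  · intro b hb
    have hne : b ≠ a := by rintro rfl; omega
    simp only [if_neg hne, hz b hb]
  · intro b
    simp only [shift]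
    split_ifs
    · rw [hRz]; push_cast; ring
    · exact hRz b

/-- A tableau that cannot be moved in the direction `σ δ^a` satisfies one of the relations at `a`
tightly. -/
theorem exists_tight (hC : C ⊆ relR n ∪ relR0 n) {R : Tableau n} (hR : R ∈ tableauxSet C L)
    {a : Vertex n} (ha : row a < n) {σ : ℤ} (hσ : σ = 1 ∨ σ = -1)
    (h : shift R a σ ∉ tableauxSet C L) :
    ∃ y w, Bound C σ a y w ∧ y ≠ a ∧ R y = R a + σ * w := by
  rw [shift_mem_iff hR ha, Satisfies] at h
  push Not at h
  obtain ⟨r, hr, hh⟩ := h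
  obtain ⟨m, hm⟩ := holds_iff.mp (hR.1 r hr)
  have hne := hi_ne_lo hC hr
  by_cases h1 : r.lo = a
  · have h2 : r.hi ≠ a := fun h2 => hne (h2.trans h1.symm)
    rcases hσ with rfl | rfl
    · rcases Nat.eq_zero_or_pos m with rfl | hpos
      · exact ⟨r.hi, r.wt, Or.inl ⟨rfl, r, hr, rfl, h1, rfl⟩, h2, by
          rw [← h1]; push_cast at hm ⊢; linear_combination hm⟩
      · refine absurd (holds_iff.mpr ⟨m - 1, ?_⟩) hh
        rw [shift_ne _ _ h2, h1, shift_self]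
        rw [h1] at hm
        have : ((r.wt + (m - 1) : ℕ) : ℂ) = ((r.wt + m : ℕ) : ℂ) - 1 := by
          rw [← Nat.add_sub_assoc hpos, Nat.cast_sub (by omega)]; simp
        rw [this]; push_cast at hm ⊢; linear_combination hm
    · refine absurd (holds_iff.mpr ⟨m + 1, ?_⟩) hh
      rw [shift_ne _ _ h2, h1, shift_self]
      rw [h1] at hm
      push_cast at hm ⊢; linear_combination hm
  by_cases h2 : r.hi = a
  · rcases hσ with rfl | rfl
    · refine absurd (holds_iff.mpr ⟨m + 1, ?_⟩) hh
      rw [shift_ne _ _ h1, h2, shift_self]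
      rw [h2] at hm
      push_cast at hm ⊢; linear_combination hm
    · rcases Nat.eq_zero_or_pos m with rfl | hpos
      · exact ⟨r.lo, r.wt, Or.inr ⟨rfl, r, hr, h2, rfl, rfl⟩, h1, by
          rw [← h2]; push_cast at hm ⊢; linear_combination -hm⟩
      · refine absurd (holds_iff.mpr ⟨m - 1, ?_⟩) hh
        rw [shift_ne _ _ h1, h2, shift_self]
        rw [h2] at hm
        have : ((r.wt + (m - 1) : ℕ) : ℂ) = ((r.wt + m : ℕ) : ℂ) - 1 := by
          rw [← Nat.add_sub_assoc hpos, Nat.cast_sub (by omega)]; simp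
        rw [this]; push_cast at hm ⊢; linear_combination hm
  · refine absurd (holds_iff.mpr ⟨m, ?_⟩) hh
    rw [shift_ne _ _ h1, shift_ne _ _ h2, hm]

/-- The only obstruction to a first step `σ δ^a`, if a second step `τ δ^b` leads to a tableau of
the basis, is a tight relation between `a` and `b`. -/
theorem mem_of_two_step (hC : C ⊆ relR n ∪ relR0 n) {R : Tableau n} (hR : R ∈ tableauxSet C L)
    {a b : Vertex n} (hab : a ≠ b) (ha : row a < n) {σ τ : ℤ} (hσ : σ = 1 ∨ σ = -1)
    (hτ : τ = 1 ∨ τ = -1) (h : shift (shift R a σ) b τ ∈ tableauxSet C L) :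
    shift R a σ ∈ tableauxSet C L ∨
      (τ = σ ∧ ∃ w, Bound C σ a b w ∧ R b = R a + σ * w) := by
  by_contra! hcon
  obtain ⟨hmem, hcon⟩ := hcon
  obtain ⟨y, w, hB, hya, hy⟩ := exists_tight hC hR ha hσ hmem
  obtain ⟨m, hm⟩ := hB.exists_nat h.1
  rw [shift_ne _ _ hab, shift_self] at hm
  have hσ2 : (σ : ℂ) * σ = 1 := by rcases hσ with rfl | rfl <;> simp
  -- A relation that is already tight would be broken after both steps, unless its other end moves
  -- along with `a` in the same direction.
  by_cases hyb : y = b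
  · subst hyb
    rw [shift_self, shift_ne _ _ hya, hy] at hm
    have hne : τ ≠ σ := fun h => hcon h w hB hy
    have h3 : τ = -σ := by omega
    subst h3
    have : ((m + 2 : ℕ) : ℂ) = 0 := by
      push_cast at hm ⊢; linear_combination -hm + (w - 2) * hσ2
    exact absurd this (Nat.cast_ne_zero.mpr (by omega))
  · rw [shift_ne _ _ hyb, shift_ne _ _ hya, hy] at hm
    have : ((m + 1 : ℕ) : ℂ) = 0 := by
      push_cast at hm ⊢; linear_combination -hm + (w - 1) * hσ2
    exact absurd this (Nat.cast_ne_zero.mpr (by omega))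

end Relations

/-! ### How the coefficients change when another entry moves -/

section Coefficients

/-- The positions of the row that follows the row of `a` in the direction `σ`. -/
def adj (σ : ℤ) (a : Vertex n) : Finset (Vertex n) :=
  Finset.univ.filter fun b => (row b : ℤ) = row a + σ

/-- The other positions of the row of `a`. -/
def peers (a : Vertex n) : Finset (Vertex n) :=
  Finset.univ.filter fun b => row b = row a ∧ b ≠ a

theorem mem_adj {σ : ℤ} {a b : Vertex n} : b ∈ adj σ a ↔ (row b : ℤ) = row a + σ := by
  simp [adj]

theorem mem_peers {a b : Vertex n} : b ∈ peers a ↔ row b = row a ∧ b ≠ a := by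
  simp [peers]

/-- The quotient of the product of the differences of `l_a` with the entries at the positions of
`S` by the product of its differences with the other entries of its row. -/
noncomputable def coef (S : Finset (Vertex n)) (R : Tableau n) (a : Vertex n) : ℂ :=
  (∏ b ∈ S, (R a - R b)) / ∏ b ∈ peers a, (R a - R b)

/-- `coef` without the contribution of the position `b` to the denominator. -/
noncomputable def coefErase (S : Finset (Vertex n)) (R : Tableau n) (a b : Vertex n) : ℂ :=
  (∏ s ∈ S, (R a - R s)) / ∏ c ∈ (peers a).erase b, (R a - R c)

theorem raiseCoeff_eq (R : Tableau n) (a : Vertex n) : raiseCoeff R a = -coef (adj 1 a) R a := by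
  rw [raiseCoeff, coef, peers, adj]
  congr 3
  ext b; simp; omega

theorem lowerCoeff_eq (R : Tableau n) (a : Vertex n) : lowerCoeff R a = coef (adj (-1) a) R a := by
  rw [lowerCoeff, coef, peers, adj]
  congr 2
  ext b; simp; omega

theorem prod_shift_of_notMem {S : Finset (Vertex n)} {b : Vertex n} (hb : b ∉ S) (R : Tableau n)
    (m : ℤ) (x : ℂ) : ∏ s ∈ S, (x - shift R b m s) = ∏ s ∈ S, (x - R s) :=
  Finset.prod_congr rfl fun s hs => by rw [shift_ne _ _ (by rintro rfl; exact hb hs)]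

theorem prod_shift_of_mem {S : Finset (Vertex n)} {b : Vertex n} (hb : b ∈ S) (R : Tableau n)
    (m : ℤ) (x : ℂ) : ∏ s ∈ S, (x - shift R b m s) = (x - R b - m) * ∏ s ∈ S.erase b, (x - R s) := by
  rw [← Finset.mul_prod_erase _ _ hb, prod_shift_of_notMem (Finset.notMem_erase b S), shift_self]
  ring

theorem coef_of_mem {S : Finset (Vertex n)} {a b : Vertex n} (hb : b ∈ S) (R : Tableau n) :
    coef S R a = (R a - R b) * coef (S.erase b) R a := by
  rw [coef, coef, ← Finset.mul_prod_erase _ _ hb, mul_div_assoc]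

theorem coef_shift_of_mem {S : Finset (Vertex n)} {a b : Vertex n} (hb : b ∈ S)
    (hab : row b ≠ row a) (R : Tableau n) (m : ℤ) :
    coef S (shift R b m) a = (R a - R b - m) * coef (S.erase b) R a := by
  have hne : a ≠ b := by rintro rfl; exact hab rfl
  rw [coef, coef, shift_ne _ _ hne, prod_shift_of_mem hb, prod_shift_of_notMem, mul_div_assoc]
  simp [mem_peers, hab]

theorem coef_shift_of_notMem {S : Finset (Vertex n)} {a b : Vertex n} (hb : b ∉ S)
    (hab : row b ≠ row a) (R : Tableau n) (m : ℤ) : coef S (shift R b m) a = coef S R a := by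
  have hne : a ≠ b := by rintro rfl; exact hab rfl
  rw [coef, coef, shift_ne _ _ hne, prod_shift_of_notMem hb, prod_shift_of_notMem]
  simp [mem_peers, hab]

theorem coef_eq_coefErase {S : Finset (Vertex n)} {a b : Vertex n} (hne : b ≠ a)
    (hab : row b = row a) (R : Tableau n) : coef S R a = coefErase S R a b / (R a - R b) := by
  rw [coef, coefErase, ← Finset.mul_prod_erase (peers a) _ (mem_peers.mpr ⟨hab, hne⟩), div_div,
    mul_comm]

theorem coef_shift_eq_coefErase {S : Finset (Vertex n)} {a b : Vertex n} (hb : b ∉ S) (hne : b ≠ a)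
    (hab : row b = row a) (R : Tableau n) (m : ℤ) :
    coef S (shift R b m) a = coefErase S R a b / (R a - R b - m) := by
  rw [coef, coefErase, shift_ne _ _ hne.symm, prod_shift_of_notMem hb,
    prod_shift_of_mem (mem_peers.mpr ⟨hab, hne⟩), div_div, mul_comm]

theorem coef_eq_zero {S : Finset (Vertex n)} {a b : Vertex n} (hb : b ∈ S) {R : Tableau n}
    (h : R b = R a) : coef S R a = 0 := by
  rw [coef_of_mem hb, h]; simp

end Coefficients

/-! ### Raising and lowering operators and their commutators -/

section Operators

variable (C : Set (Relation n)) (L : Tableau n)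

/-- The operator that moves the entries of row `k` by `σ`; up to sign it is `E_{k,k+1}` for
`σ = 1` and `E_{k+1,k}` for `σ = -1`. -/
noncomputable def op (σ : ℤ) (k : ℕ) : Module.End ℂ (TableauxSpace C L) :=
  Finsupp.linearCombination ℂ fun R : tableauxSet C L =>
    ∑ a : Vertex n with row a = k, coef (adj σ a) R.1 a • tab C L (shift R.1 a σ)

variable {C L}

theorem tab_of_mem {R : Tableau n} (hR : R ∈ tableauxSet C L) :
    tab C L R = Finsupp.single ⟨R, hR⟩ 1 := dif_pos hR

theorem tab_of_notMem {R : Tableau n} (hR : R ∉ tableauxSet C L) : tab C L R = 0 := dif_neg hR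

theorem tab_ne_zero {R : Tableau n} (hR : R ∈ tableauxSet C L) : tab C L R ≠ 0 := by
  rw [tab_of_mem hR]; simp

theorem op_tab {R : Tableau n} (hR : R ∈ tableauxSet C L) (σ : ℤ) (k : ℕ) :
    op C L σ k (tab C L R) =
      ∑ a : Vertex n with row a = k, coef (adj σ a) R a • tab C L (shift R a σ) := by
  rw [tab_of_mem hR, op, Finsupp.linearCombination_single, one_smul]

-- Moving the membership condition into the coefficient allows compositions to be written as full
-- double sums, including paths through tableaux outside the basis.
open Classical in
theorem op_tab' (R : Tableau n) (σ : ℤ) (k : ℕ) :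
    op C L σ k (tab C L R) =
      ∑ a : Vertex n with row a = k,
        (if R ∈ tableauxSet C L then coef (adj σ a) R a else 0) • tab C L (shift R a σ) := by
  split_ifs with h
  · exact op_tab h σ k
  · rw [tab_of_notMem h]; simp

theorem end_ext {f g : Module.End ℂ (TableauxSpace C L)}
    (h : ∀ R ∈ tableauxSet C L, f (tab C L R) = g (tab C L R)) : f = g := by
  refine Finsupp.lhom_ext' fun R => LinearMap.ext_ring ?_
  have := h R.1 R.2
  rwa [tab_of_mem R.2] at this

/-- Coefficients need to agree only when the end of a path lies in the basis. This extra knowledge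
about the end is what limits the obstructions to its intermediate steps. -/
theorem smul_tab_congr {Q : Tableau n} {x y : ℂ} (h : Q ∈ tableauxSet C L → x = y) :
    x • tab C L Q = y • tab C L Q := by
  by_cases hQ : Q ∈ tableauxSet C L
  · rw [h hQ]
  · rw [tab_of_notMem hQ, smul_zero, smul_zero]

open Classical in
theorem op_op_tab {R : Tableau n} (hR : R ∈ tableauxSet C L) (σ τ : ℤ) (k l : ℕ) :
    op C L σ k (op C L τ l (tab C L R)) =
      ∑ b : Vertex n with row b = l, ∑ a : Vertex n with row a = k,
        (if shift R b τ ∈ tableauxSet C L then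
          coef (adj τ b) R b * coef (adj σ a) (shift R b τ) a else 0) •
          tab C L (shift (shift R b τ) a σ) := by
  rw [op_tab hR, map_sum]
  refine Finset.sum_congr rfl fun b _ => ?_
  rw [map_smul, op_tab', Finset.smul_sum]
  refine Finset.sum_congr rfl fun a _ => ?_
  rw [smul_smul, mul_ite, mul_zero]

/-- The operators commute if they move entries of different rows in opposite directions, or
entries of rows that are not adjacent. -/
theorem op_comm (hC : C ⊆ relR n ∪ relR0 n) {σ τ : ℤ} (hσ : σ = 1 ∨ σ = -1) (hτ : τ = 1 ∨ τ = -1)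
    {k l : ℕ} (hk : k < n) (hl : l < n) (hkl : k ≠ l) (h : τ = -σ ∨ k + 1 < l ∨ l + 1 < k) :
    op C L σ k * op C L τ l = op C L τ l * op C L σ k := by
  classical
  refine end_ext fun R hR => ?_
  rw [Module.End.mul_apply, Module.End.mul_apply, op_op_tab hR, op_op_tab hR, Finset.sum_comm]
  refine Finset.sum_congr rfl fun a ha => Finset.sum_congr rfl fun b hb => ?_
  simp only [Finset.mem_filter, Finset.mem_univ, true_and] at ha hb
  have hab : a ≠ b := by rintro rfl; exact hkl (ha.symm.trans hb)
  rw [shift_comm R b a]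
  refine smul_tab_congr fun hQ => ?_
  -- An obstruction would be a relation between `a` and `b` moving in the same direction, hence in
  -- adjacent rows; both cases of `h` exclude this.
  have h1 : shift R a σ ∈ tableauxSet C L := by
    rcases mem_of_two_step hC hR hab (by omega) hσ hτ hQ with h1 | ⟨h1, w, hB, -⟩
    · exact h1
    · have := hB.row hC (by omega); omega
  have h2 : shift R b τ ∈ tableauxSet C L := by
    rw [shift_comm] at hQ
    rcases mem_of_two_step hC hR hab.symm (by omega) hτ hσ hQ with h1 | ⟨h1, w, hB, -⟩
    · exact h1
    · have := hB.row hC (by omega); omega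
  rw [if_pos h1, if_pos h2]
  by_cases h3 : b ∈ adj σ a
  · have h4 : a ∈ adj τ b := by
      rw [mem_adj] at h3 ⊢; omega
    have h5 : τ = -σ := by rw [mem_adj] at h3; omega
    rw [coef_shift_of_mem h3 (by omega), coef_shift_of_mem h4 (by omega), coef_of_mem h3,
      coef_of_mem h4, h5]
    push_cast; ring
  · have h4 : a ∉ adj τ b := by
      rw [mem_adj] at h3 ⊢; omega
    rw [coef_shift_of_notMem h3 (by omega), coef_shift_of_notMem h4 (by omega)]
    ring

theorem card_row {m : ℕ} (hm : m ≤ n) : (Finset.univ.filter fun a : Vertex n => row a = m).card = m := by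
  cases m with
  | zero =>
    rw [Finset.card_eq_zero, Finset.filter_eq_empty_iff]
    intro a _ h
    have := row_pos a
    omega
  | succ k =>
    have : (Finset.univ.filter fun a : Vertex n => row a = k + 1) =
        Finset.univ.image fun i : Fin (k + 1) => (⟨⟨k, hm⟩, i⟩ : Vertex n) := by
      ext ⟨⟨j, hj⟩, i⟩
      simp only [Finset.mem_filter, Finset.mem_univ, true_and, Finset.mem_image]
      change j + 1 = k + 1 ↔ _
      constructor
      · intro h
        obtain rfl : j = k := by omega
        exact ⟨i, rfl⟩
      · rintro ⟨i', h⟩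
        rw [Sigma.mk.injEq, Fin.mk.injEq] at h
        omega
    rw [this, Finset.card_image_of_injective, Finset.card_univ, Fintype.card_fin]
    intro i j h
    simpa using h

/-- The scalar by which the commutator of `op 1 k` and `op (-1) k` acts, up to sign. -/
noncomputable def diagScalar (R : Tableau n) (k : ℕ) : ℂ :=
  ∑ a : Vertex n with row a = k,
    ((∏ s : Vertex n with row s = k + 1, (R a - 1 - R s)) *
        (∏ t : Vertex n with row t + 1 = k, (R a - R t)) /
        ((∏ c ∈ (Finset.univ.filter fun c : Vertex n => row c = k).erase a, (R a - R c)) *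
          ∏ c : Vertex n with row c = k, (R a - 1 - R c)) +
      (∏ s : Vertex n with row s = k + 1, (R a - R s)) *
        (∏ t : Vertex n with row t + 1 = k, (R a + 1 - R t)) /
        ((∏ c ∈ (Finset.univ.filter fun c : Vertex n => row c = k).erase a, (R a - R c)) *
          ∏ c : Vertex n with row c = k, (R a + 1 - R c)))

/-- The case `σ = 0` is set apart because `a` would then belong to `adj (-σ) a`, and its own shift
would enter the numerator. -/
theorem diag_term (R : Tableau n) (a : Vertex n) (σ : ℤ) :
    coef (adj σ a) R a * coef (adj (-σ) a) (shift R a σ) a =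
      (∏ s ∈ adj σ a, (R a - R s)) * (∏ t ∈ adj (-σ) a, (R a + σ - R t)) /
        ((∏ c ∈ peers a, (R a - R c)) * ∏ c ∈ peers a, (R a + σ - R c)) ∨ σ = 0 := by
  by_cases hσ : σ = 0
  · exact Or.inr hσ
  left
  rw [coef, coef, shift_self, prod_shift_of_notMem, prod_shift_of_notMem, div_mul_div_comm]
  · simp [mem_peers]
  · simp [mem_adj, hσ]

/-- The diagonal part of the commutator of `op 1 k` and `op (-1) k` is its only part. -/
theorem op_diag (hC : C ⊆ relR n ∪ relR0 n) {k : ℕ} (hk : k < n) {R : Tableau n}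
    (hR : R ∈ tableauxSet C L) :
    op C L (-1) k (op C L 1 k (tab C L R)) - op C L 1 k (op C L (-1) k (tab C L R)) =
      diagScalar R k • tab C L R := by
  classical
  rw [op_op_tab hR, op_op_tab hR]
  conv_lhs => rw [Finset.sum_comm]
  rw [← Finset.sum_sub_distrib, diagScalar, Finset.sum_smul]
  refine Finset.sum_congr rfl fun a ha => ?_
  rw [← Finset.sum_sub_distrib, Finset.sum_eq_single_of_mem a ha]
  · simp only [Finset.mem_filter, Finset.mem_univ, true_and] at ha
    have hp : (Finset.univ.filter fun c : Vertex n => row c = k).erase a = peers a := by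
      ext c; simp [mem_peers, ha, and_comm]
    have hU : (Finset.univ.filter fun s : Vertex n => row s = k + 1) = adj 1 a := by
      ext c; simp [adj]; omega
    have hW : (Finset.univ.filter fun s : Vertex n => row s + 1 = k) = adj (-1) a := by
      ext c; simp [adj]; omega
    have hI : ∀ x : ℂ, ∏ c : Vertex n with row c = k, (x - R c) =
        (x - R a) * ∏ c ∈ peers a, (x - R c) := by
      intro x
      rw [← hp, Finset.mul_prod_erase _ (fun c => x - R c) (by simp [ha])]
    have e : shift (shift R a 1) a (-1) = R := shift_shift_neg R a 1
    have e' : shift (shift R a (-1)) a 1 = R := shift_neg_shift R a 1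
    -- A forbidden step is stopped by a tight bound: weight 0 gives a zero of the step's
    -- coefficient, weight 1 a zero of the coefficient of the way back. This holds even if the
    -- denominator vanishes, so truncation does not change the sum.
    have zero : ∀ σ : ℤ, (σ = 1 ∨ σ = -1) → shift R a σ ∉ tableauxSet C L →
        coef (adj σ a) R a * coef (adj (-σ) a) (shift R a σ) a = 0 := by
      intro σ hσ hmem
      obtain ⟨y, w, hB, hya, hy⟩ := exists_tight hC hR (by omega) hσ hmem
      rcases hB.row hC (by omega) with ⟨rfl, hrow⟩ | ⟨rfl, hrow⟩
      · rw [coef_eq_zero (mem_adj.mpr hrow), zero_mul]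
        rw [hy]; simp
      · rw [coef_eq_zero (a := a) (b := y) (S := adj (-σ) a), mul_zero]
        · rw [mem_adj]; omega
        · rw [shift_self, shift_ne _ _ hya, hy]; simp
    rw [e, e', hp, hU, hW, hI, hI, ← sub_smul]
    congr 1
    have f1 : (if shift R a 1 ∈ tableauxSet C L then
        coef (adj 1 a) R a * coef (adj (-1) a) (shift R a 1) a else 0) =
        coef (adj 1 a) R a * coef (adj (-1) a) (shift R a 1) a := by
      split_ifs with h
      · rfl
      · exact (zero 1 (Or.inl rfl) h).symm
    have f2 : (if shift R a (-1) ∈ tableauxSet C L then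
        coef (adj (-1) a) R a * coef (adj 1 a) (shift R a (-1)) a else 0) =
        coef (adj (-1) a) R a * coef (adj 1 a) (shift R a (-1)) a := by
      split_ifs with h
      · rfl
      · exact (zero (-1) (Or.inr rfl) h).symm
    have g1 := (diag_term R a 1).resolve_right (by norm_num)
    have g2 := (diag_term R a (-1)).resolve_right (by norm_num)
    rw [neg_neg] at g2
    rw [f1, f2, g1, g2]
    push_cast
    -- In `diagScalar` the products over the whole row contain the factor of `a` itself, which is
    -- $\pm1$ and supplies the sign of the commutator.
    have h1 : R a + 1 - R a = 1 := by ring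
    have h2 : R a - 1 - R a = -1 := by ring
    rw [h1, h2, ← sub_eq_add_neg, one_mul, neg_one_mul, mul_neg, div_neg]
    ring
  · intro b hb hba
    simp only [Finset.mem_filter, Finset.mem_univ, true_and] at ha hb
    rw [shift_comm R b a, sub_eq_zero]
    refine smul_tab_congr fun hQ => ?_
    have h1 : shift R a (-1) ∈ tableauxSet C L := by
      rcases mem_of_two_step hC hR hba.symm (by omega) (Or.inr rfl) (Or.inl rfl) hQ with
        h1 | ⟨h1, -⟩
      · exact h1
      · omega
    have h2 : shift R b 1 ∈ tableauxSet C L := by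
      rw [shift_comm] at hQ
      rcases mem_of_two_step hC hR hba (by omega) (Or.inl rfl) (Or.inr rfl) hQ with
        h1 | ⟨h1, -⟩
      · exact h1
      · omega
    have h3 : b ∉ adj (-1) a := by rw [mem_adj]; omega
    have h4 : a ∉ adj 1 b := by rw [mem_adj]; omega
    rw [if_pos h1, if_pos h2, coef_shift_eq_coefErase h3 hba (by omega),
      coef_shift_eq_coefErase h4 hba.symm (by omega), coef_eq_coefErase hba (by omega),
      coef_eq_coefErase hba.symm (by omega), div_mul_div_comm, div_mul_div_comm]
    congr 1
    · ring
    · push_cast; ring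

end Operators

variable {n : ℕ} {C : Set (Relation n)} {L : Tableau n}

/-! ### The Serre relations for adjacent rows -/

section Serre

theorem adj_congr {σ : ℤ} {a b : Vertex n} (h : row a = row b) : adj σ a = adj σ b := by
  ext c; rw [mem_adj, mem_adj, h]

theorem sum_sum_eq_zero_of_antisymm {ι V : Type*} [AddCommGroup V] [Module ℂ V] (s : Finset ι)
    (g : ι → ι → V) (h : ∀ i ∈ s, ∀ j ∈ s, g i j + g j i = 0) : ∑ i ∈ s, ∑ j ∈ s, g i j = 0 := by
  have h1 : ∑ i ∈ s, ∑ j ∈ s, g i j + ∑ i ∈ s, ∑ j ∈ s, g i j = 0 := by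
    conv_lhs => arg 2; rw [Finset.sum_comm]
    rw [← Finset.sum_add_distrib]
    refine Finset.sum_eq_zero fun i hi => ?_
    rw [← Finset.sum_add_distrib]
    exact Finset.sum_eq_zero fun j hj => h i hi j hj
  rw [← two_smul ℂ] at h1
  exact (smul_eq_zero.mp h1).resolve_left two_ne_zero

/-- The commutator of the operators of two adjacent rows, the second one following the first in
the direction `σ`. -/
theorem op_lie_tab_following (hC : C ⊆ relR n ∪ relR0 n) {σ : ℤ} (hσ : σ = 1 ∨ σ = -1) {k l : ℕ}
    (hk : k < n) (hl : l < n) (hkl : (l : ℤ) = k + σ) {R : Tableau n} (hR : R ∈ tableauxSet C L) :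
    (op C L σ k * op C L σ l - op C L σ l * op C L σ k) (tab C L R) =
      ∑ a : Vertex n with row a = k, ∑ b : Vertex n with row b = l,
        (-σ * coef (adj σ b) R b * coef ((adj σ a).erase b) R a) •
          tab C L (shift (shift R a σ) b σ) := by
  classical
  rw [LinearMap.sub_apply, Module.End.mul_apply, Module.End.mul_apply, op_op_tab hR, op_op_tab hR,
    Finset.sum_comm, ← Finset.sum_sub_distrib]
  refine Finset.sum_congr rfl fun a ha => ?_
  rw [← Finset.sum_sub_distrib]
  refine Finset.sum_congr rfl fun b hb => ?_
  simp only [Finset.mem_filter, Finset.mem_univ, true_and] at ha hb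
  have hab : a ≠ b := by rintro rfl; omega
  rw [shift_comm R b a, ← sub_smul]
  refine smul_tab_congr fun hQ => ?_
  have hba : b ∈ adj σ a := by rw [mem_adj]; omega
  have hnab : a ∉ adj σ b := by rw [mem_adj]; omega
  -- A missing intermediate tableau means a tight bound between `a` and `b`, which makes the generic
  -- coefficient zero anyway; the condition can be dropped. The same applies to the other order.
  have h1 : (if shift R a σ ∈ tableauxSet C L then
      coef (adj σ a) R a * coef (adj σ b) (shift R a σ) b else 0) =
      coef (adj σ a) R a * coef (adj σ b) (shift R a σ) b := by
    split_ifs with h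
    · rfl
    · rcases mem_of_two_step hC hR hab (by omega) hσ hσ hQ with h' | ⟨-, w, hB, hw⟩
      · exact absurd h' h
      · have := hB.row hC (by omega)
        obtain rfl : w = 0 := by omega
        rw [coef_eq_zero hba, zero_mul]
        rw [hw]; simp
  have h2 : (if shift R b σ ∈ tableauxSet C L then
      coef (adj σ b) R b * coef (adj σ a) (shift R b σ) a else 0) =
      coef (adj σ b) R b * coef (adj σ a) (shift R b σ) a := by
    split_ifs with h
    · rfl
    · rw [shift_comm] at hQ
      rcases mem_of_two_step hC hR hab.symm (by omega) hσ hσ hQ with h' | ⟨-, w, hB, hw⟩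
      · exact absurd h' h
      · have := hB.row hC (by omega)
        obtain rfl : w = 1 := by omega
        rw [coef_shift_of_mem hba (by omega), hw]; simp
  rw [h1, h2, coef_shift_of_mem hba (by omega), coef_shift_of_notMem hnab (by omega),
    coef_of_mem hba]
  ring

/-- The commutator of the operators of two adjacent rows, the first one following the second in
the direction `σ`. -/
theorem op_lie_tab_preceding (hC : C ⊆ relR n ∪ relR0 n) {σ : ℤ} (hσ : σ = 1 ∨ σ = -1) {k l : ℕ}
    (hk : k < n) (hl : l < n) (hkl : (l : ℤ) = k - σ) {R : Tableau n} (hR : R ∈ tableauxSet C L) :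
    (op C L σ k * op C L σ l - op C L σ l * op C L σ k) (tab C L R) =
      ∑ a : Vertex n with row a = k, ∑ b : Vertex n with row b = l,
        (σ * coef (adj σ a) R a * coef ((adj σ b).erase a) R b) •
          tab C L (shift (shift R a σ) b σ) := by
  classical
  rw [LinearMap.sub_apply, Module.End.mul_apply, Module.End.mul_apply, op_op_tab hR, op_op_tab hR,
    Finset.sum_comm, ← Finset.sum_sub_distrib]
  refine Finset.sum_congr rfl fun a ha => ?_
  rw [← Finset.sum_sub_distrib]
  refine Finset.sum_congr rfl fun b hb => ?_
  simp only [Finset.mem_filter, Finset.mem_univ, true_and] at ha hb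
  have hab : a ≠ b := by rintro rfl; omega
  rw [shift_comm R b a, ← sub_smul]
  refine smul_tab_congr fun hQ => ?_
  have hba : b ∉ adj σ a := by rw [mem_adj]; omega
  have hnab : a ∈ adj σ b := by rw [mem_adj]; omega
  have h1 : (if shift R a σ ∈ tableauxSet C L then
      coef (adj σ a) R a * coef (adj σ b) (shift R a σ) b else 0) =
      coef (adj σ a) R a * coef (adj σ b) (shift R a σ) b := by
    split_ifs with h
    · rfl
    · rcases mem_of_two_step hC hR hab (by omega) hσ hσ hQ with h' | ⟨-, w, hB, hw⟩
      · exact absurd h' h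
      · have := hB.row hC (by omega)
        obtain rfl : w = 1 := by omega
        rw [coef_shift_of_mem hnab (by omega), hw]; simp
  have h2 : (if shift R b σ ∈ tableauxSet C L then
      coef (adj σ b) R b * coef (adj σ a) (shift R b σ) a else 0) =
      coef (adj σ b) R b * coef (adj σ a) (shift R b σ) a := by
    split_ifs with h
    · rfl
    · rw [shift_comm] at hQ
      rcases mem_of_two_step hC hR hab.symm (by omega) hσ hσ hQ with h' | ⟨-, w, hB, hw⟩
      · exact absurd h' h
      · have := hB.row hC (by omega)
        obtain rfl : w = 0 := by omega
        rw [coef_eq_zero hnab, zero_mul]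
        rw [hw]; simp
  rw [h1, h2, coef_shift_of_mem hnab (by omega), coef_shift_of_notMem hba (by omega),
    coef_of_mem hnab]
  ring

/-- An operator that is given on the basis by its coefficients `y` and moves an entry of row `k`
and an entry of row `l` commutes with `op σ k`, if the coefficients satisfy the relation that
corresponds to each tableau, and all obstructed paths contribute zero. -/
theorem op_lie_eq_zero {σ : ℤ} {k l : ℕ} {Y : Module.End ℂ (TableauxSpace C L)}
    {y : Tableau n → Vertex n → Vertex n → ℂ}
    (hY : ∀ R ∈ tableauxSet C L, Y (tab C L R) =
      ∑ a : Vertex n with row a = k, ∑ b : Vertex n with row b = l,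
        y R a b • tab C L (shift (shift R a σ) b σ))
    (h1 : ∀ R ∈ tableauxSet C L, ∀ a a' b, row a = k → row a' = k → row b = l →
      shift (shift (shift R a σ) a' σ) b σ ∈ tableauxSet C L → shift R a' σ ∉ tableauxSet C L →
      coef (adj σ a') R a' * y (shift R a' σ) a b = 0)
    (h2 : ∀ R ∈ tableauxSet C L, ∀ a a' b, row a = k → row a' = k → row b = l →
      shift (shift (shift R a σ) a' σ) b σ ∈ tableauxSet C L →
      shift (shift R a σ) b σ ∉ tableauxSet C L →
      y R a b * coef (adj σ a') (shift (shift R a σ) b σ) a' = 0)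
    (h3 : ∀ R ∈ tableauxSet C L, ∀ a a' b, row a = k → row a' = k → row b = l →
      shift (shift (shift R a σ) a' σ) b σ ∈ tableauxSet C L →
      (y R a b * coef (adj σ a') (shift (shift R a σ) b σ) a' -
        coef (adj σ a') R a' * y (shift R a' σ) a b) +
      (y R a' b * coef (adj σ a) (shift (shift R a' σ) b σ) a -
        coef (adj σ a) R a * y (shift R a σ) a' b) = 0) :
    op C L σ k * Y - Y * op C L σ k = 0 := by
  classical
  refine end_ext fun R hR => ?_
  rw [LinearMap.sub_apply, Module.End.mul_apply, Module.End.mul_apply, LinearMap.zero_apply]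
  have e1 : op C L σ k (Y (tab C L R)) =
      ∑ b : Vertex n with row b = l, ∑ a : Vertex n with row a = k,
        ∑ a' : Vertex n with row a' = k,
        (y R a b * coef (adj σ a') (shift (shift R a σ) b σ) a') •
          tab C L (shift (shift (shift R a σ) a' σ) b σ) := by
    rw [hY R hR, map_sum]
    simp only [map_sum]
    rw [Finset.sum_comm]
    refine Finset.sum_congr rfl fun b hb => Finset.sum_congr rfl fun a ha => ?_
    rw [map_smul, op_tab', Finset.smul_sum]
    refine Finset.sum_congr rfl fun a' ha' => ?_
    simp only [Finset.mem_filter, Finset.mem_univ, true_and] at ha hb ha'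
    rw [smul_smul, shift_comm _ b a']
    refine smul_tab_congr fun hQ => ?_
    split_ifs with hm
    · rfl
    · rw [h2 R hR a a' b ha ha' hb hQ hm, mul_zero]
  have e2 : Y (op C L σ k (tab C L R)) =
      ∑ b : Vertex n with row b = l, ∑ a : Vertex n with row a = k,
        ∑ a' : Vertex n with row a' = k,
        (coef (adj σ a') R a' * y (shift R a' σ) a b) •
          tab C L (shift (shift (shift R a σ) a' σ) b σ) := by
    have : ∀ a' : Vertex n, row a' = k →
        coef (adj σ a') R a' • Y (tab C L (shift R a' σ)) =
        ∑ a : Vertex n with row a = k, ∑ b : Vertex n with row b = l,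
          (coef (adj σ a') R a' * y (shift R a' σ) a b) •
          tab C L (shift (shift (shift R a σ) a' σ) b σ) := by
      intro a' ha'
      by_cases hm : shift R a' σ ∈ tableauxSet C L
      · rw [hY _ hm, Finset.smul_sum]
        refine Finset.sum_congr rfl fun a ha => ?_
        rw [Finset.smul_sum]
        refine Finset.sum_congr rfl fun b hb => ?_
        rw [smul_smul, shift_comm R a a']
      · rw [tab_of_notMem hm, map_zero, smul_zero]
        symm
        refine Finset.sum_eq_zero fun a ha => Finset.sum_eq_zero fun b hb => ?_
        simp only [Finset.mem_filter, Finset.mem_univ, true_and] at ha hb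
        by_cases hQ : shift (shift (shift R a σ) a' σ) b σ ∈ tableauxSet C L
        · rw [h1 R hR a a' b ha ha' hb hQ hm, zero_smul]
        · rw [tab_of_notMem hQ, smul_zero]
    rw [op_tab hR, map_sum]
    simp only [map_smul]
    rw [Finset.sum_congr rfl fun a' ha' => this a' (Finset.mem_filter.mp ha').2, Finset.sum_comm]
    rw [Finset.sum_comm (s := Finset.univ.filter fun b : Vertex n => row b = l)]
    refine Finset.sum_congr rfl fun a _ => ?_
    rw [Finset.sum_comm]
  rw [e1, e2, ← Finset.sum_sub_distrib]
  refine Finset.sum_eq_zero fun b hb => ?_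
  rw [← Finset.sum_sub_distrib]
  simp only [← Finset.sum_sub_distrib]
  -- Paths that move `a` and `a'` in either order have the same target, and only their combined
  -- contribution vanishes.
  refine sum_sum_eq_zero_of_antisymm _ _ fun a ha a' ha' => ?_
  simp only [Finset.mem_filter, Finset.mem_univ, true_and] at ha hb ha'
  rw [shift_comm R a' a, ← sub_smul, ← sub_smul, ← add_smul]
  by_cases hQ : shift (shift (shift R a σ) a' σ) b σ ∈ tableauxSet C L
  · rw [h3 R hR a a' b ha ha' hb hQ, zero_smul]
  · rw [tab_of_notMem hQ, smul_zero]

/-- An obstruction to the first step of a path of three steps. -/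
theorem tight_of_three_step (hC : C ⊆ relR n ∪ relR0 n) {σ : ℤ} (hσ : σ = 1 ∨ σ = -1)
    {R : Tableau n} (hR : R ∈ tableauxSet C L) {a a' b : Vertex n} (haa' : row a = row a')
    (hab : row b ≠ row a) (ha : row a < n)
    (hQ : shift (shift (shift R a σ) a' σ) b σ ∈ tableauxSet C L)
    (h : shift R a' σ ∉ tableauxSet C L) :
    ∃ w, Bound C σ a' b w ∧ R b = R a' + σ * w ∧ a ≠ a' := by
  obtain ⟨y, w, hB, hya, hy⟩ := exists_tight hC hR (haa' ▸ ha) hσ h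
  obtain ⟨m, hm⟩ := hB.exists_nat hQ.1
  have hrow := hB.row hC (haa' ▸ ha)
  have hyra : y ≠ a := by rintro rfl; omega
  have hba' : a' ≠ b := by rintro rfl; omega
  have hba : b ≠ a := by rintro rfl; omega
  have hσ2 : (σ : ℂ) * σ = 1 := by rcases hσ with rfl | rfl <;> simp
  rw [shift_ne _ _ hba', shift_self] at hm
  -- The other end of a tight bound must move, and `b` is the only position in another row that
  -- does. Were `a = a'`, that entry would advance twice and `b` only once, which breaks the bound.
  by_cases hyb : y = b
  · subst hyb
    refine ⟨w, hB, hy, ?_⟩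
    rintro rfl
    rw [shift_self, shift_ne _ _ hya, shift_ne _ _ hya, shift_self, hy] at hm
    have : ((m + 1 : ℕ) : ℂ) = 0 := by
      push_cast at hm ⊢; linear_combination -hm + (w - 1) * hσ2
    exact absurd this (Nat.cast_ne_zero.mpr (by omega))
  · rw [shift_ne _ _ hyb, shift_ne _ _ hya, shift_ne _ _ hyra, hy] at hm
    by_cases heq : a' = a
    · subst heq
      rw [shift_self] at hm
      have : ((m + 2 : ℕ) : ℂ) = 0 := by
        push_cast at hm ⊢; linear_combination -hm + (w - 2) * hσ2
      exact absurd this (Nat.cast_ne_zero.mpr (by omega))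
    · rw [shift_ne _ _ heq] at hm
      have : ((m + 1 : ℕ) : ℂ) = 0 := by
        push_cast at hm ⊢; linear_combination -hm + (w - 1) * hσ2
      exact absurd this (Nat.cast_ne_zero.mpr (by omega))

/-- An obstruction to the last step, taken backwards, of a path of three steps. -/
theorem tight_of_three_step_back (hC : C ⊆ relR n ∪ relR0 n) {σ : ℤ} (hσ : σ = 1 ∨ σ = -1)
    {R : Tableau n} (hR : R ∈ tableauxSet C L) {a a' b : Vertex n} (haa' : row a = row a')
    (hab : row b ≠ row a) (ha : row a < n)
    (hQ : shift (shift (shift R a σ) a' σ) b σ ∈ tableauxSet C L)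
    (h : shift (shift R a σ) b σ ∉ tableauxSet C L) :
    ∃ w, Bound C (-σ) a' b w ∧
      (shift (shift R a σ) b σ) b = (shift (shift R a σ) b σ) a' + σ - σ * w ∧ a ≠ a' := by
  have hba' : a' ≠ b := by rintro rfl; omega
  set Q := shift (shift (shift R a σ) a' σ) b σ with hQdef
  -- The reversed path starts at `Q` and runs in direction `-σ`, so the preceding lemma applies to
  -- it.
  have e1 : shift Q a' (-σ) = shift (shift R a σ) b σ := by
    rw [hQdef, shift_comm _ a' b, shift_shift_neg]
  have e2 : shift (shift (shift Q a (-σ)) a' (-σ)) b (-σ) = R := by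
    rw [shift_comm Q a a', e1, shift_comm R a b, shift_shift_neg, shift_shift_neg]
  obtain ⟨w, hB, hw, hne⟩ := tight_of_three_step hC (σ := -σ) (by omega) hQ haa' hab ha
    (by rwa [e2]) (by rwa [e1])
  refine ⟨w, hB, ?_, hne⟩
  have h1 : shift (shift R a σ) b σ b = Q b := by
    rw [← e1, shift_ne _ _ hba'.symm]
  have h2 : shift (shift R a σ) b σ a' = Q a' - σ := by
    rw [← e1, shift_self]; push_cast; ring
  rw [h1, h2, hw]; push_cast; ring

/-- Here $u=l_a-l_{a'}$, $s=\sigma$, $d=l_a-l_b$, $d'=l_{a'}-l_b$, while $p,q$ are the coefficients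
of $a,a'$ without their mutual denominator and without the factor of $b$. The denominators $u$ and
$u\pm s$ are the reason why entries at distance one must be excluded. -/
theorem add_eq_zero_aux_following {u v s p q x d d' : ℂ} (hu : u ≠ 0) (h1 : u + s ≠ 0)
    (h2 : u - s ≠ 0) (hv : v = -u) (hd : d = u + d') :
    (-s * x * (p / u) * ((d' - s) * (q / (v - s))) - (d' * (q / v)) * (-s * x * (p / (u - s)))) +
    (-s * x * (q / v) * ((d - s) * (p / (u - s))) - (d * (p / u)) * (-s * x * (q / (v - s)))) =
      0 := by
  subst hv hd
  have h3 : -u - s ≠ 0 := fun h => h1 (by linear_combination -h)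
  field_simp
  ring

/-- The companion identity when the entries at $a,a'$ occur in the numerator of $b$: now $d=l_b-l_a$
and $d'=l_b-l_{a'}$. -/
theorem add_eq_zero_aux_preceding {u v s p q x d d' : ℂ} (hu : u ≠ 0) (h1 : u + s ≠ 0)
    (h2 : u - s ≠ 0) (hv : v = -u) (hd : d' = u + d) :
    (s * (p / u) * (d' * x) * (q / (v - s)) - (q / v) * (s * (p / (u - s)) * ((d' - s) * x))) +
    (s * (q / v) * (d * x) * (p / (u - s)) - (p / u) * (s * (q / (v - s)) * ((d - s) * x))) =
      0 := by
  subst hv hd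
  have h3 : -u - s ≠ 0 := fun h => h1 (by linear_combination -h)
  field_simp
  ring

/-- The differences of entries that occur in denominators do not vanish. -/
theorem sub_ne_zero_of_step (hnc : ∀ R ∈ tableauxSet C L, NoncriticalTableau R) {R : Tableau n}
    (hR : R ∈ tableauxSet C L) {a a' : Vertex n} (hne : a ≠ a') (haa' : row a = row a')
    (ha : row a < n) {σ : ℤ} (hσ : σ = 1 ∨ σ = -1) (h1 : R a ≠ R a' + 1) (h2 : R a' ≠ R a + 1) :
    R a - R a' ≠ 0 ∧ R a - R a' + σ ≠ 0 ∧ R a - R a' - σ ≠ 0 := by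
  refine ⟨sub_ne_zero.mpr (hnc R hR a a' haa' ha hne), ?_, ?_⟩
  · rcases hσ with rfl | rfl
    · intro h; apply h2; push_cast at h; linear_combination -h
    · intro h; apply h1; push_cast at h; linear_combination h
  · rcases hσ with rfl | rfl
    · intro h; apply h1; push_cast at h; linear_combination h
    · intro h; apply h2; push_cast at h; linear_combination -h

/-- The Serre relations. -/
theorem op_serre (hC : C ⊆ relR n ∪ relR0 n)
    (hnc : ∀ R ∈ tableauxSet C L, NoncriticalTableau R) {σ : ℤ} (hσ : σ = 1 ∨ σ = -1)
    {k l : ℕ} (hk : k < n) (hl : l < n) (hkl : l = k + 1 ∨ k = l + 1)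
    (hgap : ∀ R ∈ tableauxSet C L, ∀ a a' b, row a = k → row a' = k → row b = l → a ≠ a' →
      shift (shift (shift R a σ) a' σ) b σ ∈ tableauxSet C L → R a ≠ R a' + 1) :
    op C L σ k * (op C L σ k * op C L σ l - op C L σ l * op C L σ k) -
      (op C L σ k * op C L σ l - op C L σ l * op C L σ k) * op C L σ k = 0 := by
  have hcase : (l : ℤ) = k + σ ∨ (l : ℤ) = k - σ := by omega
  rcases hcase with hcase | hcase
  · refine op_lie_eq_zero (fun R hR => op_lie_tab_following hC hσ hk hl hcase hR) ?_ ?_ ?_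
    · intro R hR a a' b ha ha' hb hQ hm
      obtain ⟨w, hB, hw, hne⟩ := tight_of_three_step hC hσ hR (by omega) (by omega) (by omega) hQ hm
      have := hB.row hC (by omega)
      obtain rfl : w = 0 := by omega
      rw [coef_eq_zero (a := a') (b := b) (by rw [mem_adj]; omega) (by rw [hw]; simp), zero_mul]
    · intro R hR a a' b ha ha' hb hQ hm
      obtain ⟨w, hB, hw, hne⟩ :=
        tight_of_three_step_back hC hσ hR (by omega) (by omega) (by omega) hQ hm
      have := hB.row hC (by omega)
      obtain rfl : w = 1 := by omega
      rw [coef_eq_zero (a := a') (b := b) (by rw [mem_adj]; omega) (by rw [hw]; simp), mul_zero]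
    · intro R hR a a' b ha ha' hb hQ
      have hba' : b ∈ adj σ a' := by rw [mem_adj]; omega
      have hba : b ∈ adj σ a := by rw [mem_adj]; omega
      have hnab : a ∉ adj σ b := by rw [mem_adj]; omega
      have hnab' : a' ∉ adj σ b := by rw [mem_adj]; omega
      have hab : b ≠ a := by rintro rfl; omega
      have hab' : b ≠ a' := by rintro rfl; omega
      rw [coef_shift_of_mem hba' (by omega), coef_shift_of_notMem hnab' (by omega),
        coef_shift_of_mem hba (by omega), coef_shift_of_notMem hnab (by omega), coef_of_mem hba,
        coef_of_mem hba', adj_congr (show row a' = row a by omega), shift_ne _ _ hab,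
        shift_ne _ _ hab']
      -- If one entry moves twice, the moves of $a$ and $b$ leave $l_a-l_b$ unchanged, and each
      -- commutator term vanishes by itself.
      by_cases hne : a = a'
      · subst hne
        rw [shift_self]; ring
      have hS : ∀ c, row c = row a → c ∉ (adj σ a).erase b := by
        intro c hc; rw [Finset.mem_erase, mem_adj]; omega
      rw [shift_ne _ _ (Ne.symm hne), shift_ne _ _ hne,
        coef_shift_eq_coefErase (hS a rfl) hne (by omega),
        coef_shift_eq_coefErase (hS a' (by omega)) (Ne.symm hne) (by omega),
        coef_eq_coefErase hne (by omega), coef_eq_coefErase (Ne.symm hne) (by omega)]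
      obtain ⟨g1, g2, g3⟩ := sub_ne_zero_of_step hnc hR hne (by omega) (by omega) hσ
        (hgap R hR a a' b ha ha' hb hne hQ)
        (hgap R hR a' a b ha' ha hb (Ne.symm hne) (by rwa [shift_comm R a' a]))
      exact add_eq_zero_aux_following g1 g2 g3 (by ring) (by ring)
  · refine op_lie_eq_zero (fun R hR => op_lie_tab_preceding hC hσ hk hl hcase hR) ?_ ?_ ?_
    · intro R hR a a' b ha ha' hb hQ hm
      obtain ⟨w, hB, hw, hne⟩ := tight_of_three_step hC hσ hR (by omega) (by omega) (by omega) hQ hm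
      have := hB.row hC (by omega)
      obtain rfl : w = 1 := by omega
      have hab' : b ≠ a' := by rintro rfl; omega
      rw [coef_eq_zero (S := (adj σ b).erase a) (a := b) (b := a'), mul_zero, mul_zero]
      · rw [Finset.mem_erase, mem_adj]; exact ⟨Ne.symm hne, by omega⟩
      · rw [shift_self, shift_ne _ _ hab', hw]; simp
    · intro R hR a a' b ha ha' hb hQ hm
      obtain ⟨w, hB, hw, hne⟩ :=
        tight_of_three_step_back hC hσ hR (by omega) (by omega) (by omega) hQ hm
      have := hB.row hC (by omega)
      obtain rfl : w = 0 := by omega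
      have hab' : b ≠ a' := by rintro rfl; omega
      have hab : b ≠ a := by rintro rfl; omega
      rw [coef_eq_zero (S := (adj σ b).erase a) (a := b) (b := a'), mul_zero, zero_mul]
      · rw [Finset.mem_erase, mem_adj]; exact ⟨Ne.symm hne, by omega⟩
      · rw [shift_self, shift_ne _ _ hab, shift_ne _ _ hab'.symm, shift_ne _ _ (Ne.symm hne)] at hw
        linear_combination -hw
    · intro R hR a a' b ha ha' hb hQ
      have hba' : b ∉ adj σ a' := by rw [mem_adj]; omega
      have hba : b ∉ adj σ a := by rw [mem_adj]; omega
      have hab : b ≠ a := by rintro rfl; omega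
      have hab' : b ≠ a' := by rintro rfl; omega
      rw [coef_shift_of_notMem hba' (by omega), coef_shift_of_notMem hba (by omega),
        adj_congr (show row a' = row a by omega)]
      by_cases hne : a = a'
      · subst hne
        rw [coef_shift_of_notMem (S := (adj σ b).erase a) (by simp) (by omega)]; ring
      have hS : ∀ c, row c = row a → c ∉ adj σ a := by
        intro c hc; rw [mem_adj]; omega
      have m1 : a' ∈ (adj σ b).erase a := by
        rw [Finset.mem_erase, mem_adj]; exact ⟨Ne.symm hne, by omega⟩
      have m2 : a ∈ (adj σ b).erase a' := by
        rw [Finset.mem_erase, mem_adj]; exact ⟨hne, by omega⟩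
      rw [coef_shift_of_mem m1 (by omega), coef_shift_of_mem m2 (by omega), coef_of_mem m1,
        coef_of_mem m2, Finset.erase_right_comm (a := a') (b := a),
        coef_shift_eq_coefErase (hS a rfl) hne (by omega),
        coef_shift_eq_coefErase (hS a' (by omega)) (Ne.symm hne) (by omega),
        coef_eq_coefErase hne (by omega), coef_eq_coefErase (Ne.symm hne) (by omega)]
      obtain ⟨g1, g2, g3⟩ := sub_ne_zero_of_step hnc hR hne (by omega) (by omega) hσ
        (hgap R hR a a' b ha ha' hb hne hQ)
        (hgap R hR a' a b ha' ha hb (Ne.symm hne) (by rwa [shift_comm R a' a]))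
      exact add_eq_zero_aux_preceding g1 g2 g3 (by ring) (by ring)

end Serre

variable {n : ℕ} {C : Set (Relation n)} {L : Tableau n}

/-! ### The module structure and the diagonal scalars -/

section Module

/-- The eigenvalue of `E_{k+1,k+1}` at a tableau. -/
noncomputable def weight (R : Tableau n) (k : ℕ) : ℂ :=
  (k : ℂ) + ∑ a : Vertex n with row a = k + 1, R a - ∑ a : Vertex n with row a = k, R a

variable (C L) in
/-- The diagonal operator `E_{k+1,k+1}`. -/
noncomputable def weightOp (k : ℕ) : Module.End ℂ (TableauxSpace C L) :=
  Finsupp.linearCombination ℂ fun R : tableauxSet C L => weight R.1 k • tab C L R.1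

theorem weightOp_tab (R : Tableau n) (k : ℕ) :
    weightOp C L k (tab C L R) = weight R k • tab C L R := by
  by_cases hR : R ∈ tableauxSet C L
  · conv_lhs => rw [tab_of_mem hR, weightOp, Finsupp.linearCombination_single, one_smul]
  · rw [tab_of_notMem hR, map_zero, smul_zero]

theorem sum_row_shift (R : Tableau n) (a : Vertex n) (σ : ℤ) (m : ℕ) :
    ∑ b : Vertex n with row b = m, shift R a σ b =
      ∑ b : Vertex n with row b = m, R b + if row a = m then (σ : ℂ) else 0 := by
  have : ∀ b, shift R a σ b = R b + if b = a then (σ : ℂ) else 0 := by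
    intro b; simp only [shift]; split_ifs <;> simp
  simp only [this, Finset.sum_add_distrib, Finset.sum_ite_eq', Finset.mem_filter, Finset.mem_univ,
    true_and]

theorem weightOp_lie_op (σ : ℤ) (k m : ℕ) :
    weightOp C L k * op C L σ m - op C L σ m * weightOp C L k =
      ((σ : ℂ) * ((if m = k + 1 then 1 else 0) - if m = k then 1 else 0)) • op C L σ m := by
  refine end_ext fun R hR => ?_
  rw [LinearMap.sub_apply, Module.End.mul_apply, Module.End.mul_apply, weightOp_tab, map_smul,
    LinearMap.smul_apply, op_tab hR, map_sum, Finset.smul_sum, Finset.smul_sum,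
    ← Finset.sum_sub_distrib]
  refine Finset.sum_congr rfl fun a ha => ?_
  simp only [Finset.mem_filter, Finset.mem_univ, true_and] at ha
  rw [map_smul, weightOp_tab, smul_smul, smul_smul, smul_smul, ← sub_smul]
  congr 1
  rw [weight, weight, sum_row_shift, sum_row_shift, ha]
  split_ifs <;> ring

/-- The value of the diagonal part of `[E_{k,k+1}, E_{k+1,k}]` that the relations require. -/
noncomputable def diagValue (R : Tableau n) (k : ℕ) : ℂ :=
  2 * ∑ c : Vertex n with row c = k, R c + k - (k + 1 : ℕ) -
    ∑ s : Vertex n with row s = k + 1, R s - ∑ t : Vertex n with row t + 1 = k, R t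

theorem diagValue_eq (R : Tableau n) (k : ℕ) :
    diagValue R (k + 1) = weight R k - weight R (k + 1) := by
  have : (Finset.univ.filter fun t : Vertex n => row t + 1 = k + 1) =
      Finset.univ.filter fun t : Vertex n => row t = k := by
    ext t; simp
  rw [diagValue, weight, weight, this]
  push_cast
  ring

/-- The defining relations of `𝔤𝔩_n` in an associative algebra. -/
theorem glRelations_of_ring {A : Type*} [Ring A] [Algebra ℂ A] {n : ℕ} {x y w : ℕ → A}
    (hw : ∀ k l, w k * w l = w l * w k)
    (hx : ∀ k l, w k * x l - x l * w k =
      ((if l = k then 1 else 0) - (if l + 1 = k then 1 else 0) : ℂ) • x l)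
    (hy : ∀ k l, w k * y l - y l * w k =
      (-((if l = k then 1 else 0) - (if l + 1 = k then 1 else 0)) : ℂ) • y l)
    (hxy : ∀ k l, k + 1 < n → l + 1 < n → k ≠ l → x k * y l = y l * x k)
    (hxy' : ∀ k, k + 1 < n → y k * x k - x k * y k = w k - w (k + 1))
    (hxx : ∀ k l, k + 1 < l → l + 1 < n → x k * x l = x l * x k)
    (hyy : ∀ k l, k + 1 < l → l + 1 < n → y k * y l = y l * y k)
    (hsx : ∀ k l, k + 1 < n → l + 1 < n → (l = k + 1 ∨ k = l + 1) →
      x k * (x k * x l - x l * x k) - (x k * x l - x l * x k) * x k = 0)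
    (hsy : ∀ k l, k + 1 < n → l + 1 < n → (l = k + 1 ∨ k = l + 1) →
      y k * (y k * y l - y l * y k) - (y k * y l - y l * y k) * y k = 0) :
    GLRelations n (fun k => -x k) y w := by
  constructor
  · intro k l hk hl
    rw [Ring.lie_def, hw, sub_self]
  · intro k l hk hl
    rw [lie_neg, Ring.lie_def, hx]
    by_cases h1 : k = l
    · subst h1; simp
    · by_cases h2 : k = l + 1
      · subst h2; simp
      · simp [h1, h2, Ne.symm h1, Ne.symm h2]
  · intro k l hk hl
    rw [Ring.lie_def, hy]
    by_cases h1 : k = l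
    · subst h1; simp
    · by_cases h2 : k = l + 1
      · subst h2; simp
      · simp [h1, h2, Ne.symm h1, Ne.symm h2]
  · intro k l hk hl
    rw [neg_lie, Ring.lie_def]
    split_ifs with hkl
    · subst hkl; rw [neg_sub, hxy' k hk]
    · rw [hxy k l hk hl hkl, sub_self, neg_zero]
  · intro k l hkl hl
    rw [neg_lie, lie_neg, neg_neg, Ring.lie_def, hxx k l hkl hl, sub_self]
  · intro k l hkl hl
    rw [Ring.lie_def, hyy k l hkl hl, sub_self]
  · intro k hk
    simp only [neg_lie, lie_neg, neg_neg]
    rw [Ring.lie_def, Ring.lie_def, hsx k (k + 1) (by omega) (by omega) (by omega), neg_zero]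
  · intro k hk
    simp only [neg_lie, lie_neg, neg_neg]
    rw [Ring.lie_def, Ring.lie_def, hsx (k + 1) k (by omega) (by omega) (by omega), neg_zero]
  · intro k hk
    rw [Ring.lie_def, Ring.lie_def, hsy k (k + 1) (by omega) (by omega) (by omega)]
  · intro k hk
    rw [Ring.lie_def, Ring.lie_def, hsy (k + 1) k (by omega) (by omega) (by omega)]

/-- The Gelfand–Tsetlin formulas define a module if the diagonal scalars are the required ones and
entries of a row cannot differ by one before and after a step of the Serre relations. -/
theorem isGTModule_of_diagScalar (hC : C ⊆ relR n ∪ relR0 n)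
    (hnc : ∀ R ∈ tableauxSet C L, NoncriticalTableau R)
    (hdiag : ∀ R ∈ tableauxSet C L, ∀ k, 0 < k → k < n → diagScalar R k = diagValue R k)
    (hgap : ∀ σ : ℤ, (σ = 1 ∨ σ = -1) → ∀ R ∈ tableauxSet C L, ∀ a a' b, row a < n →
      row a = row a' → row b < n → (row b = row a + 1 ∨ row a = row b + 1) → a ≠ a' →
      shift (shift (shift R a σ) a' σ) b σ ∈ tableauxSet C L → R a ≠ R a' + 1) :
    IsGTModule C L := by
  have serre : ∀ σ : ℤ, (σ = 1 ∨ σ = -1) → ∀ k l : ℕ, k + 1 < n → l + 1 < n →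
      (l = k + 1 ∨ k = l + 1) →
      op C L σ (k + 1) * (op C L σ (k + 1) * op C L σ (l + 1) - op C L σ (l + 1) * op C L σ (k + 1)) -
      (op C L σ (k + 1) * op C L σ (l + 1) - op C L σ (l + 1) * op C L σ (k + 1)) *
        op C L σ (k + 1) = 0 := by
    intro σ hσ k l hk hl hkl
    refine op_serre hC hnc hσ hk hl (by omega) fun R hR a a' b ha ha' hb hne hQ => ?_
    exact hgap σ hσ R hR a a' b (by omega) (by omega) (by omega) (by omega) hne hQ
  have H : GLRelations n (fun k => -op C L 1 (k + 1)) (fun k => op C L (-1) (k + 1))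
      (weightOp C L) := by
    refine glRelations_of_ring (A := Module.End ℂ (TableauxSpace C L)) ?_ ?_ ?_ ?_ ?_ ?_ ?_
      (serre 1 (Or.inl rfl)) (serre (-1) (Or.inr rfl))
    · intro k l
      refine end_ext fun R hR => ?_
      rw [Module.End.mul_apply, Module.End.mul_apply, weightOp_tab, weightOp_tab, map_smul,
        map_smul, weightOp_tab, weightOp_tab, smul_comm]
    · intro k l
      refine (weightOp_lie_op 1 k (l + 1)).trans ?_
      simp only [add_left_inj, Int.cast_one, one_mul]
    · intro k l
      refine (weightOp_lie_op (-1) k (l + 1)).trans ?_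
      simp only [add_left_inj, Int.cast_neg, Int.cast_one, neg_one_mul]
    · intro k l hk hl hkl
      exact op_comm hC (Or.inl rfl) (Or.inr rfl) hk hl (by omega) (Or.inl rfl)
    · intro k hk
      refine end_ext fun R hR => ?_
      refine (op_diag hC hk hR).trans ?_
      rw [hdiag R hR _ (by omega) hk, diagValue_eq, sub_smul, ← weightOp_tab, ← weightOp_tab]
      rfl
    · intro k l hkl hl
      exact op_comm hC (Or.inl rfl) (Or.inl rfl) (by omega) hl (by omega)
        (Or.inr (Or.inl (by omega)))
    · intro k l hkl hl
      exact op_comm hC (Or.inr rfl) (Or.inr rfl) (by omega) hl (by omega)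
        (Or.inr (Or.inl (by omega)))
  obtain ⟨ρ, hρ, hρ'⟩ := H.exists_lieHom
  refine ⟨ρ, fun R hR => ⟨fun k l hkl => ?_, fun k => ?_⟩⟩
  · obtain ⟨h1, h2⟩ := hρ k l hkl
    rw [h1, h2, LinearMap.neg_apply, op_tab hR, op_tab hR]
    simp only [raiseCoeff_eq, lowerCoeff_eq, neg_smul, Finset.sum_neg_distrib, and_self]
  · rw [hρ', weightOp_tab, weight]

theorem neg_mul_sub_mul_neg {A : Type*} [Ring A] (x y : A) : -x * y - y * -x = y * x - x * y := by
  rw [neg_mul, mul_neg, neg_sub_neg]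

/-- In a module given by the Gelfand–Tsetlin formulas the diagonal scalars are the required
ones. -/
theorem diagScalar_eq_of_isGTModule (hC : C ⊆ relR n ∪ relR0 n) (h : IsGTModule C L)
    {R : Tableau n} (hR : R ∈ tableauxSet C L) {k : ℕ} (hk0 : 0 < k) (hk : k < n) :
    diagScalar R k = diagValue R k := by
  obtain ⟨k, rfl⟩ : ∃ m, k = m + 1 := ⟨k - 1, by omega⟩
  obtain ⟨ρ, hρ⟩ := h
  set i : Fin n := ⟨k, by omega⟩ with hi
  set j : Fin n := ⟨k + 1, hk⟩ with hj
  have he : ρ (Matrix.single i j 1) = -op C L 1 (k + 1) := by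
    refine end_ext fun R hR => ?_
    rw [((hρ R hR).1 i j rfl).1, LinearMap.neg_apply, op_tab hR]
    simp only [raiseCoeff_eq, neg_smul, Finset.sum_neg_distrib, hi]
  have hf : ρ (Matrix.single j i 1) = op C L (-1) (k + 1) := by
    refine end_ext fun R hR => ?_
    rw [((hρ R hR).1 i j rfl).2, op_tab hR]
    simp only [lowerCoeff_eq, hi]
  have hij : j ≠ i := by simp [hi, hj]
  have hlie := ρ.map_lie (Matrix.single i j 1) (Matrix.single j i 1)
  rw [single_lie_single, if_pos rfl, if_pos rfl, he, hf, map_sub, Ring.lie_def] at hlie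
  have h0 : ρ (Matrix.single i i 1) - ρ (Matrix.single j j 1) =
      op C L (-1) (k + 1) * op C L 1 (k + 1) - op C L 1 (k + 1) * op C L (-1) (k + 1) :=
    hlie.trans (neg_mul_sub_mul_neg (A := Module.End ℂ (TableauxSpace C L)) (op C L 1 (k + 1))
      (op C L (-1) (k + 1)))
  have h1 := LinearMap.congr_fun h0 (tab C L R)
  have h2 := (op_diag hC hk hR).symm.trans h1.symm
  rw [LinearMap.sub_apply, (hρ R hR).2 i, (hρ R hR).2 j, ← sub_smul] at h2
  rw [diagValue_eq, smul_left_injective ℂ (tab_ne_zero hR) h2, weight, weight]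

end Module

variable {n : ℕ}

/-! ### Indecomposable components as classes of linked positions -/

section Components

theorem mem_vertices_iff {C : Set (Relation n)} {a : Vertex n} :
    a ∈ vertices C ↔ ∃ r ∈ C, r.hi = a ∨ r.lo = a := by
  constructor
  · rintro ⟨b, h | h | h | h⟩
    exacts [⟨_, h, Or.inl rfl⟩, ⟨_, h, Or.inr rfl⟩, ⟨_, h, Or.inl rfl⟩, ⟨_, h, Or.inr rfl⟩]
  · rintro ⟨r, hr, h⟩
    cases r with
    | ge x y =>
      rcases h with rfl | rfl
      exacts [⟨y, Or.inl hr⟩, ⟨x, Or.inr (Or.inl hr)⟩]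
    | gt x y =>
      rcases h with rfl | rfl
      exacts [⟨y, Or.inr (Or.inr (Or.inl hr))⟩, ⟨x, Or.inr (Or.inr (Or.inr hr))⟩]

theorem hi_mem_vertices {C : Set (Relation n)} {r : Relation n} (hr : r ∈ C) : r.hi ∈ vertices C :=
  mem_vertices_iff.mpr ⟨r, hr, Or.inl rfl⟩

theorem lo_mem_vertices {C : Set (Relation n)} {r : Relation n} (hr : r ∈ C) : r.lo ∈ vertices C :=
  mem_vertices_iff.mpr ⟨r, hr, Or.inr rfl⟩

/-- A property of positions that is invariant under the relations of an indecomposable set holds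
for all its positions if it holds for one. -/
theorem Indecomposable.induction {D : Set (Relation n)} (hD : Indecomposable D)
    (P : Vertex n → Prop) (hP : ∀ r ∈ D, P r.hi ↔ P r.lo) {x y : Vertex n} (hx : x ∈ vertices D)
    (hy : y ∈ vertices D) (h : P x) : P y := by
  by_contra hPy
  obtain ⟨r, hr, hrx⟩ := mem_vertices_iff.mp hx
  obtain ⟨q, hq, hqy⟩ := mem_vertices_iff.mp hy
  refine hD ⟨{r ∈ D | P r.hi}, {r ∈ D | ¬ P r.hi}, ⟨r, hr, ?_⟩, ⟨q, hq, ?_⟩, ?_, ?_⟩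
  · rcases hrx with rfl | rfl
    exacts [h, (hP r hr).mpr h]
  · rcases hqy with rfl | rfl
    exacts [hPy, fun h => hPy ((hP q hq).mp h)]
  · rw [Disconnected, Set.disjoint_left]
    intro v hv hv'
    obtain ⟨r, ⟨hr, hPr⟩, hrv⟩ := mem_vertices_iff.mp hv
    obtain ⟨q, ⟨hq, hPq⟩, hqv⟩ := mem_vertices_iff.mp hv'
    have h1 : P v := by
      rcases hrv with rfl | rfl
      exacts [hPr, (hP r hr).mp hPr]
    rcases hqv with rfl | rfl
    exacts [hPq h1, hPq ((hP q hq).mpr h1)]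
  · ext r
    simp only [Set.mem_union, Set.mem_ofPred_eq]
    tauto

theorem IsComponent.mem_of_vertex {C D : Set (Relation n)} (hD : IsComponent C D) {r : Relation n}
    (hr : r ∈ C) (h : r.hi ∈ vertices D ∨ r.lo ∈ vertices D) : r ∈ D := by
  by_contra hrD
  have hd := Set.disjoint_left.mp hD.2.2.2
  rcases h with h | h
  exacts [hd h (hi_mem_vertices ⟨hr, hrD⟩), hd h (lo_mem_vertices ⟨hr, hrD⟩)]

theorem IsComponent.subset_of_mem {C D E : Set (Relation n)} (hD : IsComponent C D)
    (hE : IsComponent C E) {v : Vertex n} (hv : v ∈ vertices D) (hv' : v ∈ vertices E) : E ⊆ D := by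
  intro r hr
  refine hD.mem_of_vertex (hE.1 hr) (Or.inl ?_)
  refine hE.2.2.1.induction (fun v => v ∈ vertices D) ?_ hv' (hi_mem_vertices hr) hv
  intro q hq
  exact ⟨fun h => lo_mem_vertices (hD.mem_of_vertex (hE.1 hq) (Or.inl h)),
    fun h => hi_mem_vertices (hD.mem_of_vertex (hE.1 hq) (Or.inr h))⟩

theorem IsComponent.eq_of_mem {C D E : Set (Relation n)} (hD : IsComponent C D)
    (hE : IsComponent C E) {v : Vertex n} (hv : v ∈ vertices D) (hv' : v ∈ vertices E) : D = E :=
  (hE.subset_of_mem hD hv' hv).antisymm (hD.subset_of_mem hE hv hv')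

/-- Two positions are joined by relations of `C`. -/
def Linked (C : Set (Relation n)) : Vertex n → Vertex n → Prop :=
  Relation.EqvGen fun x y => ∃ r ∈ C, r.hi = x ∧ r.lo = y

theorem Linked.iff_of_closed {C : Set (Relation n)} {P : Vertex n → Prop}
    (hP : ∀ r ∈ C, P r.hi ↔ P r.lo) {x y : Vertex n} (h : Linked C x y) : P x ↔ P y := by
  induction h with
  | rel x y h => obtain ⟨r, hr, rfl, rfl⟩ := h; exact hP r hr
  | refl x => rfl
  | symm x y _ ih => exact ih.symm
  | trans x y z _ _ ih1 ih2 => exact ih1.trans ih2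

theorem linked_hi_lo {C : Set (Relation n)} {r : Relation n} (hr : r ∈ C) : Linked C r.hi r.lo :=
  Relation.EqvGen.rel _ _ ⟨r, hr, rfl, rfl⟩

/-- In a splitting of the class of `r`, the positions of one part would be closed under all
relations of `C`, hence contain everything linked to them, including the positions of the other
part. -/
theorem isComponent_linked {C : Set (Relation n)} {r : Relation n} (hr : r ∈ C) :
    IsComponent C {q ∈ C | Linked C r.hi q.hi} := by
  have hvert : ∀ v, v ∈ vertices {q ∈ C | Linked C r.hi q.hi} → Linked C r.hi v := by
    intro v hv
    obtain ⟨q, ⟨hq, hl⟩, rfl | rfl⟩ := mem_vertices_iff.mp hv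
    exacts [hl, hl.trans _ _ _ (linked_hi_lo hq)]
  have hmem : ∀ q ∈ C, (Linked C r.hi q.hi ∨ Linked C r.hi q.lo) →
      q ∈ {q ∈ C | Linked C r.hi q.hi} := by
    rintro q hq (h | h)
    exacts [⟨hq, h⟩, ⟨hq, h.trans _ _ _ (linked_hi_lo hq).symm⟩]
  refine ⟨fun q hq => hq.1, ⟨r, hr, Relation.EqvGen.refl _⟩, ?_, ?_⟩
  · rintro ⟨C₁, C₂, ⟨r₁, h1⟩, ⟨r₂, h2⟩, hd, hU⟩
    have hd := Set.disjoint_left.mp hd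
    have hs1 : C₁ ⊆ {q ∈ C | Linked C r.hi q.hi} := hU ▸ Set.subset_union_left
    have hs2 : C₂ ⊆ {q ∈ C | Linked C r.hi q.hi} := hU ▸ Set.subset_union_right
    have hcl : ∀ q ∈ C, q.hi ∈ vertices C₁ ↔ q.lo ∈ vertices C₁ := by
      intro q hq
      have key : (q.hi ∈ vertices C₁ ∨ q.lo ∈ vertices C₁) → q ∈ C₁ := by
        intro h
        have hq' : q ∈ C₁ ∪ C₂ := by
          rw [hU]
          refine hmem q hq ?_
          have hsub : ∀ v ∈ vertices C₁, Linked C r.hi v := by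
            intro v hv
            obtain ⟨p, hp, hpv⟩ := mem_vertices_iff.mp hv
            exact hvert v (mem_vertices_iff.mpr ⟨p, hs1 hp, hpv⟩)
          exact h.imp (hsub _) (hsub _)
        rcases hq' with hq' | hq'
        · exact hq'
        · rcases h with h | h
          exacts [(hd h (hi_mem_vertices hq')).elim, (hd h (lo_mem_vertices hq')).elim]
      exact ⟨fun h => lo_mem_vertices (key (Or.inl h)), fun h => hi_mem_vertices (key (Or.inr h))⟩
    have hl : Linked C r₁.hi r₂.hi := (hs1 h1).2.symm.trans _ _ _ (hs2 h2).2
    exact hd ((hl.iff_of_closed hcl).mp (hi_mem_vertices h1)) (hi_mem_vertices h2)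
  · rw [Disconnected, Set.disjoint_left]
    intro v hv hv'
    obtain ⟨q, ⟨hq, hq'⟩, hqv⟩ := mem_vertices_iff.mp hv'
    refine hq' (hmem q hq ?_)
    rcases hqv with rfl | rfl
    exacts [Or.inl (hvert _ hv), Or.inr (hvert _ hv)]

theorem exists_component {C : Set (Relation n)} {r : Relation n} (hr : r ∈ C) :
    ∃ D, IsComponent C D ∧ r ∈ D :=
  ⟨_, isComponent_linked hr, hr, Relation.EqvGen.refl _⟩

/-- Distinctness matters: a position that occurs in no relation is linked to itself but lies in no
component. -/
theorem exists_component_iff_linked {C : Set (Relation n)} {x y : Vertex n} (hxy : x ≠ y) :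
    (∃ D, IsComponent C D ∧ x ∈ vertices D ∧ y ∈ vertices D) ↔ Linked C x y := by
  constructor
  · rintro ⟨D, hD, hx, hy⟩
    refine hD.2.2.1.induction (fun v => Linked C x v) ?_ hx hy (Relation.EqvGen.refl _)
    intro r hr
    exact ⟨fun h => h.trans _ _ _ (linked_hi_lo (hD.1 hr)),
      fun h => h.trans _ _ _ (linked_hi_lo (hD.1 hr)).symm⟩
  · intro h
    have hx : x ∈ vertices C := by
      by_contra hx
      refine hxy ((h.iff_of_closed (P := fun v => x = v) ?_).mp rfl)
      intro r hr
      constructor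
      · rintro rfl; exact (hx (hi_mem_vertices hr)).elim
      · rintro rfl; exact (hx (lo_mem_vertices hr)).elim
    obtain ⟨r, hr, hrx⟩ := mem_vertices_iff.mp hx
    obtain ⟨D, hD, hrD⟩ := exists_component hr
    have hxD : x ∈ vertices D := mem_vertices_iff.mpr ⟨r, hrD, hrx⟩
    refine ⟨D, hD, hxD, (h.iff_of_closed (P := fun v => v ∈ vertices D) ?_).mp hxD⟩
    intro q hq
    exact ⟨fun h => lo_mem_vertices (hD.mem_of_vertex hq (Or.inl h)),
      fun h => hi_mem_vertices (hD.mem_of_vertex hq (Or.inr h))⟩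

end Components

/-! ### Implied inequalities as descending chains of relations -/

section Reachability

/-- There is a chain of relations of `D` from `a` down to `b`. -/
def Reach (D : Set (Relation n)) : Vertex n → Vertex n → Prop :=
  Relation.ReflTransGen fun x y => ∃ r ∈ D, r.hi = x ∧ r.lo = y

variable {D : Set (Relation n)}

theorem Reach.step {r : Relation n} (hr : r ∈ D) : Reach D r.hi r.lo :=
  Relation.ReflTransGen.single ⟨r, hr, rfl, rfl⟩

theorem Reach.exists_nat {a b : Vertex n} (h : Reach D a b) {L : Tableau n} (hL : Satisfies D L) :
    ∃ m : ℕ, L a - L b = m := by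
  induction h with
  | refl => exact ⟨0, by simp⟩
  | tail _ h ih =>
    obtain ⟨r, hr, rfl, rfl⟩ := h
    obtain ⟨m, hm⟩ := ih
    obtain ⟨p, hp⟩ := holds_iff.mp (hL r hr)
    exact ⟨m + (r.wt + p), by push_cast at hp ⊢; linear_combination hm + hp⟩

open Classical in
/-- The entries at the positions below `a` can be decreased. -/
theorem satisfies_lower {L : Tableau n} (hL : Satisfies D L) (a : Vertex n) (m : ℕ) :
    Satisfies D fun v => if Reach D a v then L v - m else L v := by
  intro r hr
  obtain ⟨p, hp⟩ := holds_iff.mp (hL r hr)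
  rw [holds_iff]
  by_cases h1 : Reach D a r.hi
  · have h2 : Reach D a r.lo := h1.trans (Reach.step hr)
    exact ⟨p, by simp only [h1, h2, if_true]; rw [← hp]; ring⟩
  · by_cases h2 : Reach D a r.lo
    · exact ⟨p + m, by simp only [h1, h2, if_true, if_false]; push_cast at hp ⊢; linear_combination hp⟩
    · exact ⟨p, by simp only [h1, h2, if_false]; rw [← hp]⟩

/-- Lowering all entries below `a` by more than $l_a-l_b$ keeps `D` satisfied, but destroys $a\ge b$
unless `b` is lowered too. A satisfying tableau is needed, since an inconsistent set implies
everything. -/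
theorem Implies.reach (hD : ∃ L : Tableau n, Satisfies D L) {a b : Vertex n}
    (h : Implies D (.ge a b)) : Reach D a b := by
  classical
  by_contra hab
  obtain ⟨L, hL⟩ := hD
  obtain ⟨m, hm⟩ := h L hL
  obtain ⟨p, hp⟩ := h _ (satisfies_lower hL a (m + 1))
  simp only [if_pos (show Reach D a a from Relation.ReflTransGen.refl), if_neg hab] at hp
  have : ((p + 1 : ℕ) : ℂ) = 0 := by push_cast at hp ⊢; linear_combination hm - hp
  exact absurd this (Nat.cast_ne_zero.mpr (by omega))

theorem Implies.ge_of_gt {a b : Vertex n} (h : Implies D (.gt a b)) : Implies D (.ge a b) := by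
  intro L hL
  obtain ⟨m, -, hm⟩ := h L hL
  exact ⟨m, hm⟩

theorem Reach.implies {a b : Vertex n} (h : Reach D a b) : Implies D (.ge a b) :=
  fun _ hL => h.exists_nat hL

variable {C : Set (Relation n)}

theorem IsComponent.exists_satisfies (hD : IsComponent C D) (hcrit : IsNoncritical C) :
    ∃ L : Tableau n, Satisfies D L := by
  obtain ⟨⟨L, hL⟩, -⟩ := hcrit
  exact ⟨L, fun r hr => hL r (hD.1 hr)⟩

theorem IsComponent.exists_int (hD : IsComponent C D) {L : Tableau n} (hL : Satisfies D L)
    {a b : Vertex n} (ha : a ∈ vertices D) (hb : b ∈ vertices D) : ∃ m : ℤ, L a - L b = m := by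
  refine hD.2.2.1.induction (fun v => ∃ m : ℤ, L a - L v = m) ?_ ha hb ⟨0, by simp⟩
  intro r hr
  obtain ⟨p, hp⟩ := holds_iff.mp (hL r hr)
  constructor
  · rintro ⟨m, hm⟩
    exact ⟨m + (r.wt + p), by push_cast at hp ⊢; linear_combination hm + hp⟩
  · rintro ⟨m, hm⟩
    exact ⟨m - (r.wt + p), by push_cast at hp ⊢; linear_combination hm - hp⟩

/-- The positions of a component in a row are ordered by its relations. -/
theorem IsComponent.reach_total (hD : IsComponent C D) (hcrit : IsNoncritical C) {a b : Vertex n}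
    (ha : a ∈ vertices D) (hb : b ∈ vertices D) (hab : row a = row b) :
    Reach D a b ∨ Reach D b a := by
  classical
  obtain ⟨L, hL⟩ := hD.exists_satisfies hcrit
  by_cases hne : a = b
  · subst hne; exact Or.inl Relation.ReflTransGen.refl
  rcases (row_le a).eq_or_lt with hn | hn
  · rcases (hcrit.2 D hD).2 a ha b hb hn (hab ▸ hn) with h | h
    exacts [Or.inl (h.reach ⟨L, hL⟩), Or.inr (h.reach ⟨L, hL⟩)]
  -- Lowering the entries below `a` by exactly $l_a-l_b$ would make the two entries equal if `b`
  -- were not among them, contrary to noncriticality.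
  have key : ∀ a b : Vertex n, a ∈ vertices D → b ∈ vertices D → row a = row b → row a < n →
      a ≠ b → ∀ m : ℕ, L a - L b = m → Reach D a b := by
    intro a b ha hb hab hn hne m hm
    by_contra hr
    refine (hcrit.2 D hD).1 _ (satisfies_lower hL a m) a ha b hb hab hn hne ?_
    rw [if_pos (show Reach D a a from Relation.ReflTransGen.refl), if_neg hr]
    linear_combination hm
  obtain ⟨m, hm⟩ := hD.exists_int hL ha hb
  rcases Int.eq_nat_or_neg m with ⟨p, rfl | rfl⟩
  · exact Or.inl (key a b ha hb hab hn hne p (by rw [hm]; simp))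
  · exact Or.inr (key b a hb ha hab.symm (hab ▸ hn) (Ne.symm hne) p (by
      push_cast at hm; linear_combination -hm))

theorem IsComponent.implies_gt (hD : IsComponent C D) (hcrit : IsNoncritical C) {a b : Vertex n}
    (ha : a ∈ vertices D) (hb : b ∈ vertices D) (hab : row a = row b) (hn : row a < n)
    (hne : a ≠ b) (h : Reach D a b) : Implies D (.gt a b) := by
  intro L hL
  obtain ⟨m, hm⟩ := h.exists_nat hL
  refine ⟨m, Nat.pos_of_ne_zero ?_, hm⟩
  rintro rfl
  exact (hcrit.2 D hD).1 L hL a ha b hb hab hn hne (by simpa [sub_eq_zero] using hm)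

theorem IsComponent.col_lt (hD : IsComponent C D) (hcrit : IsNoncritical C)
    (hnum : IsNumberedInOrder C) {a b : Vertex n} (ha : a ∈ vertices D) (hb : b ∈ vertices D)
    (hab : row a = row b) (hne : a ≠ b) (h : Reach D a b) : col a < col b := by
  obtain ⟨h1, h2⟩ := hnum D hD a ha b hb hab
  rcases (row_le a).eq_or_lt with hn | hn
  · exact h2 hn hne h.implies
  · exact h1 hn (hD.implies_gt hcrit ha hb hab hn hne h)

theorem IsComponent.reach_of_col_lt (hD : IsComponent C D) (hcrit : IsNoncritical C)
    (hnum : IsNumberedInOrder C) {a b : Vertex n} (ha : a ∈ vertices D) (hb : b ∈ vertices D)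
    (hab : row a = row b) (h : col a < col b) : Reach D a b := by
  rcases hD.reach_total hcrit ha hb hab with h1 | h1
  · exact h1
  · have := hD.col_lt hcrit hnum hb ha hab.symm (by rintro rfl; omega) h1
    omega

end Reachability

/-! ### Unions of sets from $\mathfrak F$ are admissible -/

section Sufficiency

variable {C : Set (Relation n)} {L : Tableau n}

/-- The nonemptiness assumption excludes the empty set, which belongs to $\mathfrak F$ vacuously but
is not a component. -/
theorem isComponent_of_mem_union {𝒟 : Set (Set (Relation n))} (hF : 𝒟 ⊆ familyF n)
    (hd : 𝒟.Pairwise Disconnected) (hU : ⋃₀ 𝒟 = C) {D : Set (Relation n)} (hD : D ∈ 𝒟)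
    (hne : D.Nonempty) : IsComponent C D := by
  refine ⟨hU ▸ Set.subset_sUnion_of_mem hD, hne, (hF hD).2.1, ?_⟩
  rw [Disconnected, Set.disjoint_left]
  intro v hv hv'
  obtain ⟨r, ⟨hr, hrD⟩, hrv⟩ := mem_vertices_iff.mp hv'
  rw [← hU] at hr
  obtain ⟨E, hE, hrE⟩ := hr
  have hDE : D ≠ E := by rintro rfl; exact hrD hrE
  exact Set.disjoint_left.mp (hd hD hE hDE) hv (mem_vertices_iff.mpr ⟨r, hrE, hrv⟩)

/-- The components of a disconnected union of sets from `𝔉` belong to `𝔉`. -/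
theorem mem_familyF_of_isComponent (h : IsDisconnectedUnionOfF C) {D : Set (Relation n)}
    (hD : IsComponent C D) : D ∈ familyF n := by
  obtain ⟨𝒟, hF, hd, hU⟩ := h
  obtain ⟨r, hr⟩ := hD.2.1
  have hrC := hD.1 hr
  rw [← hU] at hrC
  obtain ⟨E, hE, hrE⟩ := hrC
  have hEC := isComponent_of_mem_union hF hd hU hE ⟨r, hrE⟩
  rw [hD.eq_of_mem hEC (hi_mem_vertices hr) (hi_mem_vertices hrE)]
  exact hF hE

theorem bound_neg_one_gt {a b : Vertex n} (h : .gt a b ∈ C) : Bound C (-1) a b 1 :=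
  Or.inr ⟨rfl, _, h, rfl, rfl, rfl⟩

theorem bound_neg_one_ge {a b : Vertex n} (h : .ge a b ∈ C) : Bound C (-1) a b 0 :=
  Or.inr ⟨rfl, _, h, rfl, rfl, rfl⟩

theorem bound_one_gt {a b : Vertex n} (h : .gt a b ∈ C) : Bound C 1 b a 1 :=
  Or.inl ⟨rfl, _, h, rfl, rfl, rfl⟩

theorem bound_one_ge {a b : Vertex n} (h : .ge a b ∈ C) : Bound C 1 b a 0 :=
  Or.inl ⟨rfl, _, h, rfl, rfl, rfl⟩

theorem Bound.exists_mem {σ : ℤ} {a y : Vertex n} {w : ℕ} (h : Bound C σ a y w) :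
    ∃ r ∈ C, (r.hi = a ∧ r.lo = y) ∨ (r.hi = y ∧ r.lo = a) := by
  rcases h with ⟨-, r, hr, h1, h2, -⟩ | ⟨-, r, hr, h1, h2, -⟩
  exacts [⟨r, hr, Or.inr ⟨h1, h2⟩⟩, ⟨r, hr, Or.inl ⟨h1, h2⟩⟩]

theorem Bound.linked {σ : ℤ} {a y : Vertex n} {w : ℕ} (h : Bound C σ a y w) : Linked C a y := by
  obtain ⟨r, hr, ⟨rfl, rfl⟩ | ⟨rfl, rfl⟩⟩ := h.exists_mem
  exacts [linked_hi_lo hr, (linked_hi_lo hr).symm]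

/-- The relations at two positions of a row whose entries differ by one. -/
theorem bounds_of_eq_add_one (hC : C ⊆ relR n ∪ relR0 n) (hcrit : IsNoncritical C)
    (hnum : IsNumberedInOrder C) (hF : IsDisconnectedUnionOfF C)
    (hnc : ∀ R ∈ tableauxSet C L, NoncriticalTableau R) {R : Tableau n} (hR : R ∈ tableauxSet C L)
    {a b : Vertex n} (hab : row a = row b) (hn : row a < n) (h : R a = R b + 1) :
    (∃ s t, Bound C (-1) a s 1 ∧ Bound C 1 b s 0 ∧ Bound C (-1) a t 0 ∧ Bound C 1 b t 1 ∧
      R s = R b ∧ R t = R a) ∨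
    (∃ s s', s ≠ s' ∧ row a + 1 = n ∧ Bound C (-1) a s 1 ∧ Bound C 1 b s' 0 ∧
      R s = R b ∧ R s' = R b) ∨
    (¬ Linked C a b ∧
      ((∃ s t, Bound C (-1) a s 1 ∧ Bound C 1 b t 1 ∧ R s = R b ∧ R t = R a) ∨
        ∃ t s, Bound C (-1) a t 0 ∧ Bound C 1 b s 0 ∧ R s = R b ∧ R t = R a)) := by
  have hne : a ≠ b := by
    rintro rfl
    have : (1 : ℂ) = 0 := by linear_combination -h
    norm_num at this
  by_cases hl : Linked C a b
  · obtain ⟨D, hD, ha, hb⟩ := (exists_component_iff_linked hne).mpr hl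
    have hRD : Satisfies D R := fun r hr => hR.1 r (hD.1 hr)
    have hreach : Reach D a b := by
      rcases hD.reach_total hcrit ha hb hab with h1 | h1
      · exact h1
      · obtain ⟨m, hm⟩ := h1.exists_nat hRD
        have : ((m + 1 : ℕ) : ℂ) = 0 := by push_cast; linear_combination -hm - h
        exact absurd this (Nat.cast_ne_zero.mpr (by omega))
    -- Two strict inequalities need a difference of at least two.
    have hadj : IsAdjoining D a b := by
      refine ⟨ha, hb, hab, hn, hD.implies_gt hcrit ha hb hab hn hne hreach, ?_⟩
      rintro ⟨c, -, -, h1, h2⟩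
      obtain ⟨p, hp, hpe⟩ := h1 R hRD
      obtain ⟨q, hq, hqe⟩ := h2 R hRD
      have : ((p + q : ℕ) : ℂ) = (1 : ℕ) := by push_cast; linear_combination -hpe - hqe + h
      have := Nat.cast_injective this
      omega
    rcases (mem_familyF_of_isComponent hF hD).2.2 a b hadj with
      ⟨s, t, hs, ht, hsub⟩ | ⟨s, t, hs, ht, hst, hsub⟩
    · left
      have m1 := hD.1 (hsub (show Relation.gt a s ∈ _ by simp))
      have m2 := hD.1 (hsub (show Relation.ge s b ∈ _ by simp))
      have m3 := hD.1 (hsub (show Relation.ge a t ∈ _ by simp))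
      have m4 := hD.1 (hsub (show Relation.gt t b ∈ _ by simp))
      refine ⟨s, t, bound_neg_one_gt m1, bound_one_ge m2, bound_neg_one_ge m3, bound_one_gt m4,
        ?_, ?_⟩
      · obtain ⟨p, hp, hpe⟩ := hR.1 _ m1
        obtain ⟨q, hqe⟩ := hR.1 _ m2
        have : ((p + q : ℕ) : ℂ) = (1 : ℕ) := by push_cast; linear_combination -hpe - hqe + h
        have := Nat.cast_injective this
        obtain rfl : q = 0 := by omega
        push_cast at hqe; linear_combination hqe
      · obtain ⟨p, hpe⟩ := hR.1 _ m3
        obtain ⟨q, hq, hqe⟩ := hR.1 _ m4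
        have : ((p + q : ℕ) : ℂ) = (1 : ℕ) := by push_cast; linear_combination -hpe - hqe + h
        have := Nat.cast_injective this
        obtain rfl : p = 0 := by omega
        push_cast at hpe; linear_combination -hpe
    -- The strict relation $a>s$ uses up the whole difference $l_a-l_b=1$, so $s$, $t$ and $b$ carry
    -- equal entries. Noncriticality allows $l_s=l_t$ only in the top row.
    · right; left
      have d1 := hsub (show Relation.gt a s ∈ _ by simp)
      have d2 := hsub (show Relation.ge t b ∈ _ by simp)
      have hsV : s ∈ vertices D := lo_mem_vertices d1
      have htV : t ∈ vertices D := hi_mem_vertices d2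
      have hne' : s ≠ t := by rintro rfl; omega
      have hr := hD.reach_of_col_lt hcrit hnum hsV htV (by omega) hst
      obtain ⟨p, hp, hpe⟩ := hR.1 _ (hD.1 d1)
      obtain ⟨q, hqe⟩ := hR.1 _ (hD.1 d2)
      obtain ⟨m, hm⟩ := hr.exists_nat hRD
      have : ((p + q + m : ℕ) : ℂ) = (1 : ℕ) := by
        push_cast; linear_combination -hpe - hqe + h - hm
      have := Nat.cast_injective this
      obtain rfl : q = 0 := by omega
      obtain rfl : m = 0 := by omega
      have e1 : R t = R b := by push_cast at hqe; linear_combination hqe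
      have e2 : R s = R t := by push_cast at hm; linear_combination hm
      refine ⟨s, t, hne', ?_, bound_neg_one_gt (hD.1 d1), bound_one_ge (hD.1 d2), e2.trans e1, e1⟩
      by_contra hcon
      have := row_le s
      exact hnc R hR s t (by omega) (by omega) hne' e2
  -- Unlinked positions do not bound each other, yet either move would make two entries of a row
  -- equal. So each of them is held by a tight bound of its own.
  · have hmem1 : shift R a (-1) ∉ tableauxSet C L := by
      intro hm
      refine hnc _ hm a b hab hn hne ?_
      rw [shift_self, shift_ne _ _ hne.symm, h]; push_cast; ring
    have hmem2 : shift R b 1 ∉ tableauxSet C L := by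
      intro hm
      refine hnc _ hm a b hab hn hne ?_
      rw [shift_self, shift_ne _ _ hne, h]; push_cast; ring
    obtain ⟨y, w, hB, -, hy⟩ := exists_tight hC hR hn (Or.inr rfl) hmem1
    obtain ⟨y', w', hB', -, hy'⟩ := exists_tight hC hR (hab ▸ hn) (Or.inl rfl) hmem2
    have hyy' : y ≠ y' := by
      rintro rfl
      exact hl (hB.linked.trans _ _ _ hB'.linked.symm)
    -- Of the four combinations of weights, the one with both holders in the row below contradicts
    -- noncriticality; the one with both in the row above forces the top row; the other two place
    -- one holder on either side.
    rcases hB.row hC hn with ⟨rfl, hr⟩ | ⟨rfl, hr⟩ <;>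
      rcases hB'.row hC (hab ▸ hn) with ⟨rfl, hr'⟩ | ⟨rfl, hr'⟩ <;>
      push_cast at hy hy'
    · exact Or.inr (Or.inr ⟨hl, Or.inr ⟨y, y', hB, hB', by rw [hy']; ring, by rw [hy]; ring⟩⟩)
    · refine absurd ?_ (hnc R hR y y' (by omega) (by omega) hyy')
      rw [hy, hy', h]; ring
    · refine Or.inr (Or.inl ⟨y, y', hyy', ?_, hB, hB', by rw [hy, h]; ring, by rw [hy']; ring⟩)
      by_contra hcon
      refine hnc R hR y y' (by omega) ?_ hyy' (by rw [hy, hy', h]; ring)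
      omega
    · exact Or.inr (Or.inr ⟨hl, Or.inl ⟨y, y', hB, hB', by rw [hy, h]; ring,
        by rw [hy', h]; ring⟩⟩)

/-- If $l_a=l_{a'}+1$ before and after the path, then at its end `a` cannot move back without
meeting `a'`, so a tight bound holds it. Since that bound was not broken at the start, its other end
moved, so it is `b`. Likewise every tight bound that holds `a'` from above at the start comes from
`b`. But `bounds_of_eq_add_one` gives holders of `a'` in two different rows, or a holder in the top
row, which does not move, or `a` and `a'` are not linked. -/
theorem not_step_of_eq_add_one_aux (hC : C ⊆ relR n ∪ relR0 n) (hcrit : IsNoncritical C)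
    (hnum : IsNumberedInOrder C) (hF : IsDisconnectedUnionOfF C)
    (hnc : ∀ R ∈ tableauxSet C L, NoncriticalTableau R) {R : Tableau n} (hR : R ∈ tableauxSet C L)
    {a a' b : Vertex n} (haa' : row a = row a') (hn : row a < n) (hb : row b < n)
    (hab : row b ≠ row a) (hne : a ≠ a')
    (hQ : shift (shift (shift R a 1) a' 1) b 1 ∈ tableauxSet C L) : R a ≠ R a' + 1 := by
  intro h
  set Q := shift (shift (shift R a 1) a' 1) b 1 with hQdef
  have hba : b ≠ a := by rintro rfl; omega
  have hba' : b ≠ a' := by rintro rfl; omega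
  have qa : Q a = R a + 1 := by
    rw [hQdef, shift_ne _ _ hba.symm, shift_ne _ _ hne, shift_self]; push_cast; ring
  have qa' : Q a' = R a' + 1 := by
    rw [hQdef, shift_ne _ _ hba'.symm, shift_self, shift_ne _ _ hne.symm]; push_cast; ring
  have qy : ∀ y, y ≠ a → y ≠ a' → y ≠ b → Q y = R y := by
    intro y h1 h2 h3
    rw [hQdef, shift_ne _ _ h3, shift_ne _ _ h2, shift_ne _ _ h1]
  have f1 : ∀ y w, Bound C 1 a' y w → R y = R a' + w → y = b := by
    intro y w hB hy
    by_contra hyb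
    have := hB.row hC (haa' ▸ hn)
    obtain ⟨m, hm⟩ := hB.exists_nat hQ.1
    rw [qy y (by rintro rfl; omega) (by rintro rfl; omega) hyb, qa', hy] at hm
    have : ((m + 1 : ℕ) : ℂ) = 0 := by push_cast at hm ⊢; linear_combination -hm
    exact absurd this (Nat.cast_ne_zero.mpr (by omega))
  have hmem : shift Q a (-1) ∉ tableauxSet C L := by
    intro hm
    refine hnc _ hm a a' haa' hn hne ?_
    rw [shift_self, shift_ne _ _ hne.symm, qa, qa', h]; push_cast; ring
  obtain ⟨y, w, hB, -, hy⟩ := exists_tight hC hQ hn (Or.inr rfl) hmem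
  have hyb : y = b := by
    by_contra hyb
    have := hB.row hC hn
    obtain ⟨m, hm⟩ := hB.exists_nat hR.1
    rw [← qy y (by rintro rfl; omega) (by rintro rfl; omega) hyb, hy, qa] at hm
    have : ((m + 1 : ℕ) : ℂ) = 0 := by push_cast at hm ⊢; linear_combination -hm
    exact absurd this (Nat.cast_ne_zero.mpr (by omega))
  subst hyb
  rcases bounds_of_eq_add_one hC hcrit hnum hF hnc hR haa' hn h with
    ⟨s, t, -, h2, -, h4, hs, ht⟩ | ⟨s, s', -, hn', -, h2, -, hs'⟩ | ⟨hl, h'⟩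
  · have e1 := f1 s 0 h2 (by rw [hs]; simp)
    have e2 := f1 t 1 h4 (by rw [ht, h]; simp)
    have r1 := h2.row hC (haa' ▸ hn)
    have r2 := h4.row hC (haa' ▸ hn)
    rw [e1] at r1; rw [e2] at r2
    omega
  · have e1 := f1 s' 0 h2 (by rw [hs']; simp)
    have r1 := h2.row hC (haa' ▸ hn)
    rw [e1] at r1
    omega
  · rcases h' with ⟨s, t, -, h2, -, ht⟩ | ⟨t, s, -, h2, hs, -⟩
    · have e1 := f1 t 1 h2 (by rw [ht, h]; simp)
      rw [e1] at h2
      exact hl (hB.linked.trans _ _ _ h2.linked.symm)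
    · have e1 := f1 s 0 h2 (by rw [hs]; simp)
      rw [e1] at h2
      exact hl (hB.linked.trans _ _ _ h2.linked.symm)

theorem card_row_pred {k : ℕ} (hk0 : 0 < k) (hk : k < n) :
    (Finset.univ.filter fun t : Vertex n => row t + 1 = k).card = k - 1 := by
  rw [← card_row (n := n) (m := k - 1) (by omega)]
  congr 1
  ext t
  simp only [Finset.mem_filter, Finset.mem_univ, true_and]
  omega

/-- Disconnected unions of sets from `𝔉` are admissible. -/
theorem isAdmissible_of_union (hC : C ⊆ relR n ∪ relR0 n) (hcrit : IsNoncritical C)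
    (hnum : IsNumberedInOrder C) (hF : IsDisconnectedUnionOfF C) : IsAdmissible C := by
  intro L hL
  have hnc := hL.2
  refine isGTModule_of_diagScalar hC hnc ?_ ?_
  · intro R hR k hk0 hk
    have hc1 := card_row (n := n) (m := k) hk.le
    have hc2 := card_row (n := n) (m := k + 1) hk
    have hc3 := card_row_pred hk0 hk
    rw [diagScalar, diagonal_sum, diagValue, hc1, hc2]
    · intro a ha b hb hab
      simp only [Finset.coe_filter, Finset.mem_univ, true_and, Set.mem_ofPred_eq] at ha hb
      by_contra hne
      exact hnc R hR a b (by omega) (by omega) hne hab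
    · rw [hc1, hc2, hc3]; omega
    · intro a ha b hb hab
      simp only [Finset.mem_filter, Finset.mem_univ, true_and] at ha hb ⊢
      rcases bounds_of_eq_add_one hC hcrit hnum hF hnc hR (by omega : row a = row b) (by omega) hab with
        ⟨s, t, h1, -, h3, -, hs, ht⟩ | ⟨s, s', hne, hn', h1, h2, hs, hs'⟩ | ⟨-, h'⟩
      · have := h1.row hC (by omega)
        have := h3.row hC (by omega)
        exact Or.inl ⟨⟨s, by omega, hs⟩, t, by omega, ht⟩
      · have := h1.row hC (by omega)
        have := h2.row hC (by omega)
        exact Or.inr ⟨s, by omega, s', by omega, hne, hs, hs'⟩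
      · rcases h' with ⟨s, t, h1, h2, hs, ht⟩ | ⟨t, s, h1, h2, hs, ht⟩
        · have := h1.row hC (by omega)
          have := h2.row hC (by omega)
          exact Or.inl ⟨⟨s, by omega, hs⟩, t, by omega, ht⟩
        · have := h1.row hC (by omega)
          have := h2.row hC (by omega)
          exact Or.inl ⟨⟨s, by omega, hs⟩, t, by omega, ht⟩
  · rintro σ (rfl | rfl) R hR a a' b hn haa' hb hrow hne hQ
    · exact not_step_of_eq_add_one_aux hC hcrit hnum hF hnc hR haa' hn hb (by omega) hne hQ
    · intro h
      -- A descending path is an ascending one read from its end, where the two entries have the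
      -- same difference because both have moved by $-1$.
      set Q := shift (shift (shift R a (-1)) a' (-1)) b (-1) with hQdef
      have hback : shift (shift (shift Q a 1) a' 1) b 1 = R := by
        rw [hQdef, shift_comm _ b a, shift_comm _ a' a, shift_neg_shift R a 1, shift_comm _ b a',
          shift_neg_shift _ a' 1, shift_neg_shift _ b 1]
      refine not_step_of_eq_add_one_aux hC hcrit hnum hF hnc hQ haa' hn hb (by omega) hne
        (by rwa [hback]) ?_
      have hba : b ≠ a := by rintro rfl; omega
      have hba' : b ≠ a' := by rintro rfl; omega
      rw [hQdef, shift_ne _ _ hba.symm, shift_ne _ _ hba'.symm, shift_ne _ _ hne, shift_self,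
        shift_self, shift_ne _ _ hne.symm, h]
      ring

end Sufficiency

variable {n : ℕ} {C D : Set (Relation n)}

/-! ### The order on a component and the interval of a violating pair -/

section Order

theorem row_hi_cases (hC : C ⊆ relR n ∪ relR0 n) {r : Relation n} (hr : r ∈ C) :
    (r.wt = 0 ∧ (row r.hi = row r.lo + 1 ∨ row r.hi = n ∧ row r.lo = n)) ∨
      (r.wt = 1 ∧ row r.lo = row r.hi + 1) := by
  rcases hC hr with ⟨a, b, hab, rfl | rfl⟩ | ⟨a, b, ha, hb, -, rfl⟩
  · exact Or.inl ⟨rfl, Or.inl hab⟩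
  · exact Or.inr ⟨rfl, hab⟩
  · exact Or.inl ⟨rfl, Or.inr ⟨ha, hb⟩⟩

theorem eq_gt_of_row {r : Relation n} (hC : C ⊆ relR n ∪ relR0 n) (hr : r ∈ C)
    (h : row r.lo = row r.hi + 1) : r = .gt r.hi r.lo := by
  have := row_hi_cases hC hr
  have := row_le r.lo
  cases r with
  | ge a b => simp only [Relation.hi, Relation.lo, Relation.wt] at *; omega
  | gt a b => rfl

theorem eq_ge_of_row {r : Relation n} (hC : C ⊆ relR n ∪ relR0 n) (hr : r ∈ C)
    (h : row r.hi = row r.lo + 1) : r = .ge r.hi r.lo := by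
  have := row_hi_cases hC hr
  cases r with
  | ge a b => rfl
  | gt a b => simp only [Relation.hi, Relation.lo, Relation.wt] at *; omega

/-- Only strict relations lead from a row to the row above, so a chain along which the entry does
not decrease never goes up. -/
theorem Reach.row_le_of_eq (hC : C ⊆ relR n ∪ relR0 n) {L : Tableau n} (hL : Satisfies C L)
    {u v : Vertex n} (h : Reach C u v) :
    ∃ m : ℕ, L u - L v = m ∧ (m = 0 → row v ≤ row u) := by
  induction h with
  | refl => exact ⟨0, by simp, fun _ => le_rfl⟩
  | tail _ h ih =>
    obtain ⟨r, hr, rfl, rfl⟩ := h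
    obtain ⟨m, hm, hrow⟩ := ih
    obtain ⟨p, hp⟩ := holds_iff.mp (hL r hr)
    refine ⟨m + (r.wt + p), by push_cast at hp ⊢; linear_combination hm + hp, fun h0 => ?_⟩
    have := hrow (by omega)
    have := row_hi_cases hC hr
    omega

/-- Chains in both directions force equal entries, hence equal rows; within a row the numbering in
order excludes a cycle. This covers mutual relations $\ge$ in the top row too. -/
theorem IsComponent.reach_antisymm (hC : C ⊆ relR n ∪ relR0 n) (hcrit : IsNoncritical C)
    (hnum : IsNumberedInOrder C) (hD : IsComponent C D) {u v : Vertex n} (hu : u ∈ vertices D)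
    (hv : v ∈ vertices D) (h1 : Reach D u v) (h2 : Reach D v u) : u = v := by
  obtain ⟨L, hL⟩ := hD.exists_satisfies hcrit
  obtain ⟨m, hm, hr1⟩ := h1.row_le_of_eq (hD.1.trans hC) hL
  obtain ⟨p, hp, hr2⟩ := h2.row_le_of_eq (hD.1.trans hC) hL
  have h0 : ((m + p : ℕ) : ℂ) = (0 : ℕ) := by push_cast; linear_combination -hm - hp
  have := Nat.cast_injective h0
  have e1 := hr1 (by omega)
  have e2 := hr2 (by omega)
  by_contra hne
  have := hD.col_lt hcrit hnum hu hv (by omega) hne h1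
  have := hD.col_lt hcrit hnum hv hu (by omega) (Ne.symm hne) h2
  omega

theorem IsComponent.reach_of_reach (hD : IsComponent C D) {u v : Vertex n} (hu : u ∈ vertices D)
    (h : Reach C u v) : v ∈ vertices D ∧ Reach D u v := by
  induction h with
  | refl => exact ⟨hu, Relation.ReflTransGen.refl⟩
  | tail _ h ih =>
    obtain ⟨r, hr, rfl, rfl⟩ := h
    have hrD := hD.mem_of_vertex hr (Or.inl ih.1)
    exact ⟨lo_mem_vertices hrD, ih.2.trans (Reach.step hrD)⟩

theorem Reach.mono (h : D ⊆ C) {u v : Vertex n} (huv : Reach D u v) : Reach C u v :=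
  Relation.ReflTransGen.mono (fun _ _ ⟨r, hr, h1, h2⟩ => ⟨r, h hr, h1, h2⟩) _ _ huv

theorem Reach.mem_vertices {u v : Vertex n} (h : Reach D u v) (hu : u ∈ vertices D) :
    v ∈ vertices D := by
  induction h with
  | refl => exact hu
  | tail _ h _ => obtain ⟨r, hr, rfl, rfl⟩ := h; exact lo_mem_vertices hr

theorem reach_antisymm (hC : C ⊆ relR n ∪ relR0 n) (hcrit : IsNoncritical C)
    (hnum : IsNumberedInOrder C) {u v : Vertex n} (h1 : Reach C u v) (h2 : Reach C v u) :
    u = v := by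
  rcases Relation.ReflTransGen.cases_head h1 with h | ⟨w, ⟨r, hr, rfl, rfl⟩, h3⟩
  · exact h
  · obtain ⟨D, hD, hrD⟩ := exists_component hr
    obtain ⟨hv, h4⟩ := hD.reach_of_reach (hi_mem_vertices hrD) h1
    exact hD.reach_antisymm hC hcrit hnum (hi_mem_vertices hrD) hv h4 (hD.reach_of_reach hv h2).2

/-- A chain of relations meets every row between the rows of its ends. -/
theorem Reach.exists_row (hC : C ⊆ relR n ∪ relR0 n) {x y : Vertex n} (h : Reach C x y) {k : ℕ}
    (hk : row x ≤ k ∧ k ≤ row y ∨ row y ≤ k ∧ k ≤ row x) :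
    ∃ c, row c = k ∧ Reach C x c ∧ Reach C c y := by
  induction h with
  | refl => exact ⟨x, by omega, Relation.ReflTransGen.refl, Relation.ReflTransGen.refl⟩
  | tail hxz h ih =>
    rename_i z y
    have hzy : Reach C z y := Relation.ReflTransGen.single h
    by_cases hy : k = row y
    · exact ⟨y, hy.symm, hxz.tail h, Relation.ReflTransGen.refl⟩
    · obtain ⟨r, hr, rfl, rfl⟩ := h
      have := row_hi_cases hC hr
      obtain ⟨c, hc, h1, h2⟩ := ih (by omega)
      exact ⟨c, hc, h1, h2.trans hzy⟩

/-- Between two positions of a row there are neighbours. -/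
theorem IsComponent.exists_adjoining (hcrit : IsNoncritical C) (hnum : IsNumberedInOrder C)
    (hD : IsComponent C D) {x y : Vertex n} (hx : x ∈ vertices D) (hrow : row x = row y)
    (hn : row x < n) (hne : x ≠ y) (h : Reach D x y) :
    ∃ q, IsAdjoining D x q ∧ Reach D q y := by
  classical
  set S := Finset.univ.filter fun q : Vertex n =>
    row q = row x ∧ q ≠ x ∧ Reach D x q ∧ Reach D q y with hS
  have hSne : S.Nonempty := ⟨y, by
    rw [hS, Finset.mem_filter]
    exact ⟨Finset.mem_univ _, hrow.symm, hne.symm, h, Relation.ReflTransGen.refl⟩⟩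
  -- By the numbering in order, the least column is the position nearest to `x`.
  obtain ⟨q, hq, hmin⟩ := S.exists_min_image col hSne
  rw [hS, Finset.mem_filter] at hq
  obtain ⟨-, hqr, hqx, hxq, hqy⟩ := hq
  have hqV := hxq.mem_vertices hx
  refine ⟨q, ⟨hx, hqV, hqr.symm, hn, hD.implies_gt hcrit hx hqV hqr.symm hn hqx.symm hxq, ?_⟩, hqy⟩
  rintro ⟨c, hc, hcr, h1, h2⟩
  have hsat := hD.exists_satisfies hcrit
  obtain ⟨L, hL⟩ := hsat
  have hxc : c ≠ x := by
    rintro rfl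
    obtain ⟨m, hm, he⟩ := h1 L hL
    rw [sub_self, eq_comm, Nat.cast_eq_zero] at he; omega
  have hcq : c ≠ q := by
    rintro rfl
    obtain ⟨m, hm, he⟩ := h2 L hL
    rw [sub_self, eq_comm, Nat.cast_eq_zero] at he; omega
  have r1 := h1.ge_of_gt.reach ⟨L, hL⟩
  have r2 := h2.ge_of_gt.reach ⟨L, hL⟩
  have hlt := hD.col_lt hcrit hnum hc hqV (by omega) hcq r2
  have := hmin c (by
    rw [hS, Finset.mem_filter]
    exact ⟨Finset.mem_univ _, hcr, hxc, r1, r2.trans hqy⟩)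
  omega

/-- The condition on an adjoining pair in the definition of `𝔉`. -/
def PairCondition (D : Set (Relation n)) (a b : Vertex n) : Prop :=
  (∃ s t : Vertex n, row s = row a + 1 ∧ row t + 1 = row a ∧
    {.gt a s, .ge s b, .ge a t, .gt t b} ⊆ D) ∨
  (∃ s t : Vertex n, row s = row a + 1 ∧ row t = row a + 1 ∧ col s < col t ∧
    {.gt a s, .ge t b} ⊆ D)

/-- If an adjoining pair violates the condition and the pairs in the row below satisfy it, there
is exactly one position between the two. -/
theorem IsComponent.exists_middle (hC : C ⊆ relR n ∪ relR0 n) (hcrit : IsNoncritical C)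
    (hnum : IsNumberedInOrder C) (hD : IsComponent C D) {a b : Vertex n} (hab : IsAdjoining D a b)
    (hnot : ¬ PairCondition D a b)
    (ih : ∀ x y, row x + 1 = row a → IsAdjoining D x y → PairCondition D x y) :
    ∃ m, (row m = row a + 1 ∨ row m + 1 = row a) ∧ Reach D a m ∧ Reach D m b ∧
      ∀ v, Reach D a v → Reach D v b → v = a ∨ v = m ∨ v = b := by
  obtain ⟨ha, hb, hrow, hn, hgt, hno⟩ := hab
  have hDC := hD.1.trans hC
  obtain ⟨L, hL⟩ := hD.exists_satisfies hcrit
  have hne : a ≠ b := by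
    rintro rfl
    obtain ⟨m, hm, he⟩ := hgt L hL
    rw [sub_self, eq_comm, Nat.cast_eq_zero] at he; omega
  have hreach : Reach D a b := hgt.ge_of_gt.reach ⟨L, hL⟩
  have anti : ∀ {u v : Vertex n}, u ∈ vertices D → Reach D u v → Reach D v u → u = v :=
    fun hu h1 h2 => hD.reach_antisymm hC hcrit hnum hu (h1.mem_vertices hu) h1 h2
  have hS : ∀ c, row c = row a → Reach D a c → Reach D c b → c = a ∨ c = b := by
    intro c hc h1 h2
    by_contra! hcon
    have hcV := h1.mem_vertices ha
    exact hno ⟨c, hcV, hc, hD.implies_gt hcrit ha hcV hc.symm hn hcon.1.symm h1,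
      hD.implies_gt hcrit hcV hb (by omega) (by omega) hcon.2 h2⟩
  -- the first step goes down or up and the last step comes from the same side
  have cross : ∀ x y : Vertex n, x ≠ a → y ≠ b → Reach D a x → Reach D x y → Reach D y b →
      (row x ≤ row a ∧ row a ≤ row y ∨ row y ≤ row a ∧ row a ≤ row x) → False := by
    intro x y hxa hyb h1 h2 h3 hr
    obtain ⟨c, hc, h4, h5⟩ := h2.exists_row hDC hr
    rcases hS c hc (h1.trans h4) (h5.trans h3) with rfl | rfl
    · exact hxa (anti ha h1 h4).symm
    · exact hyb (anti hb h5 h3).symm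
  -- Two different positions above would be numbered in order and fulfil the second alternative of
  -- the condition.
  have up : ∀ x y : Vertex n, row x = row a + 1 → row y = row a + 1 → .gt a x ∈ D → .ge y b ∈ D →
      Reach D x y → x = y := by
    intro x y hx hy h1 h2 h3
    by_contra hxy
    have hlt := hD.col_lt hcrit hnum (lo_mem_vertices h1) (hi_mem_vertices h2) (hx.trans hy.symm) hxy h3
    exact hnot (Or.inr ⟨x, y, hx, hy, hlt, by
      rintro r (rfl | rfl)
      exacts [h1, h2]⟩)
  -- Two different positions below would contain an adjoining pair. Its condition supplies a
  -- position of the row of `a` strictly between `a` and `b`, which are neighbours.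
  have down : ∀ x y : Vertex n, row x + 1 = row a → row y + 1 = row a → .ge a x ∈ D → .gt y b ∈ D →
      Reach D x y → x = y := by
    intro x y hx hy h1 h2 h3
    by_contra hxy
    have hxV : x ∈ vertices D := lo_mem_vertices h1
    have hax : Reach D a x := Reach.step h1
    have hyb : Reach D y b := Reach.step h2
    obtain ⟨q, hq, hqy⟩ := hD.exists_adjoining hcrit hnum hxV (by omega) (by omega) hxy h3
    have hqr := hq.2.2.1
    have hs : ∃ s, row s = row a ∧ .gt x s ∈ D ∧ Reach D s q := by
      rcases ih x q hx hq with ⟨s, t, hs, ht, hsub⟩ | ⟨s, t, hs, ht, hst, hsub⟩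
      · have m1 := hsub (show Relation.gt x s ∈ _ by simp)
        have m2 := hsub (show Relation.ge s q ∈ _ by simp)
        exact ⟨s, by omega, m1, Reach.step m2⟩
      · have m1 := hsub (show Relation.gt x s ∈ _ by simp)
        have m2 := hsub (show Relation.ge t q ∈ _ by simp)
        have hsV : s ∈ vertices D := lo_mem_vertices m1
        have htV : t ∈ vertices D := hi_mem_vertices m2
        exact ⟨s, by omega, m1, (hD.reach_of_col_lt hcrit hnum hsV htV (by omega) hst).trans
          (Reach.step m2)⟩
    obtain ⟨s, hsr, m1, hsq⟩ := hs
    have hxs : Reach D x s := Reach.step m1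
    rcases hS s hsr (hax.trans hxs) (hsq.trans (hqy.trans hyb)) with rfl | rfl
    · have := anti ha hax hxs
      subst this; omega
    · have := anti hb hsq (hqy.trans hyb)
      subst this; omega
  -- an upper and a lower bound by single steps
  have first : ∀ x, (∃ r ∈ D, r.hi = a ∧ r.lo = x) →
      (row x = row a + 1 ∧ .gt a x ∈ D) ∨ (row x + 1 = row a ∧ .ge a x ∈ D) := by
    rintro x ⟨r, hr, rfl, rfl⟩
    have := row_hi_cases hDC hr
    by_cases h : row r.lo = row r.hi + 1
    · exact Or.inl ⟨h, eq_gt_of_row hDC hr h ▸ hr⟩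
    · exact Or.inr ⟨by omega, eq_ge_of_row hDC hr (by omega) ▸ hr⟩
  have last : ∀ y, (∃ r ∈ D, r.hi = y ∧ r.lo = b) →
      (row y = row a + 1 ∧ .ge y b ∈ D) ∨ (row y + 1 = row a ∧ .gt y b ∈ D) := by
    rintro x ⟨r, hr, rfl, rfl⟩
    have := row_hi_cases hDC hr
    by_cases h : row r.hi = row r.lo + 1
    · exact Or.inl ⟨by omega, eq_ge_of_row hDC hr h ▸ hr⟩
    · exact Or.inr ⟨by omega, eq_gt_of_row hDC hr (by omega) ▸ hr⟩
  have both : ∀ x y, (∃ r ∈ D, r.hi = a ∧ r.lo = x) → (∃ r ∈ D, r.hi = y ∧ r.lo = b) →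
      Reach D x y → x = y := by
    intro x y hx hy hxy
    have hax : Reach D a x := Relation.ReflTransGen.single hx
    have hyb : Reach D y b := Relation.ReflTransGen.single hy
    rcases first x hx with ⟨h1, h2⟩ | ⟨h1, h2⟩ <;> rcases last y hy with ⟨h3, h4⟩ | ⟨h3, h4⟩
    · exact up x y h1 h3 h2 h4 hxy
    · exact (cross x y (by rintro rfl; omega) (by rintro rfl; omega) hax hxy hyb (by omega)).elim
    · exact (cross x y (by rintro rfl; omega) (by rintro rfl; omega) hax hxy hyb (by omega)).elim
    · exact down x y h1 h3 h2 h4 hxy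
  obtain ⟨m, hm, hmb⟩ := (Relation.ReflTransGen.cases_head hreach).resolve_left hne
  have hm1 := first m hm
  have hmne : m ≠ b := by rintro rfl; omega
  have hstep : ∀ x, (∃ r ∈ D, r.hi = a ∧ r.lo = x) → Reach D x b →
      ∃ r ∈ D, r.hi = x ∧ r.lo = b := by
    intro x hx hxb
    have hxne : x ≠ b := by have := first x hx; rintro rfl; omega
    obtain ⟨y, hxy, hy⟩ := (Relation.ReflTransGen.cases_tail hxb).resolve_left hxne.symm
    rwa [← both x y hx hy hxy] at hy
  -- Two intermediate positions in one row are comparable, hence equal by `both`; one above together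
  -- with one below would be the first alternative of the condition.
  have huniq : ∀ x, (∃ r ∈ D, r.hi = a ∧ r.lo = x) → Reach D x b → x = m := by
    intro x hx hxb
    have e1 := hstep x hx hxb
    have e2 := hstep m hm hmb
    rcases first x hx with ⟨h1, h2⟩ | ⟨h1, h2⟩ <;> rcases hm1 with ⟨h3, h4⟩ | ⟨h3, h4⟩
    · have hxV : x ∈ vertices D := lo_mem_vertices h2
      have hmV : m ∈ vertices D := lo_mem_vertices h4
      rcases hD.reach_total hcrit hxV hmV (by omega) with h | h
      · exact both x m hx e2 h
      · exact (both m x hm e1 h).symm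
    · exfalso
      have l1 := (last x e1).resolve_right (by omega)
      have l2 := (last m e2).resolve_left (by omega)
      refine hnot (Or.inl ⟨x, m, h1, h3, ?_⟩)
      rintro r (rfl | rfl | rfl | rfl)
      exacts [h2, l1.2, h4, l2.2]
    · exfalso
      have l1 := (last x e1).resolve_left (by omega)
      have l2 := (last m e2).resolve_right (by omega)
      refine hnot (Or.inl ⟨m, x, h3, h1, ?_⟩)
      rintro r (rfl | rfl | rfl | rfl)
      exacts [h4, l2.2, h2, l1.2]
    · have hxV : x ∈ vertices D := lo_mem_vertices h2
      have hmV : m ∈ vertices D := lo_mem_vertices h4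
      rcases hD.reach_total hcrit hxV hmV (by omega) with h | h
      · exact both x m hx e2 h
      · exact (both m x hm e1 h).symm
  refine ⟨m, hm1.imp (fun h => h.1) (fun h => h.1), Relation.ReflTransGen.single hm, hmb, ?_⟩
  intro v hav hvb
  rcases Relation.ReflTransGen.cases_head hav with h | ⟨x, hx, hxv⟩
  · exact Or.inl h.symm
  rcases Relation.ReflTransGen.cases_tail hvb with h | ⟨y, hvy, hy⟩
  · exact Or.inr (Or.inr h.symm)
  have hxb : Reach D x b := Relation.ReflTransGen.trans hxv hvb
  obtain rfl := huniq x hx hxb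
  have hxy : x = y := both x y hx hy (Relation.ReflTransGen.trans hxv hvy)
  subst hxy
  have hxV : x ∈ vertices D := by obtain ⟨r, hr, -, rfl⟩ := hx; exact lo_mem_vertices hr
  exact Or.inr (Or.inl (anti hxV hxv hvy).symm)

end Order

variable {n : ℕ} {C D : Set (Relation n)}

/-! ### Strict realizations that violate the commutation relation -/

section Necessity

/-- Integers can be placed at the positions so that exactly linked positions keep an integral
difference. -/
theorem exists_tableau_int_iff_linked (C : Set (Relation n)) (Z : Vertex n → ℤ) :
    ∃ R : Tableau n, (∀ v w, Linked C v w → R v - R w = ((Z v - Z w : ℤ) : ℂ)) ∧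
      ∀ v w, (∃ m : ℤ, R v - R w = m) → Linked C v w := by
  let s : Setoid (Vertex n) := Relation.EqvGen.setoid fun x y => ∃ r ∈ C, r.hi = x ∧ r.lo = y
  let rep : Vertex n → Vertex n := fun v => (Quotient.mk s v).out
  let f : Vertex n → ℕ := fun v => (Fintype.equivFin (Vertex n) (rep v) : ℕ)
  have hf : ∀ v w, f v = f w ↔ Linked C v w := by
    intro v w
    have h1 : f v = f w ↔ rep v = rep w := by
      simp only [f, Fin.val_inj, EmbeddingLike.apply_eq_iff_eq]
    rw [h1]
    simp only [rep, Quotient.out_inj]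
    exact Quotient.eq (r := s)
  -- The imaginary part labels the class of linked positions, so differences between different
  -- classes are not integral.
  refine ⟨fun v => Z v + f v * Complex.I, ?_, ?_⟩
  · intro v w h
    dsimp only
    rw [(hf v w).mpr h]; push_cast; ring
  · rintro v w ⟨m, hm⟩
    refine (hf v w).mp ?_
    have := congrArg Complex.im hm
    simp [sub_eq_zero] at this
    exact_mod_cast this

theorem exists_strictRealization (Z : Vertex n → ℤ)
    (hZ : ∀ r ∈ C, ∃ m : ℕ, Z r.hi - Z r.lo = (r.wt + m : ℕ)) :
    ∃ R : Tableau n, IsStrictRealization C R ∧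
      (∀ v w, Linked C v w → R v - R w = ((Z v - Z w : ℤ) : ℂ)) ∧
      ∀ v w, (∃ m : ℤ, R v - R w = m) → Linked C v w := by
  obtain ⟨R, h1, h2⟩ := exists_tableau_int_iff_linked C Z
  refine ⟨R, ⟨?_, ?_⟩, h1, h2⟩
  · intro r hr
    obtain ⟨m, hm⟩ := hZ r hr
    exact holds_iff.mpr ⟨m, by rw [h1 _ _ (linked_hi_lo hr), hm]; push_cast; rfl⟩
  · intro v w _ hne
    rw [exists_component_iff_linked hne]
    exact ⟨h2 v w, fun h => ⟨_, h1 v w h⟩⟩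

theorem self_mem_tableauxSet {L : Tableau n} (hL : Satisfies C L) : L ∈ tableauxSet C L :=
  ⟨hL, 0, fun _ _ => rfl, fun a => by simp⟩

/-- Equal entries after an integral shift come from an integral difference, hence from positions of
one component, where noncriticality of `C` forbids equality. -/
theorem IsStrictRealization.noncritical (hcrit : IsNoncritical C) {L : Tableau n}
    (hL : IsStrictRealization C L) {R : Tableau n} (hR : R ∈ tableauxSet C L) :
    NoncriticalTableau R := by
  intro a b hab hn hne h
  obtain ⟨hR, z, -, hz⟩ := hR
  obtain ⟨D, hD, ha, hb⟩ := (hL.2 a b hab hne).mp ⟨z b - z a, by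
    have h1 := hz a
    have h2 := hz b
    push_cast; linear_combination -h1 + h2 + h⟩
  exact (hcrit.2 D hD).1 R (fun r hr => hR r (hD.1 hr)) a ha b hb hab hn hne h

theorem IsStrictRealization.isRealization (hcrit : IsNoncritical C) {L : Tableau n}
    (hL : IsStrictRealization C L) : IsRealization C L :=
  ⟨hL.1, fun _ hR => hL.noncritical hcrit hR⟩

theorem IsAdmissible.isStrictlyAdmissible (hcrit : IsNoncritical C) (h : IsAdmissible C) :
    IsStrictlyAdmissible C :=
  fun L hL => h L (hL.isRealization hcrit)

/-- A height function for the order that `C` generates, with one level for the interval of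
`a` and `b`. -/
theorem exists_height (hC : C ⊆ relR n ∪ relR0 n) (hcrit : IsNoncritical C)
    (hnum : IsNumberedInOrder C) (a b : Vertex n) :
    ∃ (q : Vertex n → ℤ) (N : ℤ), (∀ v, q v = N ↔ Reach C a v ∧ Reach C v b) ∧
      ∀ r ∈ C, q r.lo + 1 ≤ q r.hi ∨ q r.lo = N ∧ q r.hi = N := by
  classical
  set h : Vertex n → ℕ := fun v => (Finset.univ.filter fun w => Reach C v w).card with hh
  set N : ℤ := Fintype.card (Vertex n) + 1 with hN
  have hlt : ∀ v, (h v : ℤ) < N := by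
    intro v
    have := Finset.card_le_univ (Finset.univ.filter fun w => Reach C v w)
    simp only [hh, hN]; omega
  have hstep : ∀ r ∈ C, h r.lo < h r.hi := by
    intro r hr
    refine Finset.card_lt_card (Finset.ssubset_iff_subset_ne.mpr ⟨?_, ?_⟩)
    · intro w hw
      rw [Finset.mem_filter] at hw ⊢
      exact ⟨hw.1, Relation.ReflTransGen.trans (Reach.step hr) hw.2⟩
    · intro he
      have hmem : r.hi ∈ Finset.univ.filter fun w => Reach C r.hi w :=
        Finset.mem_filter.mpr ⟨Finset.mem_univ _, Relation.ReflTransGen.refl⟩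
      rw [← he, Finset.mem_filter] at hmem
      exact hi_ne_lo hC hr (reach_antisymm hC hcrit hnum (Reach.step hr) hmem.2)
  -- The number of positions below `v` is strictly monotone and less than `N`. Lifting everything
  -- above `b` past `N` makes room to collapse the interval to the single level `N`.
  refine ⟨fun v => if Reach C v b then if Reach C a v then N else N + 1 + h v else h v, N, ?_, ?_⟩
  · intro v
    have := hlt v
    dsimp only
    split_ifs with h1 h2
    · simp [h1, h2]
    · simp only [h1, h2, false_and, iff_false]; omega
    · simp only [h1, and_false, iff_false]; omega
  · intro r hr
    have h1 := hlt r.lo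
    have h2 := hlt r.hi
    have h3 := hstep r hr
    have h4 : Reach C r.lo b → Reach C r.hi b := fun h => Relation.ReflTransGen.trans (Reach.step hr) h
    have h5 : Reach C a r.hi → Reach C a r.lo := fun h => Relation.ReflTransGen.trans h (Reach.step hr)
    dsimp only
    by_cases c1 : Reach C r.lo b
    · have c2 := h4 c1
      by_cases c3 : Reach C a r.hi
      · simp [c1, c2, c3, h5 c3]
      · by_cases c4 : Reach C a r.lo <;> simp [c1, c2, c3, c4] <;> omega
    · by_cases c2 : Reach C r.hi b <;> by_cases c3 : Reach C a r.hi <;> simp [c1, c2, c3] <;> omega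

/-- If there is exactly one position between two neighbours of a row, and it does not lie in that
row, then `C` is not strictly admissible. -/
theorem not_isStrictlyAdmissible_of_middle (hC : C ⊆ relR n ∪ relR0 n) (hcrit : IsNoncritical C)
    (hnum : IsNumberedInOrder C) {a b m : Vertex n} (hab : row a = row b) (hn : row a < n)
    (hne : a ≠ b) (hm : row m = row a + 1 ∨ row m + 1 = row a) (ham : Reach C a m)
    (hmb : Reach C m b) (hS : ∀ v, Reach C a v → Reach C v b → v = a ∨ v = m ∨ v = b) :
    ¬ IsStrictlyAdmissible C := by
  classical
  intro hadm
  obtain ⟨q, N, hq, hqr⟩ := exists_height hC hcrit hnum a b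
  have hqa : q a = N := (hq a).mpr ⟨Relation.ReflTransGen.refl, Relation.ReflTransGen.trans ham hmb⟩
  have hqb : q b = N := (hq b).mpr ⟨Relation.ReflTransGen.trans ham hmb, Relation.ReflTransGen.refl⟩
  have hqm : q m = N := (hq m).mpr ⟨ham, hmb⟩
  have hqS : ∀ v, q v = N → v = a ∨ v = m ∨ v = b := fun v hv => hS v ((hq v).mp hv).1 ((hq v).mp hv).2
  have hma : m ≠ a := by rintro rfl; omega
  have hmbne : m ≠ b := by rintro rfl; omega
  -- Inside the interval the relations become tight: $l_m=l_b$ if `m` is in the row above, $l_m=l_a$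
  -- if it is in the row below, and $l_a=l_b+1$.
  set ε : Vertex n → ℤ := fun v => if v = a ∨ (v = m ∧ row m + 1 = row a) then 1 else 0 with hε
  have hε01 : ∀ v, 0 ≤ ε v ∧ ε v ≤ 1 := by
    intro v; simp only [hε]; split_ifs <;> omega
  have hεa : ε a = 1 := by simp [hε]
  have hεb : ε b = 0 := by simp [hε, hne.symm, hmbne.symm]
  have hεrow : ∀ v, ε v = 1 → v = a ∨ v = m ∧ row m + 1 = row a := by
    intro v hv
    by_contra hcon
    simp [hε, hcon] at hv
  have hεup : row m = row a + 1 → ε m = 0 := by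
    intro h
    have := hε01 m
    by_contra h0
    rcases hεrow m (by omega) with h | h
    exacts [hma h, by omega]
  have hεdown : row m + 1 = row a → ε m = 1 := by intro h; simp [hε, h]
  -- The factor 3 keeps entries of different levels at distance at least 2, so equality or a
  -- difference of one occurs only within a level. With factor 2 a difference of one could also
  -- arise between neighbouring levels.
  obtain ⟨R, hR, hR1, hR2⟩ := exists_strictRealization (C := C) (fun v => 3 * q v + ε v) (by
    intro r hr
    have e1 := hε01 r.hi
    have e2 := hε01 r.lo
    have hw := r.wt_le_one
    suffices h : (r.wt : ℤ) ≤ 3 * q r.hi + ε r.hi - (3 * q r.lo + ε r.lo) from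
      ⟨(3 * q r.hi + ε r.hi - (3 * q r.lo + ε r.lo) - r.wt).toNat, by push_cast; omega⟩
    rcases hqr r hr with h | ⟨h1, h2⟩
    · omega
    · have hrow := row_hi_of_lt hC hr
      have hrne := hi_ne_lo hC hr
      have back : ∀ {u v : Vertex n}, r.hi = u → r.lo = v → Reach C v u → False := by
        rintro u v rfl rfl h
        exact hrne (reach_antisymm hC hcrit hnum (Reach.step hr) h)
      rw [h1, h2]
      rcases hqS _ h2 with g | g | g <;> rcases hqS _ h1 with g' | g' | g'
      · exact (hrne (g.trans g'.symm)).elim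
      · rw [g, g'] at hrow ⊢
        have := hrow (by omega)
        rcases hm with hm | hm
        · have := hεup hm; omega
        · have := hεdown hm; omega
      · rw [g, g'] at hrow ⊢
        have := hrow (by omega)
        omega
      · exact (back g g' ham).elim
      · exact (hrne (g.trans g'.symm)).elim
      · rw [g, g'] at hrow ⊢
        have := hrow (by omega)
        rcases hm with hm | hm
        · have := hεup hm; omega
        · have := hεdown hm; omega
      · exact (back g g' (Relation.ReflTransGen.trans ham hmb)).elim
      · exact (back g g' hmb).elim
      · exact (hrne (g.trans g'.symm)).elim)
  have hlink : ∀ {u v : Vertex n}, Reach C u v → Linked C u v := by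
    intro u v h
    induction h with
    | refl => exact Relation.EqvGen.refl _
    | tail _ h ih => exact ih.trans _ _ _ (Relation.EqvGen.rel _ _ h)
  have hlab : Linked C a b := hlink (Relation.ReflTransGen.trans ham hmb)
  have key : ∀ (p : ℤ) (v w), R v = R w + p → 3 * q v + ε v = 3 * q w + ε w + p := by
    intro p v w h
    have h1 := hR1 v w (hR2 v w ⟨p, by rw [h]; ring⟩)
    have h2 : ((3 * q v + ε v - (3 * q w + ε w) : ℤ) : ℂ) = (p : ℤ) := by
      rw [← h1, h]; ring
    have := Int.cast_injective h2
    omega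
  have hRm := self_mem_tableauxSet hR.1
  have hnc := hR.noncritical hcrit hRm
  have hRab : R a = R b + 1 := by
    have := hR1 a b hlab
    rw [hqa, hqb, hεa, hεb] at this
    push_cast at this; linear_combination this
  have hdiag := diagScalar_eq_of_isGTModule hC (hadm R hR) hRm (row_pos a) hn
  have hc1 := card_row (n := n) (m := row a) hn.le
  have hc2 := card_row (n := n) (m := row a + 1) hn
  have hc3 := card_row_pred (n := n) (row_pos a) hn
  have hlev : ∀ v w, R v = R w → q v = q w ∧ ε v = ε w := by
    intro v w h
    have := key 0 v w (by rw [h]; simp)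
    have := hε01 v
    have := hε01 w
    omega
  refine diagonal_sum_ne (Finset.univ.filter fun c : Vertex n => row c = row a)
    (Finset.univ.filter fun c : Vertex n => row c = row a + 1)
    (Finset.univ.filter fun c : Vertex n => row c + 1 = row a) R ?_ ?_ (a := a) (b := b) ?_ ?_ hRab
    ?_ ?_ ?_
  · intro v hv w hw hvw
    simp only [Finset.coe_filter, Finset.mem_univ, true_and, Set.mem_ofPred_eq] at hv hw
    by_contra hvwne
    exact hnc v w (by omega) (by omega) hvwne hvw
  · have := row_pos a
    rw [hc1, hc2, hc3]; omega
  · simp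
  · simp [hab]
  -- A difference of one means equal levels and `ε c = 1`; in the row of `a` this leaves only `a`.
  · intro c hc d _ hcd
    rw [Finset.mem_filter] at hc
    have := key 1 c d (by rw [hcd]; simp)
    have := hε01 c
    have := hε01 d
    rcases hεrow c (by omega) with h | ⟨rfl, h⟩
    · exact h
    · omega
  · rcases hm with hm | hm
    · refine Or.inl ⟨m, by simp [hm], ?_, ?_, ?_⟩
      · have := hR1 m b (hlink hmb)
        rw [hqm, hqb, hεup hm, hεb] at this
        simpa [sub_eq_zero] using this
      · intro s hs hsb
        rw [Finset.mem_filter] at hs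
        rcases hqS s ((hlev s b hsb).1.trans hqb) with rfl | h | rfl
        exacts [by omega, h, by omega]
      · intro t ht hta
        rw [Finset.mem_filter] at ht
        rcases hεrow t ((hlev t a hta).2.trans hεa) with rfl | ⟨rfl, h⟩ <;> omega
    · refine Or.inr ⟨m, by simp [hm], ?_, ?_, ?_⟩
      · have := hR1 a m (hlink ham)
        rw [hqm, hqa, hεdown hm, hεa] at this
        exact (by simpa [sub_eq_zero] using this : R a = R m).symm
      · intro t ht hta
        rw [Finset.mem_filter] at ht
        rcases hqS t ((hlev t a hta).1.trans hqa) with rfl | h | rfl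
        exacts [by omega, h, by omega]
      · intro s hs hsb
        rw [Finset.mem_filter] at hs
        rcases hqS s ((hlev s b hsb).1.trans hqb) with rfl | rfl | rfl <;> omega
  · have h := hdiag
    rw [diagValue] at h
    rw [hc1, hc2]
    exact h

/-- Induction on the row: once all lower rows satisfy the condition, a violating pair has a single
position in between. Chains of `C` starting in a component stay there, so the interval is the same
for `C` and for `D`. -/
theorem IsComponent.pairCondition (hC : C ⊆ relR n ∪ relR0 n) (hcrit : IsNoncritical C)
    (hnum : IsNumberedInOrder C) (hadm : IsStrictlyAdmissible C) (hD : IsComponent C D)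
    {a b : Vertex n} (hab : IsAdjoining D a b) : PairCondition D a b := by
  induction hk : row a using Nat.strong_induction_on generalizing a b with
  | _ k ih =>
    by_contra hnot
    obtain ⟨m, hm, ham, hmb, hS⟩ := hD.exists_middle hC hcrit hnum hab hnot
      fun x y hx hxy => ih (row x) (by omega) hxy rfl
    obtain ⟨ha, -, hrow, hn, hgt, -⟩ := hab
    obtain ⟨L, hL⟩ := hD.exists_satisfies hcrit
    have hne : a ≠ b := by
      rintro rfl
      obtain ⟨p, hp, he⟩ := hgt L hL
      rw [sub_self, eq_comm, Nat.cast_eq_zero] at he; omega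
    refine not_isStrictlyAdmissible_of_middle hC hcrit hnum hrow hn hne hm (ham.mono hD.1)
      (hmb.mono hD.1) ?_ hadm
    intro v hav hvb
    obtain ⟨hv, hav⟩ := hD.reach_of_reach ha hav
    exact hS v hav (hD.reach_of_reach hv hvb).2

theorem IsStrictlyAdmissible.isDisconnectedUnionOfF (hC : C ⊆ relR n ∪ relR0 n)
    (hcrit : IsNoncritical C) (hnum : IsNumberedInOrder C) (hadm : IsStrictlyAdmissible C) :
    IsDisconnectedUnionOfF C := by
  refine ⟨{D | IsComponent C D}, ?_, ?_, ?_⟩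
  · intro D hD
    exact ⟨hD.1.trans hC, hD.2.2.1, fun a b hab => hD.pairCondition hC hcrit hnum hadm hab⟩
  · intro D hD E hE hne
    rw [Disconnected, Set.disjoint_left]
    intro v hv hv'
    exact hne (IsComponent.eq_of_mem hD hE hv hv')
  · refine Set.Subset.antisymm (Set.sUnion_subset fun D hD => hD.1) fun r hr => ?_
    obtain ⟨D, hD, hrD⟩ := exists_component hr
    exact ⟨D, hD, hrD⟩

end Necessity

end GelfandTsetlin

theorem mainTheorem3 (n : ℕ) (hn : 2 ≤ n)
    (C : Set (GelfandTsetlin.Relation n))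
    (hC : C ⊆ GelfandTsetlin.relR n ∪ GelfandTsetlin.relR0 n)
    (hcrit : GelfandTsetlin.IsNoncritical C)
    (hnum : GelfandTsetlin.IsNumberedInOrder C) :
    (GelfandTsetlin.IsAdmissible C ↔ GelfandTsetlin.IsDisconnectedUnionOfF C) ∧
    (GelfandTsetlin.IsStrictlyAdmissible C ↔ GelfandTsetlin.IsDisconnectedUnionOfF C) := by
  have h1 := GelfandTsetlin.isAdmissible_of_union hC hcrit hnum
  have h2 : GelfandTsetlin.IsStrictlyAdmissible C → GelfandTsetlin.IsDisconnectedUnionOfF C :=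
    fun h => h.isDisconnectedUnionOfF hC hcrit hnum
  have h3 : GelfandTsetlin.IsAdmissible C → GelfandTsetlin.IsStrictlyAdmissible C :=
    fun h => h.isStrictlyAdmissible hcrit
  exact ⟨⟨fun h => h2 (h3 h), h1⟩, h2, fun h => h3 (h1 h)⟩
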